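/- Let $\mathfrak g$ be a finite-dimensional real Lie algebra, stratified of step $r$: $\mathfrak g=V_1\oplus\cdots\oplus V_r$ with $[V_1,V_{i}]=V_{i+1}$ for $1\le i<r$, $[V_1,V_r]=\{0\}$ and $V_r\neq\{0\}$. Let $G$ be the corresponding Carnot group, that is, the connected, simply connected Lie group with Lie algebra $\mathfrak g$. Its exponential map is a global diffeomorphism, and through it $G$ is identified with the vector space $\mathfrak g$ (exponential coordinates), with unit $e=0$, inverse $x^{-1}=-x$ and the group law given by the Baker–Campbell–Dynkin–Hausdorff formula $$x\star y=x+y+\sum_{k=1}^{r-1}\ \sum_{\substack{n,m\in\mathbb Z_{\ge0}^k\\ n_i+m_i>0\ \forall i}}\frac{(-1)^k}{(k+1)\,m!\,n!\,(|n|+1)}\operatorname{ad}_x^{n_1}\operatorname{ad}_y^{m_1}\cdots\operatorname{ad}_x^{n_k}\operatorname{ad}_y^{m_k}x .$$ For $a>0$ let $D_a:G\to G$ be the dilation, which multiplies the component in $V_i$ by $a^i$. Let $\mathcal H=V_1$ be equipped with an inner product $\langle\cdot,\cdot\rangle$. Let $X_1,X_2,\dots$ be i.i.d. random variables in $\mathcal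 H$ with mean $0$ such that $\Lambda(\lambda)=\log\mathbb E[e^{\langle\lambda,X_1\rangle}]$ is finite for every $\lambda\in\mathcal H$, and let $\Lambda^*(u)=\sup_{v\in\mathcal H}(\langle v,u\rangle-\Lambda(v))\in[0,\infty]$. Assume that either (i) $r=2$ and $X_1$ is sub-Gaussian: for every $v\in\mathcal H$ there is $k\ge 0$ with $\mathbb E[e^{s\langle v,X_1\rangle}]\le e^{ks^2}$ for all $s\in\mathbb R$; or (ii) $r\ge3$ and $X_1$ is bounded: $|X_1|\le R$ almost surely for some $R<\infty$. Let $\mu_n$ be the law of $D_{1/n}(\exp X_1\star\cdots\star\exp X_n)$. For an absolutely continuous path $\gamma:[0,1]\to G$ let $c_\gamma(t)=(L_{\gamma(t)^{-1}})_*\gamma'(t)\in\mathfrak g$ be its Maurer–Cartan form, where $L_g$ is left translation by $g$; $\gamma$ is called horizontal if $c_\gamma(t)\in\mathcal H$ for a.e. $t$. Define $$J(g)=\inf\Big\{\int_0^1\Lambda^*(c_\gamma(t))\,dt:\ \gamma:[0,1]\to G\text{ horizontal},\ \gamma(0)=e,\ \gamma(1)=g\Big\}\in[0,\infty],\qquad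 \inf\emptyset=\infty .$$ Then $(\mu_n)$ satisfies the large deviation principle with rate function $J$: the function $J$ is lower semicontinuous and not identically $\infty$, and for every open $O\subset G$ and every closed $F\subset G$ $$\liminf_{n\to\infty}\frac1n\log\mu_n(O)\ge-\inf_{O}J,\qquad \limsup_{n\to\infty}\frac1n\log\mu_n(F)\le-\inf_{F}J .$$ -/

import Mathlib

open MeasureTheory ProbabilityTheory Filter Topology Set
open scoped ENNReal NNReal RealInnerProductSpace

noncomputable section

/-- A stratified real Lie algebra of step `r` on the finite-dimensional space `E`:
`E = V 1 ⊕ ⋯ ⊕ V r` with `[V 1, V i] = V (i + 1)` for `1 ≤ i < r`, `[V 1, V r] = 0` and `V r ≠ 0`.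
The layers are indexed by `ℕ`, with `V 0 = 0` and `V i = 0` for `i > r`. The inner product of `E`
is used below only through its restriction to the horizontal layer `V 1` (every inner product on
`V 1` is such a restriction), and through the topology of `E`; it is not related to the bracket. -/
structure StratifiedLieAlgebra (E : Type*) [NormedAddCommGroup E] [InnerProductSpace ℝ E]
    (r : ℕ) where
  /-- The Lie bracket. -/
  bracket : E →ₗ[ℝ] E →ₗ[ℝ] E
  bracket_self : ∀ x, bracket x x = 0
  jacobi : ∀ x y z, bracket x (bracket y z) + bracket y (bracket z x) + bracket z (bracket x y) = 0
  /-- The layers of the stratification. -/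
  V : ℕ → Submodule ℝ E
  internal : DirectSum.IsInternal V
  V_zero : V 0 = ⊥
  bracket_V : ∀ i, 1 ≤ i → Submodule.map₂ bracket (V 1) (V i) = V (i + 1)
  V_step : V r ≠ ⊥
  V_of_step_lt : ∀ i, r < i → V i = ⊥

namespace StratifiedLieAlgebra

variable {E : Type*} [NormedAddCommGroup E] [InnerProductSpace ℝ E] {r : ℕ}

/-- The horizontal space `ℋ = V 1`, with the inner product restricted from `E`. -/
abbrev H (S : StratifiedLieAlgebra E r) : Submodule ℝ E := S.V 1

/-- The component `x ↦ x⁽ⁱ⁾` along `E = V 1 ⊕ ⋯ ⊕ V r`. -/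
def component (S : StratifiedLieAlgebra E r) (i : ℕ) (x : E) : S.V i :=
  (LinearEquiv.ofBijective (DirectSum.coeLinearMap S.V) S.internal).symm x i

/-- `ad_x y = [x, y]`. -/
def ad (S : StratifiedLieAlgebra E r) (x : E) : Module.End ℝ E := S.bracket x

/-- The Carnot group of `S` in exponential coordinates of the first kind: it is identified with its
Lie algebra `E` through `exp` (so `exp` is the identity map of `E`, the unit is `0`, the inverse of
`x` is `-x`), with the group law given by the Baker-Campbell-Dynkin-Hausdorff formula
`x ⋆ y = log (eˣ eʸ)`, that is `x + y` plus the sum over `1 ≤ k ≤ r - 1` and over multi-indices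
`n, m` of length `k` with `nᵢ + mᵢ > 0` for all `i` of
`(-1)ᵏ / ((k + 1) m! n! (|n| + 1)) • ad_x^{n₁} ad_y^{m₁} ⋯ ad_x^{n_k} ad_y^{m_k} x`.
Terms with an exponent `≥ r` vanish since `E` is nilpotent of step `r`, so the exponents are taken
in `{0, …, r - 1}`. -/
def mul (S : StratifiedLieAlgebra E r) (x y : E) : E :=
  x + y + ∑ k ∈ Finset.Icc 1 (r - 1),
    ∑ p : (Fin k → Fin r) × (Fin k → Fin r) with ∀ i, 0 < (p.1 i : ℕ) + (p.2 i : ℕ),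
      ((-1 : ℝ) ^ k / (((k : ℝ) + 1) * (∏ i, (Nat.factorial (p.2 i) : ℝ)) *
          (∏ i, (Nat.factorial (p.1 i) : ℝ)) * ((∑ i, ((p.1 i : ℕ) : ℝ)) + 1))) •
        (List.ofFn fun i => S.ad x ^ (p.1 i : ℕ) * S.ad y ^ (p.2 i : ℕ)).prod x

/-- The dilation `D_a`, in exponential coordinates: multiplication by `aⁱ` on `V i`. -/
def dilation (S : StratifiedLieAlgebra E r) (a : ℝ) (x : E) : E :=
  ∑ i ∈ Finset.Icc 1 r, a ^ i • (S.component i x : E)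

/-- The product `exp (x 0) ⋆ exp (x 1) ⋆ ⋯ ⋆ exp (x (n - 1))`. -/
def walk (S : StratifiedLieAlgebra E r) (x : ℕ → S.H) : ℕ → E
  | 0 => 0
  | n + 1 => S.mul (S.walk x n) (x n)

/-- The Maurer-Cartan form `c_γ(t) = (L_{γ(t)⁻¹})_* γ'(t)`: the differential at `γ(t)` of the left
translation by `γ(t)⁻¹ = -γ(t)`, applied to `γ'(t)`. -/
def maurerCartan (S : StratifiedLieAlgebra E r) (γ : ℝ → E) (t : ℝ) : E :=
  fderiv ℝ (fun y => S.mul (-γ t) y) (γ t) (deriv γ t)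

/-- Horizontal paths `γ : [0, 1] → G` (only the values of `γ` on `[0, 1]` matter). -/
def IsHorizontal (S : StratifiedLieAlgebra E r) (γ : ℝ → E) : Prop :=
  AbsolutelyContinuousOnInterval γ 0 1 ∧
    ∀ᵐ t ∂(volume.restrict (Icc (0 : ℝ) 1)), S.maurerCartan γ t ∈ S.H

/-- The rate function `J(g) = inf ∫₀¹ L(c_γ(t)) dt` over the horizontal paths from the unit to `g`,
for `L : ℋ → [0, ∞]`. Here `c_γ(t) ∈ ℋ` for a.e. `t`, so that `c_γ(t)` is its own component
in `ℋ`. -/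
def rate (S : StratifiedLieAlgebra E r) (L : S.H → EReal) (g : E) : ℝ≥0∞ :=
  ⨅ (γ : ℝ → E) (_ : S.IsHorizontal γ ∧ γ 0 = 0 ∧ γ 1 = g),
    ∫⁻ t in Icc (0 : ℝ) 1, (L (S.component 1 (S.maurerCartan γ t))).toENNReal

end StratifiedLieAlgebra

/-- The log-moment generating function `Λ(v) = log 𝔼[exp ⟨v, X⟩]`. -/
def logMGF {Ω F : Type*} [MeasurableSpace Ω] [NormedAddCommGroup F] [InnerProductSpace ℝ F]
    (P : Measure Ω) (X : Ω → F) (v : F) : ℝ :=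
  Real.log (∫ ω, Real.exp ⟪v, X ω⟫ ∂P)

/-- The Legendre transform `Λ*(u) = sup_v (⟨v, u⟩ - Λ(v))`. -/
def legendre {F : Type*} [NormedAddCommGroup F] [InnerProductSpace ℝ F] (Λ : F → ℝ) (u : F) :
    EReal :=
  ⨆ v : F, ((⟪v, u⟫ - Λ v : ℝ) : EReal)

/-- Rate functions: lower semicontinuous and not identically `∞`. -/
def IsRateFunction {M : Type*} [TopologicalSpace M] (I : M → ℝ≥0∞) : Prop :=
  LowerSemicontinuous I ∧ ∃ x, I x ≠ ∞

/-- The large deviation principle for `μ` with rate function `I` (and speed `n`). -/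
def SatisfiesLDP {M : Type*} [TopologicalSpace M] [MeasurableSpace M] (μ : ℕ → Measure M)
    (I : M → ℝ≥0∞) : Prop :=
  IsRateFunction I ∧
  (∀ O : Set M, IsOpen O →
    -(⨅ x ∈ O, (I x : EReal)) ≤ liminf (fun n : ℕ => ENNReal.log (μ n O) / (n : EReal)) atTop) ∧
  (∀ F : Set M, IsClosed F →
    limsup (fun n : ℕ => ENNReal.log (μ n F) / (n : EReal)) atTop ≤ -(⨅ x ∈ F, (I x : EReal)))

end

/-! The argument is carried out in an associative algebra. The adjoint action of the Lie algebra on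
its semidirect product with the grading derivation (`adProd`) is faithful, because the derivation
has no zero eigenvalue, and it raises degrees, so products of $r+1$ images vanish. Through `emb`,
$x\mapsto e^{\rho(x)}$, the Baker–Campbell–Dynkin–Hausdorff law becomes multiplication (`emb_mul`).
Since dilations are automorphisms, the rescaled walk becomes the product of the exponentials of
$\sigma(X_k/n)$, where $\sigma$ is $\rho$ restricted to $\mathcal H$.

A horizontal path becomes a solution of $G'=G\,\sigma(h)$, $G(0)=1$, with control $h$ its
Maurer–Cartan form. By nilpotency this solution is a finite sum of iterated integrals of $h$
(`flow_eq`). Hence $J(g)$ is the least cost $\int\Lambda^*(h)$ of steering the flow to $e^{\rho(g)}$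
(`rate_eq_ctlRate`). The bound $\Lambda(v)\le\kappa|v|^2$ gives $\Lambda^*(u)\ge|u|^2/(4\kappa)$, so
controls of bounded cost are bounded in $L^2$ and have weak limits. The cost is weakly lower
semicontinuous (`lintegral_cost_le_of_weak`) and the endpoint of the flow is weakly continuous
(`tendsto_flow`). This gives lower semicontinuity of the rate, and the lower bounds on
neighbourhoods of closed sets that the upper estimate needs.

For a fixed number $m$ of blocks, the vector of normalized block sums obeys the Gärtner–Ellis bounds
(`eventually_measureReal_closed_le`, `eventually_le_measureReal_open`). Its cost is that of a step
control (`cost_avgFun`), and the product of the $m$ exponentials of block sums depends continuously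
on it. Averaging a control over cells does not raise its cost (Jensen) and preserves its flow in the
limit, so step controls suffice for the lower bound.

It remains to see that replacing the $n$ factors by $m$ block exponentials makes an error larger
than $\delta$ only with probability $e^{-nK}$, for any $K$, once $m$ is large. For bounded
increments the error is deterministically $O(1/m)$ (`norm_expProd_sub_expProd_blockSum_le`). In step
two it is exactly half the sum of the commutators inside the blocks, a quadratic form controlled by
an exponential supermartingale (`eventually_measureReal_bilinear_le`). -/

noncomputable section

/-! ### Truncated power series identities -/

namespace NilpotentSeries

open Polynomial

/-- The truncation of `(e^X - 1) / X`. -/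
def phi (K : ℕ) : ℝ[X] := ∑ k ∈ Finset.range K, C (((k + 1).factorial : ℝ)⁻¹) * X ^ k

/-- The truncation of `log (1 + X) / X`. -/
def psi (K : ℕ) : ℝ[X] := ∑ k ∈ Finset.range K, C ((-1 : ℝ) ^ k / (k + 1)) * X ^ k

/-- A truncated form of $(e^X-1)'=1+(e^X-1)$, whose defect is a single term of top degree. -/
theorem derivative_X_mul_phi (K : ℕ) :
    derivative (X * phi (K + 1)) = 1 + X * phi (K + 1) - C (((K + 1).factorial : ℝ)⁻¹) * X ^ (K + 1) := by
  have h : ∀ K, X * phi K = ∑ k ∈ Finset.range K, C (((k + 1).factorial : ℝ)⁻¹) * X ^ (k + 1) := by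
    intro K
    rw [phi, Finset.mul_sum]
    exact Finset.sum_congr rfl fun k _ => by ring
  rw [h]
  induction K with
  | zero => simp
  | succ K ih =>
    rw [Finset.sum_range_succ, derivative_add, ih]
    have h2 : (((K + 1 + 1).factorial : ℝ)⁻¹) * ((K : ℝ) + 1 + 1) = ((K + 1).factorial : ℝ)⁻¹ := by
      rw [Nat.factorial_succ (K + 1)]
      push_cast
      have : ((K + 1).factorial : ℝ) ≠ 0 := by positivity
      have : ((K : ℝ) + 1 + 1) ≠ 0 := by positivity
      field_simp
    simp only [derivative_C_mul_X_pow]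
    push_cast
    rw [h2]
    ring

theorem X_pow_dvd_of_derivative {K : ℕ} {p : ℝ[X]} (h0 : p.coeff 0 = 0)
    (h : X ^ K ∣ derivative p) : X ^ (K + 1) ∣ p := by
  rw [X_pow_dvd_iff] at h ⊢
  intro d hd
  rcases d with _ | d
  · exact h0
  · have := h d (by omega)
    rw [coeff_derivative] at this
    have h3 : ((d : ℝ) + 1) ≠ 0 := by positivity
    exact (mul_eq_zero.mp this).resolve_right h3

/-- This is $\log(1+u)=X$ for $u=e^X-1$, divided by $X$. Multiplied by $X$ and differentiated, the
logarithm becomes the geometric series $\sum(-u)^k$ times $u'\approx1+u$, which telescopes to $1$ up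
to terms of order $K+1$ (with $K$ shifted by one). -/
theorem X_pow_dvd_psi_comp_mul_phi (K : ℕ) :
    X ^ K ∣ (psi K).comp (X * phi K) * phi K - 1 := by
  rcases K with _ | K
  · simp
  set u := X * phi (K + 1) with hu
  have hcomp : (psi (K + 1)).comp u = ∑ k ∈ Finset.range (K + 1), C ((-1 : ℝ) ^ k / (k + 1)) * u ^ k := by
    simp [psi, Polynomial.comp, Polynomial.eval₂_finsetSum]
  have hX : X ^ (K + 1 + 1) ∣ X * ((psi (K + 1)).comp u * phi (K + 1) - 1) := by
    have e : X * ((psi (K + 1)).comp u * phi (K + 1) - 1) =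
        ∑ k ∈ Finset.range (K + 1), C ((-1 : ℝ) ^ k / (k + 1)) * u ^ (k + 1) - X := by
      rw [mul_sub, mul_one, mul_left_comm, ← hu, hcomp, Finset.sum_mul]
      congr 1
      exact Finset.sum_congr rfl fun k _ => by ring
    rw [e]
    apply X_pow_dvd_of_derivative
    · simp [hu, Polynomial.coeff_zero_eq_eval_zero, Polynomial.eval_finsetSum]
    · have e2 : derivative (∑ k ∈ Finset.range (K + 1), C ((-1 : ℝ) ^ k / (k + 1)) * u ^ (k + 1) - X)
          = (∑ k ∈ Finset.range (K + 1), (-u) ^ k) * derivative u - 1 := by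
        rw [derivative_sub, derivative_X, derivative_sum, Finset.sum_mul]
        congr 1
        refine Finset.sum_congr rfl fun k _ => ?_
        rw [derivative_C_mul, derivative_pow]
        have : ((-1 : ℝ) ^ k / (k + 1)) * ((k + 1 : ℕ) : ℝ) = (-1) ^ k := by
          push_cast
          have : ((k : ℝ) + 1) ≠ 0 := by positivity
          field_simp
        simp only [Nat.add_sub_cancel]
        rw [← mul_assoc, ← mul_assoc, ← C_mul, this, neg_pow u]
        simp
      have e3 : (∑ k ∈ Finset.range (K + 1), (-u) ^ k) * (1 + u) = 1 - (-u) ^ (K + 1) := by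
        have := geom_sum_mul_neg (-u) (K + 1)
        rwa [sub_neg_eq_add] at this
      rw [e2, hu, derivative_X_mul_phi, ← hu, mul_sub, e3]
      have : X ^ (K + 1) ∣ (-u) ^ (K + 1) := by
        rw [neg_pow, hu, mul_pow]
        exact Dvd.dvd.mul_left (Dvd.intro _ rfl) _
      have h4 : X ^ (K + 1) ∣ (∑ k ∈ Finset.range (K + 1), (-u) ^ k) *
          (C (((K + 1).factorial : ℝ)⁻¹) * X ^ (K + 1)) :=
        Dvd.dvd.mul_left (Dvd.dvd.mul_left dvd_rfl _) _
      have : (1 : ℝ[X]) - (-u) ^ (K + 1) - (∑ k ∈ Finset.range (K + 1), (-u) ^ k) *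
          (C (((K + 1).factorial : ℝ)⁻¹) * X ^ (K + 1)) - 1 = -((-u) ^ (K + 1)) -
          (∑ k ∈ Finset.range (K + 1), (-u) ^ k) * (C (((K + 1).factorial : ℝ)⁻¹) * X ^ (K + 1)) := by
        ring
      rw [this]
      exact dvd_sub ((dvd_neg).mpr ‹_›) h4
  rw [pow_succ', mul_dvd_mul_iff_left X_ne_zero] at hX
  exact hX

variable {A : Type*} [Ring A] [Algebra ℝ A]

theorem aeval_eq_zero_of_dvd {K : ℕ} {a : A} (ha : a ^ K = 0) {p : ℝ[X]} (h : X ^ K ∣ p) :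
    aeval a p = 0 := by
  obtain ⟨q, rfl⟩ := h
  simp [ha]

theorem commute_aeval_aeval (a : A) (p q : ℝ[X]) : Commute (aeval a p) (aeval a q) := by
  rw [Commute, SemiconjBy, ← map_mul, mul_comm, map_mul]

/-- The power series identity is exact on nilpotent elements. It serves twice: to show that $\log$
inverts $\exp$, and to invert the derivative of $\exp$. -/
theorem aeval_psi_mul_aeval_phi {K : ℕ} {a : A} (ha : a ^ K = 0) :
    aeval (a * aeval a (phi K)) (psi K) * aeval a (phi K) = 1 := by
  have := aeval_eq_zero_of_dvd ha (X_pow_dvd_psi_comp_mul_phi K)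
  rw [map_sub, map_mul, aeval_comp, map_mul, aeval_X, map_one, sub_eq_zero] at this
  exact this

theorem aeval_phi (K : ℕ) (a : A) :
    aeval a (phi K) = ∑ k ∈ Finset.range K, (((k + 1).factorial : ℝ)⁻¹) • a ^ k := by
  simp [phi, Algebra.smul_def]

theorem aeval_psi (K : ℕ) (a : A) :
    aeval a (psi K) = ∑ k ∈ Finset.range K, ((-1 : ℝ) ^ k / (k + 1)) • a ^ k := by
  simp only [psi, map_sum, map_mul, aeval_C, map_pow, aeval_X, Algebra.smul_def]

/-- The truncated logarithm `log (1 + u)`. -/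
def logOneAdd (K : ℕ) (u : A) : A := u * aeval u (psi K)

end NilpotentSeries

/-! ### The exponential of nilpotent elements -/

section Exp

variable {A : Type*} [NormedRing A] [NormedAlgebra ℝ A]

open NormedSpace NilpotentSeries

theorem exp_add_real [CompleteSpace A] {x y : A} (h : Commute x y) : exp (x + y) = exp x * exp y :=
  exp_add_of_commute_of_mem_ball (𝕂 := ℝ) h
    ((expSeries_radius_eq_top ℝ A).symm ▸ edist_lt_top _ _)
    ((expSeries_radius_eq_top ℝ A).symm ▸ edist_lt_top _ _)

theorem exp_mul_exp_neg_real [CompleteSpace A] (x : A) : exp x * exp (-x) = 1 := by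
  rw [← exp_add_real (Commute.refl x).neg_right, add_neg_cancel, exp_zero]

theorem exp_neg_mul_exp_real [CompleteSpace A] (x : A) : exp (-x) * exp x = 1 := by
  rw [← exp_add_real (Commute.refl x).neg_left, neg_add_cancel, exp_zero]

theorem continuous_exp_real [CompleteSpace A] : Continuous (exp : A → A) := by
  let _ := NormedAlgebra.restrictScalars ℚ ℝ A
  exact exp_continuous

theorem exp_eq_sum_of_pow_eq_zero {a : A} {K : ℕ} (ha : a ^ K = 0) :
    exp a = ∑ n ∈ Finset.range K, ((n.factorial : ℝ)⁻¹) • a ^ n := by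
  rw [exp_eq_tsum ℝ]
  refine tsum_eq_sum fun n hn => ?_
  rw [pow_eq_zero_of_le (not_lt.mp (by simpa using hn)) ha, smul_zero]

theorem exp_eq_one_add {a : A} {K : ℕ} (ha : a ^ K = 0) :
    exp a = 1 + a * Polynomial.aeval a (phi K) := by
  rw [exp_eq_sum_of_pow_eq_zero (pow_eq_zero_of_le (Nat.le_succ K) ha), Finset.sum_range_succ',
    aeval_phi, Finset.mul_sum, add_comm]
  simp [pow_succ']

theorem logOneAdd_exp {a : A} {K : ℕ} (ha : a ^ K = 0) : logOneAdd K (exp a - 1) = a := by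
  rw [logOneAdd, exp_eq_one_add ha, add_sub_cancel_left, mul_assoc]
  have hc : Commute (Polynomial.aeval a (phi K))
      (Polynomial.aeval (a * Polynomial.aeval a (phi K)) (psi K)) := by
    have : a * Polynomial.aeval a (phi K) = Polynomial.aeval a (Polynomial.X * phi K) := by simp
    rw [this, ← Polynomial.aeval_comp]
    exact commute_aeval_aeval _ _ _
  rw [hc.eq, aeval_psi_mul_aeval_phi ha, mul_one]

end Exp

/-! ### The derivative of the exponential -/

section Dexp

variable {A : Type*} [NormedRing A] [NormedAlgebra ℝ A]

/-- `adL Z B = Z B - B Z`. -/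
def adL (Z : A) : A →L[ℝ] A := ContinuousLinearMap.mul ℝ A Z - (ContinuousLinearMap.mul ℝ A).flip Z

@[simp] theorem adL_apply (Z B : A) : adL Z B = Z * B - B * Z := rfl

theorem commute_mul_flip (Z : A) :
    Commute (ContinuousLinearMap.mul ℝ A Z) ((ContinuousLinearMap.mul ℝ A).flip Z) := by
  ext B
  simp [mul_assoc]

theorem mul_pow_apply (Z B : A) (n : ℕ) : (ContinuousLinearMap.mul ℝ A Z ^ n) B = Z ^ n * B := by
  induction n generalizing B with
  | zero => simp
  | succ n ih => rw [pow_succ, mul_apply_eq_comp, ih]; simp [pow_succ, mul_assoc]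

theorem flip_pow_apply (Z B : A) (n : ℕ) :
    ((ContinuousLinearMap.mul ℝ A).flip Z ^ n) B = B * Z ^ n := by
  induction n generalizing B with
  | zero => simp
  | succ n ih => rw [pow_succ, mul_apply_eq_comp, ih]; simp [pow_succ', mul_assoc]

/-- Left and right multiplication by $Z$ commute and are nilpotent, so their difference is nilpotent
by the binomial formula. -/
theorem adL_pow_eq_zero {Z : A} {N : ℕ} (hZ : Z ^ N = 0) : adL Z ^ (2 * N) = 0 := by
  rw [adL, sub_eq_add_neg, (commute_mul_flip Z).neg_right.add_pow]
  refine Finset.sum_eq_zero fun i _ => ?_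
  rcases le_total N i with h | h
  · have : ContinuousLinearMap.mul ℝ A Z ^ i = 0 := by
      ext B; rw [mul_pow_apply, pow_eq_zero_of_le h hZ, zero_mul]; rfl
    simp [this]
  · have : (-(ContinuousLinearMap.mul ℝ A).flip Z) ^ (2 * N - i) = 0 := by
      rw [neg_pow]
      have : ((ContinuousLinearMap.mul ℝ A).flip Z) ^ (2 * N - i) = 0 := by
        ext B; rw [flip_pow_apply, pow_eq_zero_of_le (show N ≤ 2 * N - i by omega) hZ, mul_zero]; rfl
      rw [this, mul_zero]
    simp [this]

theorem pow_mul_eq_sum_adL (Z B : A) (n : ℕ) :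
    Z ^ n * B = ∑ k ∈ Finset.range (n + 1), (n.choose k : ℝ) • ((adL Z ^ k) B * Z ^ (n - k)) := by
  have hc : Commute (adL Z) ((ContinuousLinearMap.mul ℝ A).flip Z) :=
    (commute_mul_flip Z).sub_left (Commute.refl _)
  have h := hc.add_pow n
  have e : adL Z + (ContinuousLinearMap.mul ℝ A).flip Z = ContinuousLinearMap.mul ℝ A Z := by
    simp [adL]
  rw [e] at h
  rw [← mul_pow_apply, h, _root_.sum_apply]
  refine Finset.sum_congr rfl fun k _ => ?_
  have hn : ∀ (m : ℕ) (T : A →L[ℝ] A), T * (m : A →L[ℝ] A) = (m : ℝ) • T := by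
    intro m T
    rw [← nsmul_eq_mul']; ext B; simp [Nat.cast_smul_eq_nsmul]
  rw [hn, (hc.pow_pow k (n - k)).eq]
  rw [_root_.smul_apply, mul_apply_eq_comp, flip_pow_apply]

/-- The left side is the derivative of $Z\mapsto Z^n$ in the direction $B$. Moving $B$ to the front
produces iterated commutators, and the coefficients add up by Pascal's rule. -/
theorem sum_pow_mul_pow_eq_sum_adL (Z B : A) (n : ℕ) :
    ∑ i ∈ Finset.range n, Z ^ (n.pred - i) * B * Z ^ i =
      ∑ k ∈ Finset.range n, (n.choose (k + 1) : ℝ) • ((adL Z ^ k) B * Z ^ (n - 1 - k)) := by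
  induction n with
  | zero => simp
  | succ n ih =>
    have e1 : ∑ i ∈ Finset.range (n + 1), Z ^ ((n + 1).pred - i) * B * Z ^ i =
        (∑ i ∈ Finset.range n, Z ^ (n.pred - i) * B * Z ^ i) * Z + Z ^ n * B := by
      rw [Finset.sum_range_succ', Finset.sum_mul]
      congr 1
      · refine Finset.sum_congr rfl fun i hi => ?_
        rw [show (n + 1).pred - (i + 1) = n.pred - i by simp; omega, pow_succ, ← mul_assoc]
      · simp
    have e2 : (∑ k ∈ Finset.range n, (n.choose (k + 1) : ℝ) • ((adL Z ^ k) B * Z ^ (n - 1 - k))) * Z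
        = ∑ k ∈ Finset.range (n + 1), (n.choose (k + 1) : ℝ) • ((adL Z ^ k) B * Z ^ (n - k)) := by
      rw [Finset.sum_range_succ, Nat.choose_succ_self, Nat.cast_zero, zero_smul, add_zero,
        Finset.sum_mul]
      refine Finset.sum_congr rfl fun k hk => ?_
      have : n - k = (n - 1 - k) + 1 := by have := Finset.mem_range.mp hk; omega
      rw [this, pow_succ, smul_mul_assoc, mul_assoc]
    rw [e1, ih, e2, pow_mul_eq_sum_adL, ← Finset.sum_add_distrib]
    refine Finset.sum_congr rfl fun k _ => ?_
    rw [← add_smul, Nat.choose_succ_succ, add_tsub_cancel_right]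
    push_cast
    rw [add_comm]

theorem sum_antidiagonal_eq_sum_sum {M : Type*} [AddCommMonoid M] (g : ℕ → ℕ → M) (I J N : ℕ)
    (hN : I + J ≤ N) (hI : ∀ i j, I ≤ i → g i j = 0) (hJ : ∀ i j, J ≤ j → g i j = 0) :
    ∑ n ∈ Finset.range N, ∑ p ∈ Finset.HasAntidiagonal.antidiagonal n, g p.1 p.2 =
      ∑ i ∈ Finset.range I, ∑ j ∈ Finset.range J, g i j := by
  rw [← Finset.sum_product', Finset.sum_sigma']
  refine Finset.sum_bij_ne_zero (fun p _ _ => p.2) ?_ ?_ ?_ ?_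
  · rintro ⟨n, i, j⟩ _ hne
    simp only [Finset.mem_product, Finset.mem_range]
    exact ⟨not_le.mp fun h => hne (hI _ _ h), not_le.mp fun h => hne (hJ _ _ h)⟩
  · rintro ⟨n, i, j⟩ h _ ⟨n', i', j'⟩ h' _ he
    simp only [Finset.mem_sigma, Finset.HasAntidiagonal.mem_antidiagonal] at h h' he
    obtain ⟨rfl, rfl⟩ := Prod.mk.inj he
    obtain rfl : n = n' := by omega
    rfl
  · rintro ⟨i, j⟩ h hne
    simp only [Finset.mem_product, Finset.mem_range] at h
    exact ⟨⟨i + j, i, j⟩, by simp; omega, hne, rfl⟩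
  · intros; rfl

open NormedSpace NilpotentSeries

/-- The derivative of `s ↦ exp (Z s)`, for nilpotent `Z s`. -/
theorem hasDerivAt_exp_nilpotent {Z : ℝ → A} {Z' : A} {t : ℝ} {N : ℕ} (hN : ∀ s, Z s ^ N = 0)
    (hZ : HasDerivAt Z Z' t) :
    HasDerivAt (fun s => exp (Z s))
      (Polynomial.aeval (adL (Z t)) (phi (2 * N)) Z' * exp (Z t)) t := by
  -- The term of index $0$ has zero derivative; the remaining $3N$ terms cover all pairs $(i,j)$
  -- with $i<2N$, $j<N$, the only ones for which $\operatorname{ad}^i$ and $Z^j$ can both be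
  -- nonzero.
  have h1 : (fun s => exp (Z s)) =
      fun s => ∑ n ∈ Finset.range (3 * N + 1), ((n.factorial : ℝ)⁻¹) • Z s ^ n := by
    ext s
    exact exp_eq_sum_of_pow_eq_zero (pow_eq_zero_of_le (by omega) (hN s))
  have h2 : HasDerivAt (fun s => ∑ n ∈ Finset.range (3 * N + 1), ((n.factorial : ℝ)⁻¹) • Z s ^ n)
      (∑ n ∈ Finset.range (3 * N + 1), ((n.factorial : ℝ)⁻¹) •
        ∑ i ∈ Finset.range n, Z t ^ (n.pred - i) * Z' * Z t ^ i) t :=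
    HasDerivAt.fun_sum fun n _ => (hZ.fun_pow' n).fun_const_smul _
  rw [h1]
  convert! h2 using 1
  set g : ℕ → ℕ → A := fun i j => (((i + 1).factorial : ℝ)⁻¹ * (j.factorial : ℝ)⁻¹) •
    ((adL (Z t) ^ i) Z' * Z t ^ j) with hg
  have hgI : ∀ i j, 2 * N ≤ i → g i j = 0 := fun i j h => by
    simp only [hg, pow_eq_zero_of_le h (adL_pow_eq_zero (hN t)), _root_.zero_apply, zero_mul,
      smul_zero]
  have hgJ : ∀ i j, N ≤ j → g i j = 0 := fun i j h => by
    simp [hg, pow_eq_zero_of_le h (hN t)]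
  rw [Finset.sum_range_succ']
  simp only [Finset.range_zero, Finset.sum_empty, smul_zero, add_zero]
  have h3 : ∀ n, (((n + 1).factorial : ℝ)⁻¹) • ∑ i ∈ Finset.range (n + 1),
      Z t ^ ((n + 1).pred - i) * Z' * Z t ^ i = ∑ p ∈ Finset.HasAntidiagonal.antidiagonal n, g p.1 p.2 := by
    intro n
    rw [sum_pow_mul_pow_eq_sum_adL, Finset.Nat.sum_antidiagonal_eq_sum_range_succ g, Finset.smul_sum]
    refine Finset.sum_congr rfl fun k hk => ?_
    have hk' : k ≤ n := by have := Finset.mem_range.mp hk; omega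
    rw [smul_smul, hg]
    congr 1
    rw [Nat.cast_choose ℝ (show k + 1 ≤ n + 1 by omega)]
    have : ((n + 1).factorial : ℝ) ≠ 0 := by positivity
    rw [show n + 1 - (k + 1) = n - k by omega]
    field_simp
  rw [Finset.sum_congr rfl fun n _ => h3 n, sum_antidiagonal_eq_sum_sum g (2 * N) N _ (by omega) hgI hgJ,
    exp_eq_sum_of_pow_eq_zero (hN t), aeval_phi, _root_.sum_apply, Finset.sum_mul_sum]
  refine Finset.sum_congr rfl fun i _ => Finset.sum_congr rfl fun j _ => ?_
  rw [_root_.smul_apply, smul_mul_smul_comm]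

variable [CompleteSpace A]

/-- The curve $e^{-sZ}\,(e^{s\operatorname{ad}Z}B)\,e^{sZ}$ has zero derivative. -/
theorem exp_adL_apply (Z B : A) : exp (adL Z) B = exp Z * B * exp (-Z) := by
  have hd : ∀ s : ℝ, HasDerivAt (fun s : ℝ => exp (s • (-Z)) * (exp (s • adL Z) B) * exp (s • Z)) 0 s := by
    intro s
    have h1 := hasDerivAt_exp_smul_const (𝕂 := ℝ) (-Z) s
    have h2 := (hasDerivAt_exp_smul_const' (𝕂 := ℝ) (adL Z) s).clm_apply (hasDerivAt_const s B)
    have h3 := hasDerivAt_exp_smul_const' (𝕂 := ℝ) Z s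
    convert! (h1.mul h2).mul h3 using 1
    simp only [map_zero, mul_apply_eq_comp, adL_apply]
    simp only [Pi.mul_apply]
    noncomm_ring
  have hz : exp ((0 : ℝ) • adL Z) B = B := by
    rw [show (0 : ℝ) • adL Z = 0 by ext; simp, exp_zero]
    rfl
  have hc := is_const_of_deriv_eq_zero (fun s => (hd s).differentiableAt) (fun s => (hd s).deriv) 1 0
  simp only [one_smul, zero_smul, exp_zero, one_mul, mul_one, hz] at hc
  calc exp (adL Z) B = (exp Z * exp (-Z)) * exp (adL Z) B * (exp Z * exp (-Z)) := by
        rw [exp_mul_exp_neg_real]; simp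
    _ = exp Z * (exp (-Z) * exp (adL Z) B * exp Z) * exp (-Z) := by simp only [mul_assoc]
    _ = _ := by rw [hc]

/-- Along the segment $su$, the product $e^{-\log(1+su)}(1+su)$ is constant: everything commutes,
and the derivative of the logarithm times $1+su$ is $u$. -/
theorem exp_logOneAdd {u : A} {K : ℕ} (hu : u ^ K = 0) : exp (logOneAdd K u) = 1 + u := by
  have e : ∀ s : ℝ, logOneAdd K (s • u) =
      ∑ k ∈ Finset.range K, ((-1 : ℝ) ^ k / (k + 1)) • s ^ (k + 1) • u ^ (k + 1) := by
    intro s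
    rw [logOneAdd, aeval_psi, Finset.mul_sum]
    refine Finset.sum_congr rfl fun k _ => ?_
    rw [mul_smul_comm, ← pow_succ', smul_pow]
  set l : ℝ → A := fun s => logOneAdd K (s • u) with hl
  set l' : ℝ → A := fun s => ∑ k ∈ Finset.range K, (-s) ^ k • u ^ (k + 1) with hl'
  have hd : ∀ s, HasDerivAt l (l' s) s := by
    intro s
    have : l = fun s => ∑ k ∈ Finset.range K, ((-1 : ℝ) ^ k / (k + 1)) • s ^ (k + 1) • u ^ (k + 1) :=
      funext e
    rw [this]
    refine HasDerivAt.fun_sum fun k _ => ?_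
    have := ((hasDerivAt_pow (k + 1) s).smul_const (u ^ (k + 1))).fun_const_smul ((-1 : ℝ) ^ k / (k + 1))
    convert! this using 1
    rw [smul_smul]
    congr 1
    have : ((k : ℝ) + 1) ≠ 0 := by positivity
    rw [neg_pow]
    push_cast
    field_simp
  have hln : ∀ s, l s ^ K = 0 := by
    intro s
    change (logOneAdd K (s • u)) ^ K = 0
    rw [logOneAdd]
    have : Commute (s • u) (Polynomial.aeval (s • u) (psi K)) := by
      simpa using commute_aeval_aeval (s • u) Polynomial.X (psi K)
    rw [this.mul_pow, smul_pow, hu]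
    simp
  have hcu : ∀ s, Commute u (l s) := fun s => by
    change Commute u (logOneAdd K (s • u))
    rw [e]
    exact Commute.sum_right _ _ _ fun k _ => (((Commute.refl u).pow_right _).smul_right _).smul_right _
  have hcl : ∀ s, Commute (l s) (l' s) := fun s => by
    rw [hl']
    exact Commute.sum_right _ _ _ fun k _ => (((hcu s).symm.pow_right _)).smul_right _
  -- The commutator of $l$ and $l'$ vanishes, so only the constant term of the series acts.
  have had : ∀ s, Polynomial.aeval (adL (-l s)) (phi (2 * K)) (-l' s) = - l' s := by
    intro s
    have h0 : adL (-l s) (-l' s) = 0 := by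
      simp [(hcl s).eq]
    rcases K with _ | K
    · simp [hl']
    · rw [aeval_phi, _root_.sum_apply, show 2 * (K + 1) = (2 * K + 1) + 1 by ring,
        Finset.sum_range_succ', Finset.sum_eq_zero]
      · simp
      · intro k _
        rw [_root_.smul_apply, pow_succ, mul_apply_eq_comp, h0, map_zero,
          smul_zero]
  have hq : ∀ s, HasDerivAt (fun s : ℝ => exp (-l s) * (1 + s • u)) 0 s := by
    intro s
    have h1 := hasDerivAt_exp_nilpotent (Z := fun s => -l s) (N := K)
      (fun s => by rw [neg_pow, hln, mul_zero]) (hd s).fun_neg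
    have h2 : HasDerivAt (fun s : ℝ => 1 + s • u) u s := by
      simpa using ((hasDerivAt_id s).smul_const u).const_add 1
    convert! h1.mul h2 using 1
    rw [had s]
    have hce : Commute (l' s) (exp (-l s)) := by
      rw [exp_eq_sum_of_pow_eq_zero (K := K) (by rw [neg_pow, hln, mul_zero])]
      exact Commute.sum_right _ _ _ fun k _ => (((hcl s).symm.neg_right).pow_right _).smul_right _
    have hgeo : l' s * (1 + s • u) = u := by
      have e1 : l' s = (∑ k ∈ Finset.range K, (-(s • u)) ^ k) * u := by
        rw [hl', Finset.sum_mul]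
        refine Finset.sum_congr rfl fun k _ => ?_
        rw [← neg_smul, smul_pow, smul_mul_assoc, ← pow_succ]
      have e2 := geom_sum_mul_neg (-(s • u)) K
      rw [sub_neg_eq_add, neg_pow, smul_pow, hu, smul_zero, mul_zero, sub_zero] at e2
      have hc : Commute u (1 + s • u) := (Commute.one_right u).add_right ((Commute.refl u).smul_right s)
      rw [e1, mul_assoc, hc.eq, ← mul_assoc, e2, one_mul]
    rw [neg_mul, hce.eq, neg_mul, mul_assoc, hgeo, neg_add_cancel]
  have hc := is_const_of_deriv_eq_zero (fun s => (hq s).differentiableAt) (fun s => (hq s).deriv) 1 0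
  simp only [hl, one_smul, zero_smul, add_zero, mul_one] at hc
  have h0 : logOneAdd K (0 : A) = 0 := by simp [logOneAdd]
  rw [h0, neg_zero, exp_zero] at hc
  calc exp (logOneAdd K u) = exp (logOneAdd K u) * (exp (-logOneAdd K u) * (1 + u)) := by
        rw [hc, mul_one]
    _ = 1 + u := by rw [← mul_assoc, exp_mul_exp_neg_real, one_mul]

/-- The differential equation of `t ↦ log (exp (t X) exp Y)`. -/
theorem exists_log_exp_mul_exp {X Y : A} {N : ℕ} (hY : Y ^ N = 0)
    (hW : ∀ t : ℝ, (exp (t • X) * exp Y - 1) ^ N = 0) :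
    ∃ Z : ℝ → A, Z 0 = Y ∧ (∀ t, exp (Z t) = exp (t • X) * exp Y) ∧
      ∀ t, HasDerivAt Z ((∑ k ∈ Finset.range (2 * N), ((-1 : ℝ) ^ k / (k + 1)) •
        (exp (t • adL X) * exp (adL Y) - 1) ^ k) X) t := by
  set W : ℝ → A := fun t => exp (t • X) * exp Y with hWdef
  have hWd : ∀ t, HasDerivAt W (X * W t) t := fun t => by
    have := (hasDerivAt_exp_smul_const' (𝕂 := ℝ) X t).mul_const (exp Y)
    rwa [mul_assoc] at this
  set Z : ℝ → A := fun t => logOneAdd N (W t - 1) with hZdef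
  have hZexp : ∀ t, exp (Z t) = W t := fun t => by
    rw [hZdef]; simp only; rw [exp_logOneAdd (hW t), add_sub_cancel]
  have hZN : ∀ t, Z t ^ N = 0 := by
    intro t
    simp only [hZdef, logOneAdd]
    have : Commute (W t - 1) (Polynomial.aeval (W t - 1) (psi N)) := by
      simpa using commute_aeval_aeval (W t - 1) Polynomial.X (psi N)
    rw [this.mul_pow, hW]
    simp
  have hdiff : ∀ t, DifferentiableAt ℝ Z t := by
    intro t
    have h1 : DifferentiableAt ℝ (fun t => W t - 1) t := (hWd t).differentiableAt.sub_const 1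
    have : Z = fun t => (W t - 1) * ∑ k ∈ Finset.range N, ((-1 : ℝ) ^ k / (k + 1)) • (W t - 1) ^ k := by
      ext t
      rw [hZdef]; simp only [logOneAdd, aeval_psi]
    rw [this]
    refine h1.mul (DifferentiableAt.fun_sum fun k _ => ?_)
    exact ((h1.hasDerivAt.fun_pow' k).differentiableAt).fun_const_smul ((-1 : ℝ) ^ k / (k + 1))
  refine ⟨Z, ?_, hZexp, fun t => ?_⟩
  · rw [hZdef]
    simp only [hWdef, zero_smul, exp_zero, one_mul]
    exact logOneAdd_exp hY
  -- Two expressions for the derivative of $e^{Z}=W$ are compared: the derivative of the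
  -- exponential, and $W'=XW$.
  · have hX : Polynomial.aeval (adL (Z t)) (phi (2 * N)) (deriv Z t) = X := by
      have h1 := hasDerivAt_exp_nilpotent hZN (hdiff t).hasDerivAt
      simp only [hZexp] at h1
      have h2 := h1.unique (hWd t)
      have h3 : W t * exp (-Z t) = 1 := by rw [← hZexp, exp_mul_exp_neg_real]
      calc _ = Polynomial.aeval (adL (Z t)) (phi (2 * N)) (deriv Z t) * W t * exp (-Z t) := by
            rw [mul_assoc, h3, mul_one]
        _ = X := by rw [h2, mul_assoc, h3, mul_one]
    have hZ' : deriv Z t = Polynomial.aeval (exp (adL (Z t)) - 1) (psi (2 * N)) X := by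
      have h1 := aeval_psi_mul_aeval_phi (adL_pow_eq_zero (hZN t))
      rw [exp_eq_one_add (adL_pow_eq_zero (hZN t)), add_sub_cancel_left, ← hX,
        ← mul_apply_eq_comp, h1, one_apply_eq_self]
    -- Conjugation by $e^{Z}=e^{tX}e^{Y}$ is the composition of the two conjugations; this removes
    -- the unknown $Z$ from the right side of the equation.
    have hAd : exp (adL (Z t)) = exp (t • adL X) * exp (adL Y) := by
      have h1 : t • adL X = adL (t • X) := by ext B; simp [smul_sub]
      have h3 : exp (-Z t) = exp (-Y) * exp (-(t • X)) := by
        calc exp (-Z t) = exp (-Z t) * (exp (t • X) * (exp Y * exp (-Y)) * exp (-(t • X))) := by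
              rw [exp_mul_exp_neg_real, mul_one, exp_mul_exp_neg_real, mul_one]
          _ = exp (-Z t) * exp (Z t) * (exp (-Y) * exp (-(t • X))) := by
              rw [hZexp]; simp only [hWdef, mul_assoc]
          _ = _ := by rw [exp_neg_mul_exp_real, one_mul]
      ext B
      rw [h1, mul_apply_eq_comp, exp_adL_apply, exp_adL_apply, exp_adL_apply, hZexp, h3]
      simp only [hWdef, mul_assoc]
    rw [← hAd, ← aeval_psi, ← hZ']
    exact (hdiff t).hasDerivAt

end Dexp

/-! ### Nilpotent filtrations -/

/-- A decreasing multiplicative filtration of an algebra, with trivial `N`-th term. -/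
structure NilFiltration (A : Type*) [Ring A] [Algebra ℝ A] (N : ℕ) where
  /-- The terms of the filtration. -/
  F : ℕ → Submodule ℝ A
  mul_mem : ∀ {i j a b}, a ∈ F i → b ∈ F j → a * b ∈ F (i + j)
  anti : Antitone F
  one_mem : 1 ∈ F 0
  bot : F N = ⊥

namespace NilFiltration

variable {A : Type*}

section

variable [Ring A] [Algebra ℝ A] {N : ℕ} (𝓕 : NilFiltration A N)

theorem pow_mem {a : A} (ha : a ∈ 𝓕.F 1) (k : ℕ) : a ^ k ∈ 𝓕.F k := by
  induction k with
  | zero => simpa using 𝓕.one_mem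
  | succ k ih => rw [pow_succ]; exact 𝓕.mul_mem ih ha

theorem mem_left {i : ℕ} {a b : A} (ha : a ∈ 𝓕.F i) (hb : b ∈ 𝓕.F 0) : a * b ∈ 𝓕.F i := by
  simpa using 𝓕.mul_mem ha hb

theorem aeval_mem {a : A} (ha : a ∈ 𝓕.F 1) (p : Polynomial ℝ) : Polynomial.aeval a p ∈ 𝓕.F 0 := by
  rw [Polynomial.aeval_eq_sum_range]
  exact sum_mem fun k _ => Submodule.smul_mem _ _ (𝓕.anti (Nat.zero_le k) (𝓕.pow_mem ha k))

theorem eq_zero {i : ℕ} {a : A} (ha : a ∈ 𝓕.F i) (hi : N ≤ i) : a = 0 := by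
  have := 𝓕.anti hi ha
  simpa [𝓕.bot] using this

theorem pow_eq_zero {a : A} (ha : a ∈ 𝓕.F 1) : a ^ N = 0 := 𝓕.eq_zero (𝓕.pow_mem ha N) le_rfl

end

section

variable [NormedRing A] [NormedAlgebra ℝ A] {N : ℕ} (𝓕 : NilFiltration A N)

theorem exp_sub_one_mem {a : A} (ha : a ∈ 𝓕.F 1) : NormedSpace.exp a - 1 ∈ 𝓕.F 1 := by
  rw [exp_eq_one_add (𝓕.pow_eq_zero ha), add_sub_cancel_left]
  exact 𝓕.mem_left ha (𝓕.aeval_mem ha _)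

theorem mul_sub_one_mem {a b : A} (ha : a - 1 ∈ 𝓕.F 1) (hb : b - 1 ∈ 𝓕.F 1) :
    a * b - 1 ∈ 𝓕.F 1 := by
  have : a * b - 1 = (a - 1) * b + (b - 1) := by noncomm_ring
  rw [this]
  have hb' : b ∈ 𝓕.F 0 := by
    rw [← sub_add_cancel b 1]
    exact add_mem (𝓕.anti zero_le_one hb) 𝓕.one_mem
  exact add_mem (𝓕.mem_left ha hb') hb

end

end NilFiltration

namespace StratifiedLieAlgebra

variable {E : Type*} [NormedAddCommGroup E] [InnerProductSpace ℝ E] {r : ℕ}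
  (S : StratifiedLieAlgebra E r)

/-! ### The grading -/

theorem bracket_skew (x y : E) : S.bracket x y = -S.bracket y x := by
  have h := S.bracket_self (x + y)
  simp only [map_add, LinearMap.add_apply, S.bracket_self, zero_add, add_zero] at h
  exact eq_neg_of_add_eq_zero_right h

theorem bracket_bracket (a b y : E) :
    S.bracket (S.bracket a b) y = S.bracket a (S.bracket b y) - S.bracket b (S.bracket a y) := by
  have h := S.jacobi a b y
  rw [S.bracket_skew y (S.bracket a b), S.bracket_skew y a, map_neg] at h
  rw [← sub_eq_zero, ← neg_eq_zero, ← h]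
  abel

/-- Only brackets with $V_1$ are prescribed. Since $V_{i+1}$ is spanned by $[V_1,V_i]$, the Jacobi
identity gives the general case by induction on $i$. -/
theorem bracket_mem {i j : ℕ} {x y : E} (hx : x ∈ S.V i) (hy : y ∈ S.V j) :
    S.bracket x y ∈ S.V (i + j) := by
  induction i generalizing j x y with
  | zero =>
    rw [S.V_zero, Submodule.mem_bot] at hx
    simp [hx]
  | succ i ih =>
    have h1 : ∀ {j x y}, x ∈ S.V 1 → y ∈ S.V j → S.bracket x y ∈ S.V (j + 1) := by
      intro j x y hx hy
      rcases j with _ | j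
      · rw [S.V_zero, Submodule.mem_bot] at hy
        simp [hy]
      · rw [← S.bracket_V (j + 1) (by omega)]
        exact Submodule.apply_mem_map₂ _ hx hy
    rcases i with _ | i
    · rw [zero_add, add_comm]; exact h1 hx hy
    · have hle : S.V (i + 1 + 1) ≤ (S.V (i + 1 + 1 + j)).comap (S.bracket.flip y) := by
        rw [← S.bracket_V (i + 1) (by omega), Submodule.map₂_le]
        intro a ha b hb
        rw [Submodule.mem_comap, LinearMap.flip_apply, bracket_bracket]
        refine sub_mem ?_ ?_
        · have := h1 ha (ih hb hy)
          rwa [show i + 1 + j + 1 = i + 1 + 1 + j by ring] at this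
        · have := ih hb (h1 ha hy)
          rwa [show i + 1 + (j + 1) = i + 1 + 1 + j by ring] at this
      exact hle hx

theorem V_eq_bot {i : ℕ} (h : i ∉ Finset.Icc 1 r) : S.V i = ⊥ := by
  rcases Nat.eq_zero_or_pos i with rfl | hi
  · exact S.V_zero
  · exact S.V_of_step_lt i (by simpa [Nat.one_le_iff_ne_zero, hi.ne'] using h)

theorem one_le_step (S : StratifiedLieAlgebra E r) : 1 ≤ r := by
  rcases Nat.eq_zero_or_pos r with h | h
  · exact absurd (h ▸ S.V_zero) S.V_step
  · exact h

/-- The component along `V i`, as an endomorphism. -/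
def compL (i : ℕ) : E →ₗ[ℝ] E :=
  (S.V i).subtype ∘ₗ DirectSum.component ℝ ℕ (fun i => S.V i) i ∘ₗ
    (LinearEquiv.ofBijective (DirectSum.coeLinearMap S.V) S.internal).symm.toLinearMap

theorem coe_component (i : ℕ) (x : E) : (S.component i x : E) = S.compL i x := rfl

theorem compL_mem (i : ℕ) (x : E) : S.compL i x ∈ S.V i := (S.component i x).2

theorem compL_of_mem {i j : ℕ} {x : E} (hx : x ∈ S.V j) :
    S.compL i x = if i = j then x else 0 := by
  have h : (LinearEquiv.ofBijective (DirectSum.coeLinearMap S.V) S.internal).symm x =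
      DirectSum.lof ℝ ℕ (fun i => S.V i) j ⟨x, hx⟩ := by
    rw [LinearEquiv.symm_apply_eq]
    exact (DirectSum.coeLinearMap_lof S.V j ⟨x, hx⟩).symm
  simp only [compL, LinearMap.comp_apply, LinearEquiv.coe_coe, h]
  split_ifs with hij
  · subst hij
    rw [DirectSum.component.lof_self]
    rfl
  · rw [DirectSum.component.of, dif_neg (Ne.symm hij), map_zero]

theorem linearMap_ext {M : Type*} [AddCommMonoid M] [Module ℝ M] {f g : E →ₗ[ℝ] M}
    (h : ∀ i, ∀ x ∈ S.V i, f x = g x) : f = g := by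
  ext x
  have hx : x ∈ ⨆ i, S.V i := by rw [S.internal.submodule_iSup_eq_top]; trivial
  refine Submodule.iSup_induction S.V (motive := fun x => f x = g x) hx h (by simp) ?_
  intro x y hx hy
  rw [map_add, map_add, hx, hy]

theorem sum_smul_compL_of_mem (c : ℕ → ℝ) {j : ℕ} {x : E} (hx : x ∈ S.V j) :
    ∑ i ∈ Finset.Icc 1 r, c i • S.compL i x = c j • x := by
  simp only [S.compL_of_mem hx, smul_ite, smul_zero, Finset.sum_ite_eq']
  split_ifs with h
  · rfl
  · have : x = 0 := by simpa [S.V_eq_bot h] using hx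
    simp [this]

theorem sum_compL (x : E) : ∑ i ∈ Finset.Icc 1 r, S.compL i x = x := by
  have : ∑ i ∈ Finset.Icc 1 r, S.compL i = LinearMap.id := S.linearMap_ext fun j x hx => by
    have := S.sum_smul_compL_of_mem (fun _ => 1) hx
    simpa [LinearMap.sum_apply] using this
  have := LinearMap.congr_fun this x
  simpa [LinearMap.sum_apply] using this

/-- The linear map which is multiplication by `c i` on `V i`. -/
def diag (c : ℕ → ℝ) : E →ₗ[ℝ] E := ∑ i ∈ Finset.Icc 1 r, c i • S.compL i

theorem diag_of_mem (c : ℕ → ℝ) {j : ℕ} {x : E} (hx : x ∈ S.V j) : S.diag c x = c j • x := by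
  rw [← S.sum_smul_compL_of_mem c hx]
  simp [diag, LinearMap.sum_apply]

theorem dilation_eq_diag (a : ℝ) (x : E) : S.dilation a x = S.diag (fun i => a ^ i) x := by
  simp [dilation, diag, LinearMap.sum_apply, coe_component]

theorem bracket_ext {f g : E →ₗ[ℝ] E →ₗ[ℝ] E}
    (h : ∀ i j, ∀ x ∈ S.V i, ∀ y ∈ S.V j, f x y = g x y) : f = g :=
  S.linearMap_ext fun i x hx => S.linearMap_ext fun j y hy => h i j x hx y hy

/-- The derivation of the grading: multiplication by `i` on `V i`. -/
def deg : E →ₗ[ℝ] E := S.diag fun i => i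

theorem deg_bracket (x y : E) :
    S.deg (S.bracket x y) = S.bracket (S.deg x) y + S.bracket x (S.deg y) := by
  have : S.bracket.compr₂ S.deg = S.bracket.compl₁₂ S.deg LinearMap.id +
      S.bracket.compl₁₂ LinearMap.id S.deg := S.bracket_ext fun i j x hx y hy => by
    simp [deg, S.diag_of_mem _ hx, S.diag_of_mem _ hy, S.diag_of_mem _ (S.bracket_mem hx hy), add_smul]
  simpa using LinearMap.congr_fun₂ this x y

/-- The only possible zero eigenvalue belongs to $V_0$, which is trivial. This is what makes the
representation below faithful. -/
theorem deg_injective : Function.Injective S.deg := by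
  have h : S.diag (fun i => (i : ℝ)⁻¹) ∘ₗ S.deg = LinearMap.id := S.linearMap_ext fun i x hx => by
    rcases Nat.eq_zero_or_pos i with rfl | hi
    · have : x = 0 := by simpa [S.V_zero] using hx
      simp [this]
    · have : (i : ℝ) ≠ 0 := by positivity
      simp [deg, S.diag_of_mem _ hx, smul_smul, this]
  exact Function.LeftInverse.injective (g := S.diag (fun i => (i : ℝ)⁻¹))
    fun x => LinearMap.congr_fun h x

theorem diag_pow_bracket (a : ℝ) (x y : E) :
    S.diag (fun i => a ^ i) (S.bracket x y) =
      S.bracket (S.diag (fun i => a ^ i) x) (S.diag (fun i => a ^ i) y) := by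
  have : S.bracket.compr₂ (S.diag fun i => a ^ i) =
      S.bracket.compl₁₂ (S.diag fun i => a ^ i) (S.diag fun i => a ^ i) :=
    S.bracket_ext fun i j x hx y hy => by
      simp [S.diag_of_mem _ hx, S.diag_of_mem _ hy, S.diag_of_mem _ (S.bracket_mem hx hy), pow_add,
        smul_smul]
      rw [mul_comm]
  simpa using LinearMap.congr_fun₂ this x y

/-- The elements without components of degree less than `k`. -/
def fil (k : ℕ) : Submodule ℝ E := ⨅ i ∈ Finset.range k, LinearMap.ker (S.compL i)

theorem mem_fil {k : ℕ} {x : E} : x ∈ S.fil k ↔ ∀ i < k, S.compL i x = 0 := by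
  simp [fil, Submodule.mem_iInf]

theorem fil_anti : Antitone S.fil := fun i j hij x hx => by
  rw [mem_fil] at hx ⊢
  exact fun l hl => hx l (hl.trans_le hij)

theorem mem_fil_one (x : E) : x ∈ S.fil 1 := by
  rw [mem_fil]
  intro i hi
  obtain rfl : i = 0 := by omega
  simpa [S.V_zero] using S.compL_mem 0 x

theorem eq_zero_of_mem_fil {k : ℕ} {x : E} (hx : x ∈ S.fil k) (hk : r < k) : x = 0 := by
  rw [mem_fil] at hx
  rw [← S.sum_compL x]
  exact Finset.sum_eq_zero fun i hi => hx i (by simp at hi; omega)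

theorem bracket_mem_fil {k : ℕ} (x : E) {y : E} (hy : y ∈ S.fil k) :
    S.bracket x y ∈ S.fil (k + 1) := by
  rw [mem_fil] at hy ⊢
  intro l hl
  rw [← S.sum_compL x, ← S.sum_compL y]
  simp only [map_sum, LinearMap.sum_apply]
  refine Finset.sum_eq_zero fun i hi => Finset.sum_eq_zero fun j hj => ?_
  rcases lt_or_ge i k with h | h
  · simp [hy i h]
  · rw [S.compL_of_mem (S.bracket_mem (S.compL_mem j x) (S.compL_mem i y)), if_neg]
    simp at hi hj
    omega

theorem ad_pow_mem_fil {k : ℕ} (x : E) {y : E} (hy : y ∈ S.fil k) (n : ℕ) :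
    (S.ad x ^ n) y ∈ S.fil (k + n) := by
  induction n with
  | zero => simpa using hy
  | succ n ih =>
    rw [pow_succ', Module.End.mul_apply]
    exact S.bracket_mem_fil x ih

theorem ad_pow_eq_zero (x : E) {n : ℕ} (hn : r ≤ n) : S.ad x ^ n = 0 := by
  ext y
  exact S.eq_zero_of_mem_fil (S.ad_pow_mem_fil x (S.mem_fil_one y) n) (by omega)

theorem prod_mem_fil {k : ℕ} (f : Fin k → Module.End ℝ E)
    (hf : ∀ i l, ∀ y ∈ S.fil l, f i y ∈ S.fil (l + 1)) {l : ℕ} {y : E} (hy : y ∈ S.fil l) :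
    (List.ofFn f).prod y ∈ S.fil (l + k) := by
  induction k with
  | zero => simpa using hy
  | succ k ih =>
    rw [List.ofFn_succ, List.prod_cons, Module.End.mul_apply]
    exact hf 0 _ _ (ih _ fun i => hf i.succ)

theorem ad_pow_mul_ad_pow_mem_fil (x y : E) {n m : ℕ} (h : 0 < n + m) (l : ℕ) {z : E}
    (hz : z ∈ S.fil l) : (S.ad x ^ n * S.ad y ^ m) z ∈ S.fil (l + 1) := by
  rw [Module.End.mul_apply]
  exact S.fil_anti (by omega) (S.ad_pow_mem_fil x (S.ad_pow_mem_fil y hz m) n)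

/-- Every correction term is an iterated commutator, of degree at least two. Hence the horizontal
part of the Maurer–Cartan form is the horizontal part of the derivative. -/
theorem compL_one_mul (x y : E) : S.compL 1 (S.mul x y) = S.compL 1 x + S.compL 1 y := by
  rw [mul, map_add, map_add, add_eq_left, map_sum]
  refine Finset.sum_eq_zero fun k hk => ?_
  rw [map_sum]
  refine Finset.sum_eq_zero fun p hp => ?_
  rw [map_smul]
  have h1 := S.prod_mem_fil (fun i => S.ad x ^ (p.1 i : ℕ) * S.ad y ^ (p.2 i : ℕ))
    (fun i l z hz => S.ad_pow_mul_ad_pow_mem_fil x y (by simpa using (Finset.mem_filter.mp hp).2 i) l hz)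
    (S.mem_fil_one x)
  rw [mem_fil] at h1
  have := (Finset.mem_Icc.mp hk).1
  rw [h1 1 (by omega), smul_zero]

theorem map_prod_of_intertwine {F : Type*} [AddCommGroup F] [Module ℝ F] (φ : E →ₗ[ℝ] F) {k : ℕ}
    (f : Fin k → Module.End ℝ E) (g : Fin k → Module.End ℝ F) (h : ∀ i x, φ (f i x) = g i (φ x))
    (x : E) : φ ((List.ofFn f).prod x) = (List.ofFn g).prod (φ x) := by
  induction k with
  | zero => simp
  | succ k ih =>
    rw [List.ofFn_succ, List.ofFn_succ, List.prod_cons, List.prod_cons, Module.End.mul_apply,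
      Module.End.mul_apply, h, ih _ (fun i => g i.succ) fun i => h i.succ]

theorem map_pow_of_intertwine {F : Type*} [AddCommGroup F] [Module ℝ F] (φ : E →ₗ[ℝ] F)
    (f : Module.End ℝ E) (g : Module.End ℝ F) (h : ∀ x, φ (f x) = g (φ x)) (n : ℕ)
    (x : E) : φ ((f ^ n) x) = (g ^ n) (φ x) := by
  induction n with
  | zero => simp
  | succ n ih => rw [pow_succ', pow_succ', Module.End.mul_apply, h, ih, Module.End.mul_apply]

theorem map_mul_of_map_bracket (φ : E →ₗ[ℝ] E)
    (h : ∀ x y, φ (S.bracket x y) = S.bracket (φ x) (φ y)) (x y : E) :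
    φ (S.mul x y) = S.mul (φ x) (φ y) := by
  rw [mul, mul, map_add, map_add, map_sum]
  congr 1
  refine Finset.sum_congr rfl fun k _ => ?_
  rw [map_sum]
  refine Finset.sum_congr rfl fun p _ => ?_
  rw [map_smul, map_prod_of_intertwine φ _
    (fun i => S.ad (φ x) ^ (p.1 i : ℕ) * S.ad (φ y) ^ (p.2 i : ℕ))]
  intro i z
  rw [Module.End.mul_apply, Module.End.mul_apply,
    map_pow_of_intertwine φ (S.ad x) (S.ad (φ x)) (fun z => h x z),
    map_pow_of_intertwine φ (S.ad y) (S.ad (φ y)) (fun z => h y z)]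

/-- A dilation preserves the bracket, hence the group law, and it is a plain scaling on the
horizontal layer. -/
theorem dilation_walk (a : ℝ) (x : ℕ → S.H) (n : ℕ) :
    S.dilation a (S.walk x n) = S.walk (fun k => a • x k) n := by
  induction n with
  | zero => simp [walk, dilation_eq_diag]
  | succ n ih =>
    rw [walk, walk, ← ih, dilation_eq_diag, dilation_eq_diag,
      S.map_mul_of_map_bracket _ (S.diag_pow_bracket a), S.diag_of_mem _ (x n).2]
    simp

end StratifiedLieAlgebra

theorem sum_pow_eq_sum_prod_ofFn {R ι : Type*} [Semiring R] [DecidableEq ι] [Fintype ι]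
    (s : Finset ι) (f : ι → R) (k : ℕ) :
    (∑ i ∈ s, f i) ^ k = ∑ p : Fin k → ι with ∀ i, p i ∈ s, (List.ofFn fun i => f (p i)).prod := by
  induction k with
  | zero => simp
  | succ k ih =>
    rw [pow_succ', ih, Finset.sum_mul_sum, ← Finset.sum_product']
    refine Finset.sum_bij (fun q _ => Fin.cons q.1 q.2) ?_ ?_ ?_ ?_
    · rintro ⟨a, q⟩ h
      simp only [Finset.mem_product, Finset.mem_filter, Finset.mem_univ, true_and] at h ⊢
      exact Fin.cases h.1 h.2
    · rintro ⟨a, q⟩ _ ⟨a', q'⟩ _ h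
      obtain ⟨rfl, rfl⟩ := Fin.cons_injective2 h
      rfl
    · intro p hp
      simp only [Finset.mem_filter, Finset.mem_univ, true_and] at hp
      exact ⟨(p 0, Fin.tail p), by simp [Fin.tail, hp], Fin.cons_self_tail p⟩
    · rintro ⟨a, q⟩ _
      simp [List.ofFn_succ]

theorem prod_ofFn_smul {R : Type*} [Ring R] [Algebra ℝ R] {k : ℕ} (c : Fin k → ℝ) (f : Fin k → R) :
    (List.ofFn fun i => c i • f i).prod = (∏ i, c i) • (List.ofFn f).prod := by
  induction k with
  | zero => simp
  | succ k ih =>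
    rw [List.ofFn_succ, List.ofFn_succ, List.prod_cons, List.prod_cons, ih, Fin.prod_univ_succ,
      smul_mul_smul_comm]

/-- The product `exp (a 0) exp (a 1) ⋯ exp (a (n - 1))`. -/
def expProd {A : Type*} [NormedRing A] [NormedAlgebra ℝ A] (a : ℕ → A) : ℕ → A
  | 0 => 1
  | n + 1 => expProd a n * NormedSpace.exp (a n)

namespace StratifiedLieAlgebra

variable {E : Type*} [NormedAddCommGroup E] [InnerProductSpace ℝ E] {r : ℕ}
  (S : StratifiedLieAlgebra E r)

/-! ### A faithful nilpotent representation -/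

/-- The filtration of `E × ℝ`, the semidirect product of `E` with its grading derivation. -/
def filProd (k : ℕ) : Submodule ℝ (E × ℝ) where
  carrier := {v | v.1 ∈ S.fil k ∧ (0 < k → v.2 = 0)}
  add_mem' := fun {a b} ha hb => ⟨add_mem ha.1 hb.1, fun h => by simp [ha.2 h, hb.2 h]⟩
  zero_mem' := ⟨zero_mem _, fun _ => rfl⟩
  smul_mem' := fun c {a} ha => ⟨Submodule.smul_mem _ c ha.1, fun h => by simp [ha.2 h]⟩

theorem mem_filProd {k : ℕ} {v : E × ℝ} : v ∈ S.filProd k ↔ v.1 ∈ S.fil k ∧ (0 < k → v.2 = 0) :=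
  Iff.rfl

/-- The endomorphisms which raise the degree by `1, 2, …`. -/
def nilFiltration : NilFiltration ((E × ℝ) →L[ℝ] (E × ℝ)) (r + 1) where
  F j :=
    { carrier := {T | ∀ k, ∀ v ∈ S.filProd k, T v ∈ S.filProd (k + j)}
      add_mem' := fun ha hb k v hv => add_mem (ha k v hv) (hb k v hv)
      zero_mem' := fun _ _ _ => zero_mem _
      smul_mem' := fun c _ ha k v hv => Submodule.smul_mem _ c (ha k v hv) }
  mul_mem := fun {i j a b} ha hb k v hv => by
    have := ha _ _ (hb k v hv)
    rwa [add_assoc, add_comm j i] at this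
  anti := fun i j hij T hT k v hv => by
    have h := S.mem_filProd.mp (hT k v hv)
    exact ⟨S.fil_anti (by omega) h.1, fun h' => h.2 (by omega)⟩
  one_mem := fun k v hv => by simpa using hv
  bot := by
    rw [eq_bot_iff]
    intro T hT
    rw [Submodule.mem_bot]
    refine ContinuousLinearMap.ext fun v => ?_
    have h := S.mem_filProd.mp (hT 0 v ⟨by rw [mem_fil]; omega, by omega⟩)
    exact Prod.ext (S.eq_zero_of_mem_fil h.1 (by omega)) (h.2 (by omega))

theorem mem_nilFiltration {j : ℕ} {T : (E × ℝ) →L[ℝ] (E × ℝ)} :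
    T ∈ S.nilFiltration.F j ↔ ∀ k, ∀ v ∈ S.filProd k, T v ∈ S.filProd (k + j) := Iff.rfl

/-- The exponents of one factor in the Baker-Campbell-Dynkin-Hausdorff formula. -/
def bchIndex (r : ℕ) : Finset (Fin r × Fin r) := Finset.univ.filter fun q => 0 < (q.1 : ℕ) + q.2

/-- Subtracting the identity from $e^{t\operatorname{ad}x}e^{\operatorname{ad}y}$ removes exactly
the pair $(0,0)$; this is the origin of the condition $n_i+m_i>0$. -/
theorem sum_range_mul_sum_range_sub_one (hr : 1 ≤ r) (x y : E) (t : ℝ) :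
    (∑ n ∈ Finset.range r, (t ^ n * (n.factorial : ℝ)⁻¹) • S.ad x ^ n) *
      (∑ n ∈ Finset.range r, ((n.factorial : ℝ)⁻¹) • S.ad y ^ n) - 1 =
    ∑ q ∈ bchIndex r, (t ^ (q.1 : ℕ) * ((q.1 : ℕ).factorial : ℝ)⁻¹ * ((q.2 : ℕ).factorial : ℝ)⁻¹) •
      (S.ad x ^ (q.1 : ℕ) * S.ad y ^ (q.2 : ℕ)) := by
  rw [Finset.sum_mul_sum, ← Fin.sum_univ_eq_sum_range (fun i => ∑ j ∈ Finset.range r,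
    ((t ^ i * (i.factorial : ℝ)⁻¹) • S.ad x ^ i) * (((j.factorial : ℝ)⁻¹) • S.ad y ^ j))]
  simp_rw [← Fin.sum_univ_eq_sum_range (fun j =>
    ((t ^ _ * ((_ : ℕ).factorial : ℝ)⁻¹) • S.ad x ^ _) * (((j.factorial : ℝ)⁻¹) • S.ad y ^ j))]
  rw [← Finset.sum_product', Finset.univ_product_univ,
    ← Finset.sum_filter_add_sum_filter_not Finset.univ (fun q : Fin r × Fin r => 0 < (q.1 : ℕ) + q.2)]
  have h0 : (Finset.univ.filter fun q : Fin r × Fin r => ¬ 0 < (q.1 : ℕ) + q.2) =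
      {(⟨0, hr⟩, ⟨0, hr⟩)} := by
    ext ⟨a, b⟩
    simp [Prod.ext_iff, Fin.ext_iff]
  rw [h0, Finset.sum_singleton]
  simp only [pow_zero, Nat.factorial_zero, Nat.cast_one, inv_one, one_mul, one_smul,
    add_sub_cancel_right]
  refine Finset.sum_congr rfl fun q _ => ?_
  rw [smul_mul_smul_comm]

/-- A faithful representation by nilpotent elements of an algebra. -/
structure NilRep (A : Type*) [NormedRing A] [NormedAlgebra ℝ A] (N : ℕ) where
  /-- The representation. -/
  rho : E →L[ℝ] A
  /-- The filtration. -/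
  fil : NilFiltration A N
  map_bracket : ∀ x y, rho (S.bracket x y) = rho x * rho y - rho y * rho x
  injective : Function.Injective rho
  mem : ∀ x, rho x ∈ fil.F 1

section

variable [FiniteDimensional ℝ E]

/-- The adjoint representation of `E` on its semidirect product with the grading derivation. -/
def adProd : E →L[ℝ] ((E × ℝ) →L[ℝ] (E × ℝ)) :=
  LinearMap.toContinuousLinearMap
    (LinearMap.toContinuousLinearMap.toLinearMap ∘ₗ
      ((LinearMap.inl ℝ E ℝ).compRight ℝ ∘ₗ
        ((LinearMap.fst ℝ E ℝ).lcomp ℝ E ∘ₗ S.bracket -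
          (LinearMap.smulRightₗ (LinearMap.snd ℝ E ℝ) : E →ₗ[ℝ] _) ∘ₗ S.deg)))

@[simp] theorem adProd_apply (x y : E) (s : ℝ) :
    S.adProd x (y, s) = (S.bracket x y - s • S.deg x, 0) := by
  simp [adProd]

theorem adProd_bracket (x y : E) : S.adProd (S.bracket x y) = S.adProd x * S.adProd y - S.adProd y * S.adProd x := by
  refine ContinuousLinearMap.ext fun ⟨z, s⟩ => ?_
  rw [_root_.sub_apply, mul_apply_eq_comp, mul_apply_eq_comp]
  simp only [adProd_apply, map_sub, map_smul, zero_smul, sub_zero, Prod.mk_sub_mk, deg_bracket,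
    bracket_bracket, sub_self, smul_add]
  rw [S.bracket_skew y (S.deg x)]
  congr 1
  simp only [smul_neg, sub_neg_eq_add]
  abel_nf

/-- The adjoint action on $E$ alone kills the centre. The added direction detects it: $(0,1)$ is
sent to $(-\deg x,0)$. -/
theorem adProd_injective : Function.Injective S.adProd := by
  rw [injective_iff_map_eq_zero]
  intro x hx
  have h := congrArg Prod.fst (DFunLike.congr_fun hx (0, 1))
  simp only [adProd_apply, map_zero, one_smul, zero_sub] at h
  have : S.deg x = 0 := by simpa using h
  exact (injective_iff_map_eq_zero _).mp S.deg_injective x this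

theorem adProd_mem (x : E) : S.adProd x ∈ S.nilFiltration.F 1 := by
  rw [mem_nilFiltration]
  rintro k ⟨y, s⟩ ⟨h1, h2⟩
  rw [adProd_apply]
  refine ⟨sub_mem (S.bracket_mem_fil x h1) ?_, fun _ => rfl⟩
  rcases Nat.eq_zero_or_pos k with rfl | hk
  · exact S.mem_fil_one _
  · have : s = 0 := h2 hk
    simp [this]

/-- A faithful nilpotent representation of a stratified Lie algebra. -/
def nilRep : S.NilRep ((E × ℝ) →L[ℝ] (E × ℝ)) (r + 1) :=
  ⟨S.adProd, S.nilFiltration, S.adProd_bracket, S.adProd_injective, S.adProd_mem⟩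

end

namespace NilRep

variable {S} {A : Type*} [NormedRing A] [NormedAlgebra ℝ A] {N : ℕ} (R : S.NilRep A N)

theorem pow_eq_zero (x : E) : R.rho x ^ N = 0 := R.fil.pow_eq_zero (R.mem x)

/-- This vanishing, restricted to $\mathcal H$, is the only form in which nilpotency enters the
study of the flow. -/
theorem prod_eq_zero (v : Fin N → E) : (List.ofFn fun i => R.rho (v i)).prod = 0 := by
  have : ∀ {k : ℕ} (v : Fin k → E), (List.ofFn fun i => R.rho (v i)).prod ∈ R.fil.F k := by
    intro k v
    induction k with
    | zero => simpa using R.fil.one_mem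
    | succ k ih =>
      rw [List.ofFn_succ, List.prod_cons]
      have := R.fil.mul_mem (R.mem (v 0)) (ih fun i => v i.succ)
      rwa [add_comm 1 k] at this
  exact R.fil.eq_zero (this v) le_rfl

/-- The embedding of the group in the algebra. -/
def emb (x : E) : A := NormedSpace.exp (R.rho x)

theorem emb_zero : R.emb 0 = 1 := by simp [emb]

theorem contDiff_emb : ContDiff ℝ 1 R.emb := by
  have h : R.emb = fun x => ∑ n ∈ Finset.range N, ((n.factorial : ℝ)⁻¹) • R.rho x ^ n := by
    ext x
    exact exp_eq_sum_of_pow_eq_zero (R.pow_eq_zero x)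
  rw [h]
  exact ContDiff.sum fun n _ => (R.rho.contDiff.pow n).const_smul _

variable [CompleteSpace A]

theorem exp_smul_adL_rho (x z : E) (t : ℝ) :
    NormedSpace.exp (t • adL (R.rho x)) (R.rho z) =
      R.rho ((∑ n ∈ Finset.range r, (t ^ n * (n.factorial : ℝ)⁻¹) • S.ad x ^ n) z) := by
  have h1 : ∀ n, ((t • adL (R.rho x)) ^ n) (R.rho z) = R.rho ((t ^ n • S.ad x ^ n) z) := by
    intro n
    induction n with
    | zero => simp
    | succ n ih =>
      rw [pow_succ', mul_apply_eq_comp, ih, _root_.smul_apply, adL_apply, ← R.map_bracket, ← map_smul,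
        pow_succ', pow_succ']
      congr 1
      simp [ad, smul_smul]
  have hs := NormedSpace.exp_series_hasSum_exp' (𝕂 := ℝ) (t • adL (R.rho x))
  have hs2 := (ContinuousLinearMap.apply ℝ _ (R.rho z)).hasSum hs
  have hs3 : HasSum (fun n => (ContinuousLinearMap.apply ℝ _ (R.rho z))
      ((n.factorial : ℝ)⁻¹ • (t • adL (R.rho x)) ^ n))
      (∑ n ∈ Finset.range r, (ContinuousLinearMap.apply ℝ _ (R.rho z))
      ((n.factorial : ℝ)⁻¹ • (t • adL (R.rho x)) ^ n)) := by
    refine hasSum_sum_of_ne_finset_zero fun n hn => ?_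
    have : r ≤ n := by simpa using hn
    rw [ContinuousLinearMap.apply_apply, _root_.smul_apply, h1, S.ad_pow_eq_zero x this]
    simp
  have h2 := hs2.unique hs3
  rw [ContinuousLinearMap.apply_apply] at h2
  rw [h2, LinearMap.sum_apply, map_sum]
  refine Finset.sum_congr rfl fun n _ => ?_
  rw [ContinuousLinearMap.apply_apply, _root_.smul_apply, h1, ← map_smul]
  congr 1
  simp only [LinearMap.smul_apply, smul_smul]
  rw [mul_comm]

/-- The curve $Z(t)=\log(e^{t\rho(x)}e^{\rho(y)})$ has derivative
$\sum_k\frac{(-1)^k}{k+1}(e^{t\operatorname{ad}x}e^{\operatorname{ad}y}-1)^kx$, read in the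
representation. This is a polynomial in $t$, and integrating $t^{|n|}$ from $0$ to $1$ yields the
denominators $|n|+1$ of the group law. -/
theorem emb_mul (hN : r ≤ N) (x y : E) : R.emb (S.mul x y) = R.emb x * R.emb y := by
  have hr := S.one_le_step
  set 𝓕 := R.fil
  obtain ⟨Z, hZ0, hZexp, hZd⟩ := exists_log_exp_mul_exp (X := R.rho x) (Y := R.rho y) (N := N)
    (R.pow_eq_zero y) (fun t => 𝓕.pow_eq_zero (𝓕.mul_sub_one_mem
      (𝓕.exp_sub_one_mem (Submodule.smul_mem _ t (R.mem x))) (𝓕.exp_sub_one_mem (R.mem y))))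
  set P : ℝ → Module.End ℝ E := fun t => ∑ q ∈ bchIndex r,
    (t ^ (q.1 : ℕ) * ((q.1 : ℕ).factorial : ℝ)⁻¹ * ((q.2 : ℕ).factorial : ℝ)⁻¹) •
      (S.ad x ^ (q.1 : ℕ) * S.ad y ^ (q.2 : ℕ)) with hP
  set c : ℕ → ℝ := fun k => (-1 : ℝ) ^ k / (k + 1) with hc
  have hstep : ∀ t z, (NormedSpace.exp (t • adL (R.rho x)) * NormedSpace.exp (adL (R.rho y)) - 1)
      (R.rho z) = R.rho (P t z) := by
    intro t z
    have hy := R.exp_smul_adL_rho y z 1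
    simp only [one_smul, one_pow, one_mul] at hy
    rw [_root_.sub_apply, mul_apply_eq_comp, hy, exp_smul_adL_rho, one_apply_eq_self, ← map_sub]
    simp only [hP]
    rw [← S.sum_range_mul_sum_range_sub_one hr]
    rfl
  have hpow : ∀ t (k : ℕ) z, ((NormedSpace.exp (t • adL (R.rho x)) *
      NormedSpace.exp (adL (R.rho y)) - 1) ^ k) (R.rho z) = R.rho ((P t ^ k) z) := by
    intro t k z
    induction k with
    | zero => simp
    | succ k ih => rw [pow_succ', pow_succ', mul_apply_eq_comp, ih, hstep]; rfl
  have hPk : ∀ t (k : ℕ), P t ^ k = ∑ p : (Fin k → Fin r) × (Fin k → Fin r) with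
      ∀ i, 0 < (p.1 i : ℕ) + (p.2 i : ℕ),
      (t ^ (∑ i, (p.1 i : ℕ)) * ((∏ i, ((p.2 i : ℕ).factorial : ℝ)) *
          (∏ i, ((p.1 i : ℕ).factorial : ℝ)))⁻¹) •
        (List.ofFn fun i => S.ad x ^ (p.1 i : ℕ) * S.ad y ^ (p.2 i : ℕ)).prod := by
    intro t k
    rw [hP]
    simp only
    rw [sum_pow_eq_sum_prod_ofFn]
    refine Finset.sum_equiv (Equiv.arrowProdEquivProdArrow _ _ _) ?_ ?_
    · intro p
      simp [bchIndex]
    · intro p _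
      rw [prod_ofFn_smul]
      simp only [Equiv.arrowProdEquivProdArrow_apply, Finset.prod_mul_distrib, Finset.prod_pow_eq_pow_sum,
        Finset.prod_inv_distrib, mul_inv]
      congr 1
      ring
  -- Each factor raises the degree and $x$ has degree at least one, so the series stops at $k=r-1$,
  -- as in the definition of the product.
  have hPnil : ∀ t (k : ℕ), r ≤ k → (P t ^ k) x = 0 := by
    intro t k hk
    refine S.eq_zero_of_mem_fil (k := 1 + k) ?_ (by omega)
    rw [hPk, LinearMap.sum_apply]
    refine sum_mem fun p hp => Submodule.smul_mem _ _ ?_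
    exact S.prod_mem_fil _ (fun i l z hz => S.ad_pow_mul_ad_pow_mem_fil x y
      (by simpa using (Finset.mem_filter.mp hp).2 i) l hz) (S.mem_fil_one x)
  -- The candidate primitive: it starts at $y$ and equals the group product at $t=1$.
  set z : ℝ → E := fun t => t • x + y + ∑ k ∈ Finset.Icc 1 (r - 1),
    ∑ p : (Fin k → Fin r) × (Fin k → Fin r) with ∀ i, 0 < (p.1 i : ℕ) + (p.2 i : ℕ),
      (t ^ (∑ i, (p.1 i : ℕ) + 1)) • ((-1 : ℝ) ^ k / (((k : ℝ) + 1) *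
          (∏ i, (Nat.factorial (p.2 i) : ℝ)) *
          (∏ i, (Nat.factorial (p.1 i) : ℝ)) * ((∑ i, ((p.1 i : ℕ) : ℝ)) + 1))) •
        (List.ofFn fun i => S.ad x ^ (p.1 i : ℕ) * S.ad y ^ (p.2 i : ℕ)).prod x with hz
  have hzd : ∀ t, HasDerivAt z (∑ k ∈ Finset.range r, c k • (P t ^ k) x) t := by
    intro t
    have e : Finset.range r = insert 0 (Finset.Icc 1 (r - 1)) := by
      ext i; simp; omega
    rw [e, Finset.sum_insert (by simp)]
    have h0 : c 0 • (P t ^ 0) x = x := by simp [hc]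
    rw [h0]
    refine HasDerivAt.add ?_ (HasDerivAt.fun_sum fun k hk => ?_)
    · simpa using ((hasDerivAt_id t).smul_const x).add_const y
    · rw [hPk, LinearMap.sum_apply, Finset.smul_sum]
      refine HasDerivAt.fun_sum fun p _ => ?_
      have h1 := (hasDerivAt_pow (∑ i, (p.1 i : ℕ) + 1) t).smul_const (((-1 : ℝ) ^ k /
        (((k : ℝ) + 1) * (∏ i, (Nat.factorial (p.2 i) : ℝ)) *
          (∏ i, (Nat.factorial (p.1 i) : ℝ)) * ((∑ i, ((p.1 i : ℕ) : ℝ)) + 1))) •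
        (List.ofFn fun i => S.ad x ^ (p.1 i : ℕ) * S.ad y ^ (p.2 i : ℕ)).prod x)
      convert! h1 using 1
      rw [LinearMap.smul_apply, smul_smul, smul_smul]
      congr 1
      have hpos : (0 : ℝ) < (∑ i, ((p.1 i : ℕ) : ℝ)) + 1 := by positivity
      have hpos1 : (0 : ℝ) < ∏ i, ((p.1 i : ℕ).factorial : ℝ) :=
        Finset.prod_pos fun i _ => by positivity
      have hpos2 : (0 : ℝ) < ∏ i, ((p.2 i : ℕ).factorial : ℝ) :=
        Finset.prod_pos fun i _ => by positivity
      rw [hc, Nat.add_sub_cancel]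
      push_cast
      field_simp
  have hconst : ∀ t, HasDerivAt (fun t => Z t - R.rho (z t)) 0 t := by
    intro t
    have h1 := (hZd t).sub (R.rho.hasFDerivAt.comp_hasDerivAt t (hzd t))
    convert! h1 using 1
    rw [eq_comm, sub_eq_zero, _root_.sum_apply, map_sum]
    -- The equation for $Z$ is summed up to $2N$, that of $z$ up to $r$; the surplus terms vanish.
    have : ∀ M, r ≤ M → ∑ k ∈ Finset.range M, R.rho (c k • (P t ^ k) x) =
        ∑ k ∈ Finset.range r, R.rho (c k • (P t ^ k) x) := fun M hM => by
      rw [← Finset.sum_range_add_sum_Ico _ hM, add_eq_left]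
      refine Finset.sum_eq_zero fun k hk => ?_
      rw [hPnil t k (Finset.mem_Ico.mp hk).1, smul_zero, map_zero]
    rw [← this (2 * N) (by omega)]
    refine Finset.sum_congr rfl fun k _ => ?_
    rw [_root_.smul_apply, hpow, map_smul]
  have h01 := is_const_of_deriv_eq_zero (fun t => (hconst t).differentiableAt)
    (fun t => (hconst t).deriv) 1 0
  have hz0 : z 0 = y := by simp [hz]
  have hz1 : z 1 = S.mul x y := by simp [hz, mul]
  simp only [hz0, hz1, hZ0, sub_self, sub_eq_zero] at h01
  rw [emb, ← h01, hZexp, one_smul]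
  rfl

theorem emb_mul_emb_neg (x : E) : R.emb x * R.emb (-x) = 1 := by
  rw [emb, emb, map_neg, exp_mul_exp_neg_real]

theorem emb_neg_mul_emb (x : E) : R.emb (-x) * R.emb x = 1 := by
  rw [emb, emb, map_neg, exp_neg_mul_exp_real]

theorem hasFDerivAt_emb_zero : HasFDerivAt R.emb R.rho 0 := by
  have h1 : HasFDerivAt (NormedSpace.exp : A → A) (1 : A →L[ℝ] A) (R.rho 0) := by
    rw [map_zero]; exact hasFDerivAt_exp_zero
  have := h1.comp (0 : E) R.rho.hasFDerivAt
  exact this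

theorem emb_walk (hN : r ≤ N) (x : ℕ → S.H) (n : ℕ) :
    R.emb (S.walk x n) = expProd (fun k => R.rho (x k)) n := by
  induction n with
  | zero => simp [walk, emb_zero, expProd]
  | succ n ih => rw [walk, R.emb_mul hN, ih, expProd, emb]

variable [FiniteDimensional ℝ A]

/-- A linear left inverse of the representation. -/
def rhoInv : A →L[ℝ] E :=
  LinearMap.toContinuousLinearMap
    (LinearMap.exists_leftInverse_of_injective R.rho.toLinearMap
      (LinearMap.ker_eq_bot.mpr R.injective)).choose

theorem rhoInv_rho (x : E) : R.rhoInv (R.rho x) = x :=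
  LinearMap.congr_fun (LinearMap.exists_leftInverse_of_injective R.rho.toLinearMap
      (LinearMap.ker_eq_bot.mpr R.injective)).choose_spec x

/-- A smooth left inverse of the embedding of the group. -/
def theta (a : A) : E := R.rhoInv (NilpotentSeries.logOneAdd N (a - 1))

theorem theta_emb (x : E) : R.theta (R.emb x) = x := by
  rw [theta, emb, logOneAdd_exp (R.pow_eq_zero x), rhoInv_rho]

theorem emb_injective : Function.Injective R.emb :=
  Function.LeftInverse.injective R.theta_emb

theorem contDiff_theta : ContDiff ℝ 1 R.theta := by
  have h : R.theta = fun a => R.rhoInv ((a - 1) * ∑ k ∈ Finset.range N,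
      ((-1 : ℝ) ^ k / (k + 1)) • (a - 1) ^ k) := by
    ext a
    rw [theta, NilpotentSeries.logOneAdd, NilpotentSeries.aeval_psi]
  rw [h]
  have h1 : ContDiff ℝ 1 fun a : A => a - 1 := contDiff_id.sub contDiff_const
  exact R.rhoInv.contDiff.comp (h1.mul (ContDiff.sum fun n _ => (h1.pow n).const_smul _))

theorem mul_eq (hN : r ≤ N) (x y : E) : S.mul x y = R.theta (R.emb x * R.emb y) := by
  rw [← R.emb_mul hN, theta_emb]

/-- Smoothness is read off the algebra, where the law is multiplication between the smooth maps
`emb` and `theta`. -/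
theorem contDiff_mul (R : S.NilRep A N) (hN : r ≤ N) (x : E) : ContDiff ℝ 1 (S.mul x) := by
  have : S.mul x = fun y => R.theta (R.emb x * R.emb y) := funext fun y => R.mul_eq hN x y
  rw [this]
  exact R.contDiff_theta.comp (contDiff_const.mul R.contDiff_emb)

theorem mul_neg_self (R : S.NilRep A N) (hN : r ≤ N) (x : E) : S.mul (-x) x = 0 :=
  R.emb_injective (by rw [R.emb_mul hN, emb_neg_mul_emb, emb_zero])

/-- In the representation, `G' = G c_γ` for the Maurer-Cartan form `c_γ` of `γ` and `G` the image
of `γ`. -/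
theorem hasDerivAt_emb (hN : r ≤ N) {γ : ℝ → E} {t : ℝ} (hγ : DifferentiableAt ℝ γ t) :
    HasDerivAt (fun s => R.emb (γ s)) (R.emb (γ t) * R.rho (S.maurerCartan γ t)) t := by
  have h1 : HasDerivAt (fun s => S.mul (-γ t) (γ s)) (S.maurerCartan γ t) t :=
    (((R.contDiff_mul hN (-γ t)).differentiable one_ne_zero (γ t)).hasFDerivAt).comp_hasDerivAt t
      hγ.hasDerivAt
  have h2 : HasFDerivAt R.emb R.rho (S.mul (-γ t) (γ t)) := by
    rw [R.mul_neg_self hN]; exact R.hasFDerivAt_emb_zero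
  have h3 := (h2.comp_hasDerivAt t h1).const_mul (R.emb (γ t))
  refine h3.congr_of_eventuallyEq (Eventually.of_forall fun s => ?_)
  simp only [Function.comp]
  rw [R.emb_mul hN, ← mul_assoc, emb_mul_emb_neg, one_mul]

theorem compL_one_maurerCartan (R : S.NilRep A N) (hN : r ≤ N) [FiniteDimensional ℝ E] {γ : ℝ → E} {t : ℝ}
    (hγ : DifferentiableAt ℝ γ t) : S.compL 1 (S.maurerCartan γ t) = S.compL 1 (deriv γ t) := by
  have h1 : HasDerivAt (fun s => S.mul (-γ t) (γ s)) (S.maurerCartan γ t) t :=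
    (((R.contDiff_mul hN (-γ t)).differentiable one_ne_zero (γ t)).hasFDerivAt).comp_hasDerivAt t
      hγ.hasDerivAt
  set L := LinearMap.toContinuousLinearMap (S.compL 1)
  have h2 := L.hasFDerivAt.comp_hasDerivAt t h1
  have h3 := (L.hasFDerivAt.comp_hasDerivAt t hγ.hasDerivAt).const_add (L (-γ t))
  refine h2.unique (h3.congr_of_eventuallyEq (Eventually.of_forall fun s => ?_))
  exact S.compL_one_mul _ _

end NilRep

end StratifiedLieAlgebra

/-! ### Square integrable controls on the unit interval -/

theorem integral_mul_le_sqrt_mul_sqrt {α : Type*} {m : MeasurableSpace α} {ν : Measure α} {f g : α → ℝ}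
    (hf0 : 0 ≤ f) (hg0 : 0 ≤ g) (hf : MemLp f 2 ν) (hg : MemLp g 2 ν) :
    ∫ a, f a * g a ∂ν ≤ √(∫ a, f a ^ 2 ∂ν) * √(∫ a, g a ^ 2 ∂ν) := by
  have h := integral_mul_le_Lp_mul_Lq_of_nonneg (μ := ν) Real.HolderConjugate.two_two
    (Eventually.of_forall hf0) (Eventually.of_forall hg0) (by simpa using hf) (by simpa using hg)
  simpa [Real.sqrt_eq_rpow] using h

/-- The Lebesgue measure on the unit interval. -/
abbrev volUnit : Measure ℝ := volume.restrict (Icc (0 : ℝ) 1)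

section Control

variable {F : Type*} [NormedAddCommGroup F]

theorem MeasureTheory.MemLp.integrableOn_unit {h : ℝ → F} (hh : MemLp h 2 volUnit) :
    IntegrableOn h (Icc (0 : ℝ) 1) := hh.integrable (by norm_num)

theorem intervalIntegrable_of_integrableOn_unit {h : ℝ → F} (hh : IntegrableOn h (Icc (0 : ℝ) 1))
    {a b : ℝ} (ha : a ∈ Icc (0 : ℝ) 1) (hb : b ∈ Icc (0 : ℝ) 1) : IntervalIntegrable h volume a b :=
  (hh.mono_set (uIcc_subset_Icc ha hb)).intervalIntegrable

theorem intervalIntegral_norm_le {h : ℝ → F} (hh : MemLp h 2 volUnit) {C : ℝ}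
    (hC : ∫ s, ‖h s‖ ^ 2 ∂volUnit ≤ C) {a b : ℝ} (ha : 0 ≤ a) (hab : a ≤ b) (hb : b ≤ 1) :
    ∫ s in a..b, ‖h s‖ ≤ √(b - a) * √C := by
  have hsub : Ioc a b ⊆ Icc 0 1 := fun x hx => ⟨ha.trans hx.1.le, hx.2.trans hb⟩
  have hhr : MemLp h 2 (volume.restrict (Ioc a b)) := hh.mono_measure (Measure.restrict_mono hsub le_rfl)
  have h1 := integral_mul_le_sqrt_mul_sqrt (ν := volume.restrict (Ioc a b)) (f := fun _ => 1)
    (g := fun s => ‖h s‖) (fun _ => zero_le_one) (fun _ => norm_nonneg _) (memLp_const 1) hhr.norm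
  rw [intervalIntegral.integral_of_le hab]
  simp only [one_mul, one_pow, integral_const, measureReal_restrict_apply_univ, Real.volume_real_Ioc_of_le hab,
    smul_eq_mul, mul_one] at h1
  refine h1.trans ?_
  gcongr
  refine le_trans ?_ hC
  exact setIntegral_mono_set (hh.integrable_norm_pow two_ne_zero)
    (Eventually.of_forall fun s => by positivity) (Eventually.of_forall hsub)

end Control

/-! ### Iterated integrals and the flow of a control -/

section Iterated

variable {F : Type*} [NormedAddCommGroup F] [NormedSpace ℝ F]
  {A : Type*} [NormedRing A] [NormedAlgebra ℝ A]

theorem integrableOn_mul_control (σ : F →L[ℝ] A) {h : ℝ → F} (hh : IntegrableOn h (Icc (0 : ℝ) 1))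
    {B : ℝ → A} (hB : ContinuousOn B (Icc 0 1)) :
    IntegrableOn (fun s => B s * σ (h s)) (Icc (0 : ℝ) 1) :=
  IntegrableOn.continuousOn_mul hB (σ.integrable_comp hh) isCompact_Icc

theorem intervalIntegral_mul_right [CompleteSpace A] {f : ℝ → A} {a b : ℝ} (hf : IntervalIntegrable f volume a b) (w : A) :
    (∫ s in a..b, f s) * w = ∫ s in a..b, f s * w :=
  (((ContinuousLinearMap.mul ℝ A).flip w).intervalIntegral_comp_comm hf).symm

/-- The iterated integrals of the control `h`. -/
def iterInt (σ : F →L[ℝ] A) (h : ℝ → F) : ℕ → ℝ → A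
  | 0 => fun _ => 1
  | k + 1 => fun t => ∫ s in (0 : ℝ)..t, iterInt σ h k s * σ (h s)

variable {σ : F →L[ℝ] A}

theorem continuousOn_iterInt {h : ℝ → F} (hh : IntegrableOn h (Icc (0 : ℝ) 1)) (k : ℕ) :
    ContinuousOn (iterInt σ h k) (Icc 0 1) := by
  induction k with
  | zero => exact continuousOn_const
  | succ k ih =>
    have := intervalIntegral.continuousOn_primitive_interval (a := 0) (b := 1) (μ := volume)
      (by rw [uIcc_of_le zero_le_one]; exact integrableOn_mul_control σ hh ih)
    rwa [uIcc_of_le zero_le_one] at this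

/-- The solution of `G' = G σ(h)`, `G 0 = 1`, for `σ` with values in a nilpotent set. -/
def flow (N : ℕ) (σ : F →L[ℝ] A) (h : ℝ → F) (t : ℝ) : A := ∑ k ∈ Finset.range N, iterInt σ h k t

theorem continuousOn_flow {N : ℕ} {h : ℝ → F} (hh : IntegrableOn h (Icc (0 : ℝ) 1)) :
    ContinuousOn (flow N σ h) (Icc 0 1) :=
  continuousOn_finsetSum _ fun k _ => continuousOn_iterInt hh k

/-- A $k$-fold iterated integral behaves like a product of $k$ values of $\sigma$, so $N-k$ further
factors kill it. The induction moves $\sigma(h(s))$ from the integrand to the head of the product.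
-/
theorem iterInt_mul_prod_eq_zero [CompleteSpace A] {N : ℕ}
    (hσ : ∀ v : Fin N → F, (List.ofFn fun i => σ (v i)).prod = 0)
    {h : ℝ → F} (hh : IntegrableOn h (Icc (0 : ℝ) 1)) (k : ℕ) {t : ℝ} (ht : t ∈ Icc (0 : ℝ) 1) {j : ℕ}
    (hj : j + k = N) (v : Fin j → F) : iterInt σ h k t * (List.ofFn fun i => σ (v i)).prod = 0 := by
  induction k generalizing t j with
  | zero =>
    obtain rfl : j = N := by omega
    rw [hσ, mul_zero]
  | succ k ih =>
    rw [iterInt, intervalIntegral_mul_right (intervalIntegrable_of_integrableOn_unit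
      (integrableOn_mul_control σ hh (continuousOn_iterInt hh k)) (by simp) ht)]
    rw [intervalIntegral.integral_congr (g := fun _ => 0)]
    · simp
    · intro s hs
      rw [uIcc_of_le ht.1] at hs
      have := ih (t := s) ⟨hs.1, hs.2.trans ht.2⟩ (j := j + 1) (by omega) (Fin.cons (h s) v)
      simpa [List.ofFn_succ, mul_assoc] using this

/-- The integral shifts the index of the iterated integrals by one, and the $N$-th one vanishes: the
Picard series terminates. -/
theorem flow_eq [CompleteSpace A] {N : ℕ} (hσ : ∀ v : Fin N → F, (List.ofFn fun i => σ (v i)).prod = 0)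
    {h : ℝ → F} (hh : IntegrableOn h (Icc (0 : ℝ) 1)) {t : ℝ} (ht : t ∈ Icc (0 : ℝ) 1) :
    flow N σ h t = 1 + ∫ s in (0 : ℝ)..t, flow N σ h s * σ (h s) := by
  have h0 : iterInt σ h N t = 0 := by
    simpa using iterInt_mul_prod_eq_zero hσ hh N ht (j := 0) (by omega) Fin.elim0
  have h1 : ∫ s in (0 : ℝ)..t, flow N σ h s * σ (h s) = ∑ k ∈ Finset.range N, iterInt σ h (k + 1) t := by
    simp only [flow, Finset.sum_mul]
    rw [intervalIntegral.integral_finsetSum]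
    · rfl
    · intro k _
      exact intervalIntegrable_of_integrableOn_unit
        (integrableOn_mul_control σ hh (continuousOn_iterInt hh k)) (by simp) ht
  have h2 := Finset.sum_range_succ' (fun k => iterInt σ h k t) N
  rw [Finset.sum_range_succ, h0, add_zero] at h2
  rw [h1, flow, h2, add_comm]
  rfl

/-- Uniqueness by nilpotency instead of Grönwall: $D$ times any $N$ values of $\sigma$ vanishes, and
each use of the equation lowers the number of factors needed by one, down to none. -/
theorem eq_zero_of_integral_eq [CompleteSpace A] {N : ℕ} (hσ : ∀ v : Fin N → F, (List.ofFn fun i => σ (v i)).prod = 0)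
    {h : ℝ → F} (hh : IntegrableOn h (Icc (0 : ℝ) 1)) {a b : ℝ} (ha : 0 ≤ a) (hb : b ≤ 1)
    {D : ℝ → A} (hD : ContinuousOn D (Icc a b))
    (heq : ∀ t ∈ Icc a b, D t = ∫ s in a..t, D s * σ (h s)) {t : ℝ} (ht : t ∈ Icc a b) : D t = 0 := by
  have key : ∀ k ≤ N, ∀ t ∈ Icc a b, ∀ v : Fin (N - k) → F, D t * (List.ofFn fun i => σ (v i)).prod = 0 := by
    intro k
    induction k with
    | zero => intro _ t _ v; simp only [Nat.sub_zero] at v ⊢; rw [hσ, mul_zero]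
    | succ k ih =>
      intro hk t ht v
      have hint : IntegrableOn (fun s => D s * σ (h s)) (Icc a b) :=
        IntegrableOn.continuousOn_mul hD
          (σ.integrable_comp (hh.mono_set (Icc_subset_Icc ha hb))) isCompact_Icc
      rw [heq t ht, intervalIntegral_mul_right (hint.mono_set
        (by rw [uIcc_of_le ht.1]; exact Icc_subset_Icc le_rfl ht.2)).intervalIntegrable,
        intervalIntegral.integral_congr (g := fun _ => 0)]
      · simp
      · intro s hs
        rw [uIcc_of_le ht.1] at hs
        have h1 := ih (by omega) s ⟨hs.1, hs.2.trans ht.2⟩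
        rw [show N - k = (N - (k + 1)) + 1 by omega] at h1
        simpa [List.ofFn_succ, mul_assoc] using h1 (Fin.cons (h s) v)
  have h2 := key N le_rfl t ht
  rw [Nat.sub_self] at h2
  simpa using h2 Fin.elim0

theorem eqOn_flow [CompleteSpace A] {N : ℕ} (hσ : ∀ v : Fin N → F, (List.ofFn fun i => σ (v i)).prod = 0)
    {h : ℝ → F} (hh : IntegrableOn h (Icc (0 : ℝ) 1)) {G : ℝ → A} (hG : ContinuousOn G (Icc 0 1))
    (heq : ∀ t ∈ Icc (0 : ℝ) 1, G t = 1 + ∫ s in (0 : ℝ)..t, G s * σ (h s)) {t : ℝ}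
    (ht : t ∈ Icc (0 : ℝ) 1) : G t = flow N σ h t := by
  rw [← sub_eq_zero]
  refine eq_zero_of_integral_eq hσ hh le_rfl le_rfl (D := fun t => G t - flow N σ h t)
    (hG.sub (continuousOn_flow hh)) (fun t ht => ?_) ht
  simp only [sub_mul]
  rw [intervalIntegral.integral_sub, heq t ht, flow_eq hσ hh ht]
  · abel
  · exact intervalIntegrable_of_integrableOn_unit (integrableOn_mul_control σ hh hG) (by simp) ht
  · exact intervalIntegrable_of_integrableOn_unit
      (integrableOn_mul_control σ hh (continuousOn_flow hh)) (by simp) ht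

end Iterated

/-! ### Continuity of the flow along controls with converging primitives -/

section Convergence

variable {F : Type*} [NormedAddCommGroup F] [NormedSpace ℝ F]
  {A : Type*} [NormedRing A] [NormedAlgebra ℝ A] {σ : F →L[ℝ] A}

theorem norm_integral_mul_control_le {h : ℝ → F} (hh : IntegrableOn h (Icc (0 : ℝ) 1)) {B : ℝ → A}
    {a b ε : ℝ} (hab : a ≤ b) (ha : a ∈ Icc (0 : ℝ) 1) (hb : b ∈ Icc (0 : ℝ) 1)
    (hε : ∀ s ∈ Icc a b, ‖B s‖ ≤ ε) :
    ‖∫ s in a..b, B s * σ (h s)‖ ≤ ε * ‖σ‖ * ∫ s in a..b, ‖h s‖ := by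
  rw [← intervalIntegral.integral_const_mul]
  refine intervalIntegral.norm_integral_le_of_norm_le hab (Eventually.of_forall fun s hs => ?_)
    ((intervalIntegrable_of_integrableOn_unit hh.norm ha hb).const_mul _)
  have h1 := hε s ⟨hs.1.le, hs.2⟩
  calc ‖B s * σ (h s)‖ ≤ ‖B s‖ * (‖σ‖ * ‖h s‖) :=
        (norm_mul_le _ _).trans (by gcongr; exact σ.le_opNorm _)
    _ ≤ ε * (‖σ‖ * ‖h s‖) := by gcongr
    _ = _ := by ring

/-- Freezing $B$ at the points of a fine partition makes the integral a finite combination of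
increments of the primitive, which converge. The error is uniform in $n$ by the $L^2$ bound. -/
theorem tendsto_integral_mul_control [CompleteSpace F] [CompleteSpace A] {h : ℕ → ℝ → F} {h' : ℝ → F}
    (hh : ∀ n, MemLp (h n) 2 volUnit)
    (hh' : MemLp h' 2 volUnit) {C : ℝ} (hC : ∀ n, ∫ s, ‖h n s‖ ^ 2 ∂volUnit ≤ C)
    (hlim : ∀ t ∈ Icc (0 : ℝ) 1, Tendsto (fun n => ∫ s in (0 : ℝ)..t, h n s) atTop
      (𝓝 (∫ s in (0 : ℝ)..t, h' s)))
    {B : ℝ → A} (hB : ContinuousOn B (Icc 0 1)) {t : ℝ} (ht : t ∈ Icc (0 : ℝ) 1) :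
    Tendsto (fun n => ∫ s in (0 : ℝ)..t, B s * σ (h n s)) atTop
      (𝓝 (∫ s in (0 : ℝ)..t, B s * σ (h' s))) := by
  set C' := max C (∫ s, ‖h' s‖ ^ 2 ∂volUnit) with hC'
  have huc := isCompact_Icc.uniformContinuousOn_of_continuous hB
  rw [Metric.uniformContinuousOn_iff_le] at huc
  have step : ∀ ε > 0, ∃ T : (ℝ → F) → A, (∀ f, MemLp f 2 volUnit → ∫ s, ‖f s‖ ^ 2 ∂volUnit ≤ C' →
      ‖(∫ s in (0 : ℝ)..t, B s * σ (f s)) - T f‖ ≤ ε * (‖σ‖ * √C')) ∧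
      Tendsto (fun n => T (h n)) atTop (𝓝 (T h')) := by
    intro ε hε
    obtain ⟨δ, hδ, hδB⟩ := huc ε hε
    obtain ⟨m, hm⟩ := exists_nat_gt (δ⁻¹)
    have hm0 : (0 : ℝ) < m := (inv_pos.mpr hδ).trans hm
    set p : ℕ → ℝ := fun j => j * t / m with hp
    have hp01 : ∀ j ≤ m, p j ∈ Icc (0 : ℝ) 1 := by
      intro j hj
      have hj' : (j : ℝ) ≤ m := by exact_mod_cast hj
      refine ⟨by have := ht.1; positivity, ?_⟩
      rw [hp]; simp only
      rw [div_le_one hm0]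
      nlinarith [ht.1, ht.2]
    have hpmono : ∀ j, p j ≤ p (j + 1) := by
      intro j
      rw [hp]; simp only
      have := ht.1
      gcongr
      simp
    have hp0 : p 0 = 0 := by simp [hp]
    have hpm : p m = t := by rw [hp]; field_simp
    refine ⟨fun f => ∑ j ∈ Finset.range m, B (p j) * σ ((∫ s in (0 : ℝ)..p (j + 1), f s) -
      ∫ s in (0 : ℝ)..p j, f s), ?_, ?_⟩
    · intro f hf hfC
      have hfi := hf.integrableOn_unit
      have hadj : ∀ (φ : ℝ → A), IntegrableOn φ (Icc 0 1) → ∫ s in (0 : ℝ)..t, φ s =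
          ∑ j ∈ Finset.range m, ∫ s in p j..p (j + 1), φ s := by
        intro φ hφ
        have := intervalIntegral.sum_integral_adjacent_intervals (f := φ) (μ := volume) (a := p) (n := m)
          (fun k hk => intervalIntegrable_of_integrableOn_unit hφ (hp01 k hk.le) (hp01 (k + 1) hk))
        rw [this, hp0, hpm]
      rw [hadj _ (integrableOn_mul_control σ hfi hB), ← Finset.sum_sub_distrib]
      have hterm : ∀ j ∈ Finset.range m, ‖(∫ s in p j..p (j + 1), B s * σ (f s)) -
          B (p j) * σ ((∫ s in (0 : ℝ)..p (j + 1), f s) - ∫ s in (0 : ℝ)..p j, f s)‖ ≤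
          ε * ‖σ‖ * ∫ s in p j..p (j + 1), ‖f s‖ := by
        intro j hj
        have hj' := Finset.mem_range.mp hj
        have h1 := intervalIntegrable_of_integrableOn_unit hfi (hp01 j hj'.le) (hp01 (j + 1) hj')
        rw [intervalIntegral.integral_interval_sub_left
          (intervalIntegrable_of_integrableOn_unit hfi (by simp) (hp01 (j + 1) hj'))
          (intervalIntegrable_of_integrableOn_unit hfi (by simp) (hp01 j hj'.le)),
          ← σ.intervalIntegral_comp_comm h1]
        have h2 : B (p j) * ∫ s in p j..p (j + 1), σ (f s) = ∫ s in p j..p (j + 1), B (p j) * σ (f s) :=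
          ((ContinuousLinearMap.mul ℝ A (B (p j))).intervalIntegral_comp_comm
            (f := fun s => σ (f s)) ⟨σ.integrable_comp h1.1, σ.integrable_comp h1.2⟩).symm
        rw [h2, ← intervalIntegral.integral_sub]
        · simp only [← sub_mul]
          refine norm_integral_mul_control_le hfi (hpmono j) (hp01 j hj'.le) (hp01 (j + 1) hj') ?_
          intro s hs
          rw [← dist_eq_norm]
          refine hδB s ⟨(hp01 j hj'.le).1.trans hs.1, hs.2.trans (hp01 (j + 1) hj').2⟩ _ (hp01 j hj'.le) ?_
          rw [Real.dist_eq, abs_of_nonneg (sub_nonneg.mpr hs.1)]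
          have h3 : p (j + 1) - p j ≤ 1 / m := by
            rw [hp]; simp only
            push_cast
            rw [← sub_div]
            gcongr
            nlinarith [ht.2]
          have h4 : 1 / (m : ℝ) ≤ δ := by
            rw [div_le_iff₀ hm0]
            rw [inv_lt_iff_one_lt_mul₀ hδ] at hm
            linarith
          linarith [hs.2]
        · exact intervalIntegrable_of_integrableOn_unit (integrableOn_mul_control σ hfi hB)
            (hp01 j hj'.le) (hp01 (j + 1) hj')
        · exact intervalIntegrable_of_integrableOn_unit (integrableOn_mul_control σ hfi continuousOn_const)
            (hp01 j hj'.le) (hp01 (j + 1) hj')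
      refine (norm_sum_le _ _).trans ((Finset.sum_le_sum hterm).trans ?_)
      rw [← Finset.mul_sum, intervalIntegral.sum_integral_adjacent_intervals (f := fun s => ‖f s‖)
        (fun k hk => intervalIntegrable_of_integrableOn_unit hfi.norm (hp01 k hk.le) (hp01 (k + 1) hk)),
        hp0, hpm, mul_assoc]
      gcongr
      refine (intervalIntegral_norm_le hf hfC le_rfl ht.1 ht.2).trans ?_
      rw [sub_zero]
      have : √t ≤ 1 := Real.sqrt_le_one.mpr ht.2
      nlinarith [Real.sqrt_nonneg C']
    · refine tendsto_finsetSum _ fun j hj => ?_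
      have hj' := Finset.mem_range.mp hj
      refine Tendsto.const_mul _ ?_
      exact (σ.continuous.tendsto _).comp ((hlim _ (hp01 (j + 1) hj')).sub (hlim _ (hp01 j hj'.le)))
  rw [Metric.tendsto_atTop]
  intro ε hε
  set K := ‖σ‖ * √C' with hK
  have hK0 : 0 ≤ K := by positivity
  -- One third of $\varepsilon$ for each of the two approximations and for the convergence of $T$;
  -- the $+1$ covers $K=0$.
  obtain ⟨T, hT, hTlim⟩ := step (ε / (3 * (K + 1))) (by positivity)
  obtain ⟨n0, hn0⟩ := Metric.tendsto_atTop.mp hTlim (ε / 3) (by positivity)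
  refine ⟨n0, fun n hn => ?_⟩
  have h1 := hT (h n) (hh n) ((hC n).trans (le_max_left _ _))
  have h2 := hT h' hh' (le_max_right _ _)
  have h3 := hn0 n hn
  have h4 : ε / (3 * (K + 1)) * K < ε / 3 := by
    rw [div_mul_eq_mul_div, div_lt_div_iff₀ (by positivity) (by positivity)]
    nlinarith
  rw [← dist_eq_norm] at h1 h2
  have := dist_triangle4 (∫ s in (0 : ℝ)..t, B s * σ (h n s)) (T (h n)) (T h')
    (∫ s in (0 : ℝ)..t, B s * σ (h' s))
  rw [dist_comm (T h')] at this
  linarith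

theorem norm_iterInt_le [NormOneClass A] {h : ℝ → F} (hh : MemLp h 2 volUnit) {C : ℝ}
    (hC : ∫ s, ‖h s‖ ^ 2 ∂volUnit ≤ C) (k : ℕ) {t : ℝ} (ht : t ∈ Icc (0 : ℝ) 1) :
    ‖iterInt σ h k t‖ ≤ (‖σ‖ * √C) ^ k := by
  induction k generalizing t with
  | zero => simp [iterInt]
  | succ k ih =>
    have h1 := norm_integral_mul_control_le (σ := σ) hh.integrableOn_unit (B := iterInt σ h k)
      (ε := (‖σ‖ * √C) ^ k) ht.1 (by simp) ht (fun s hs => ih ⟨hs.1, hs.2.trans ht.2⟩)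
    refine h1.trans ?_
    have h2 := intervalIntegral_norm_le hh hC le_rfl ht.1 ht.2
    have h3 : √(t - 0) ≤ 1 := by rw [sub_zero]; exact Real.sqrt_le_one.mpr ht.2
    have h4 : ∫ s in (0 : ℝ)..t, ‖h s‖ ≤ √C := h2.trans (by nlinarith [Real.sqrt_nonneg C])
    rw [pow_succ, mul_assoc]
    gcongr

/-- The integrand is split so that only one factor varies at a time. The difference of the lower
iterated integrals tends to $0$ in $L^2$ by dominated convergence, and Cauchy–Schwarz pairs it with
the bounded controls; the rest is a fixed continuous integrand against $h_n$. -/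
theorem tendsto_iterInt [CompleteSpace F] [CompleteSpace A] [NormOneClass A] {h : ℕ → ℝ → F} {h' : ℝ → F}
    (hh : ∀ n, MemLp (h n) 2 volUnit)
    (hh' : MemLp h' 2 volUnit) {C : ℝ} (hC : ∀ n, ∫ s, ‖h n s‖ ^ 2 ∂volUnit ≤ C)
    (hlim : ∀ t ∈ Icc (0 : ℝ) 1, Tendsto (fun n => ∫ s in (0 : ℝ)..t, h n s) atTop
      (𝓝 (∫ s in (0 : ℝ)..t, h' s))) (k : ℕ) {t : ℝ} (ht : t ∈ Icc (0 : ℝ) 1) :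
    Tendsto (fun n => iterInt σ (h n) k t) atTop (𝓝 (iterInt σ h' k t)) := by
  induction k generalizing t with
  | zero => exact tendsto_const_nhds
  | succ k ih =>
    have hmain := tendsto_integral_mul_control (σ := σ) hh hh' hC hlim
      (continuousOn_iterInt (σ := σ) hh'.integrableOn_unit k) ht
    set d : ℕ → ℝ → A := fun n s => iterInt σ (h n) k s - iterInt σ h' k s with hd
    have hdc : ∀ n, ContinuousOn (d n) (Icc 0 1) := fun n =>
      (continuousOn_iterInt (hh n).integrableOn_unit k).sub (continuousOn_iterInt hh'.integrableOn_unit k)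
    have hdm : ∀ n, AEStronglyMeasurable (d n) volUnit := fun n =>
      (hdc n).aestronglyMeasurable measurableSet_Icc
    set C' := max C (∫ s, ‖h' s‖ ^ 2 ∂volUnit) with hC'
    have hdb : ∀ n, ∀ s ∈ Icc (0 : ℝ) 1, ‖d n s‖ ≤ 2 * (‖σ‖ * √C') ^ k := by
      intro n s hs
      have h1 := norm_iterInt_le (σ := σ) (hh n) (C := C') ((hC n).trans (le_max_left _ _)) k hs
      have h2 := norm_iterInt_le (σ := σ) hh' (C := C') (le_max_right _ _) k hs
      exact (norm_sub_le _ _).trans (by linarith)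
    have hdL : ∀ n, MemLp (d n) 2 volUnit := fun n =>
      MemLp.of_bound (hdm n) (2 * (‖σ‖ * √C') ^ k)
        ((ae_restrict_mem measurableSet_Icc).mono (hdb n))
    have hdlim : Tendsto (fun n => ∫ s, ‖d n s‖ ^ 2 ∂volUnit) atTop (𝓝 0) := by
      have : Tendsto (fun n => ∫ s, ‖d n s‖ ^ 2 ∂volUnit) atTop (𝓝 (∫ s, (0 : ℝ) ∂volUnit)) := by
        refine tendsto_integral_of_dominated_convergence (fun _ => (2 * (‖σ‖ * √C') ^ k) ^ 2)
          (fun n => (hdm n).norm.pow 2) (integrable_const _) (fun n => ?_) ?_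
        · refine (ae_restrict_mem measurableSet_Icc).mono fun s hs => ?_
          rw [Real.norm_of_nonneg (by positivity)]
          have := hdb n s hs
          gcongr
        · refine (ae_restrict_mem measurableSet_Icc).mono fun s hs => ?_
          have h1 : Tendsto (fun n => d n s) atTop (𝓝 0) := by
            simpa [hd] using (ih hs).sub_const (iterInt σ h' k s)
          simpa using h1.norm.pow 2
      simpa using this
    have hfirst : Tendsto (fun n => ∫ s in (0 : ℝ)..t, d n s * σ (h n s)) atTop (𝓝 0) := by
      have hb : ∀ n, ‖∫ s in (0 : ℝ)..t, d n s * σ (h n s)‖ ≤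
          ‖σ‖ * (√(∫ s, ‖d n s‖ ^ 2 ∂volUnit) * √C) := by
        intro n
        have hp : Integrable (fun s => ‖d n s‖ * ‖h n s‖) volUnit := (hdL n).norm.integrable_mul (hh n).norm
        have h1 : ‖∫ s in (0 : ℝ)..t, d n s * σ (h n s)‖ ≤ ∫ s in (0 : ℝ)..t, ‖σ‖ * (‖d n s‖ * ‖h n s‖) := by
          refine intervalIntegral.norm_integral_le_of_norm_le ht.1 (Eventually.of_forall fun s hs => ?_)
            (intervalIntegrable_of_integrableOn_unit (hp.const_mul _) (by simp) ht)
          calc ‖d n s * σ (h n s)‖ ≤ ‖d n s‖ * (‖σ‖ * ‖h n s‖) :=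
                (norm_mul_le _ _).trans (by gcongr; exact σ.le_opNorm _)
            _ = _ := by ring
        refine h1.trans ?_
        rw [intervalIntegral.integral_const_mul]
        gcongr
        have h2 := integral_mul_le_sqrt_mul_sqrt (ν := volUnit) (fun s => norm_nonneg (d n s))
          (fun s => norm_nonneg (h n s)) (hdL n).norm (hh n).norm
        refine le_trans ?_ (h2.trans (by gcongr; exact hC n))
        rw [intervalIntegral.integral_of_le ht.1]
        exact setIntegral_mono_set hp (Eventually.of_forall fun s => by positivity)
          (Eventually.of_forall fun s hs => ⟨hs.1.le, hs.2.trans ht.2⟩)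
      refine squeeze_zero_norm hb ?_
      have := ((hdlim.sqrt).mul_const (√C)).const_mul ‖σ‖
      simpa using this
    have := hfirst.add hmain
    rw [zero_add] at this
    refine this.congr fun n => ?_
    simp only [hd, sub_mul]
    rw [intervalIntegral.integral_sub, iterInt, sub_add_cancel]
    · exact intervalIntegrable_of_integrableOn_unit (integrableOn_mul_control σ (hh n).integrableOn_unit
        (continuousOn_iterInt (hh n).integrableOn_unit k)) (by simp) ht
    · exact intervalIntegrable_of_integrableOn_unit (integrableOn_mul_control σ (hh n).integrableOn_unit
        (continuousOn_iterInt hh'.integrableOn_unit k)) (by simp) ht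

theorem tendsto_flow [CompleteSpace F] [CompleteSpace A] [NormOneClass A] {h : ℕ → ℝ → F} {h' : ℝ → F}
    (hh : ∀ n, MemLp (h n) 2 volUnit)
    (hh' : MemLp h' 2 volUnit) {C : ℝ} (hC : ∀ n, ∫ s, ‖h n s‖ ^ 2 ∂volUnit ≤ C)
    (hlim : ∀ t ∈ Icc (0 : ℝ) 1, Tendsto (fun n => ∫ s in (0 : ℝ)..t, h n s) atTop
      (𝓝 (∫ s in (0 : ℝ)..t, h' s))) (N : ℕ) {t : ℝ} (ht : t ∈ Icc (0 : ℝ) 1) :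
    Tendsto (fun n => flow N σ (h n) t) atTop (𝓝 (flow N σ h' t)) :=
  tendsto_finsetSum _ fun k _ => tendsto_iterInt hh hh' hC hlim k ht

end Convergence

/-! ### The cost of a control -/

section Cost

variable {F : Type*} [NormedAddCommGroup F] [InnerProductSpace ℝ F]

/-- The Legendre transform of `Λ` with values in `[0, ∞]`. -/
def cost (Λ : F → ℝ) (u : F) : ℝ≥0∞ := ⨆ v : F, ENNReal.ofReal (⟪v, u⟫ - Λ v)

theorem toENNReal_legendre (Λ : F → ℝ) (u : F) : (legendre Λ u).toENNReal = cost Λ u := by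
  apply le_antisymm
  · have h : legendre Λ u ≤ ((cost Λ u : ℝ≥0∞) : EReal) := by
      refine iSup_le fun v => ?_
      have h1 : ((⟪v, u⟫ - Λ v : ℝ) : EReal) ≤ ((ENNReal.ofReal (⟪v, u⟫ - Λ v) : ℝ≥0∞) : EReal) := by
        rw [EReal.coe_ennreal_ofReal]
        exact_mod_cast le_max_left _ _
      exact h1.trans (by exact_mod_cast le_iSup (fun v => ENNReal.ofReal (⟪v, u⟫ - Λ v)) v)
    simpa using EReal.toENNReal_le_toENNReal h
  · refine iSup_le fun v => ?_
    rw [← EReal.real_coe_toENNReal]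
    exact EReal.toENNReal_le_toENNReal (le_iSup (fun v => ((⟪v, u⟫ - Λ v : ℝ) : EReal)) v)

theorem ofReal_le_cost (Λ : F → ℝ) (u v : F) : ENNReal.ofReal (⟪v, u⟫ - Λ v) ≤ cost Λ u :=
  le_iSup (fun v => ENNReal.ofReal (⟪v, u⟫ - Λ v)) v

/-- The dual variable $u/(2\kappa)$ maximizes $\langle v,u\rangle-\kappa|v|^2$. This coercivity is
the source of all compactness below. -/
theorem ofReal_norm_sq_le_cost {Λ : F → ℝ} {κ : ℝ} (hκ : 0 < κ) (hΛ : ∀ v, Λ v ≤ κ * ‖v‖ ^ 2) (u : F) :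
    ENNReal.ofReal (‖u‖ ^ 2 / (4 * κ)) ≤ cost Λ u := by
  refine le_trans (ENNReal.ofReal_le_ofReal ?_) (ofReal_le_cost Λ u ((2 * κ)⁻¹ • u))
  have h := hΛ ((2 * κ)⁻¹ • u)
  rw [norm_smul, mul_pow, Real.norm_eq_abs, sq_abs] at h
  rw [real_inner_smul_left, real_inner_self_eq_norm_sq]
  have : ‖u‖ ^ 2 / (4 * κ) = (2 * κ)⁻¹ * ‖u‖ ^ 2 - κ * ((2 * κ)⁻¹ ^ 2 * ‖u‖ ^ 2) := by
    field_simp; ring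
  linarith

/-- Exhibits the squared norm as a cost, so that Jensen's inequality for costs also gives the $L^2$
contraction of averages. -/
theorem cost_norm_sq (u : F) : cost (fun v => ‖v‖ ^ 2 / 4) u = ENNReal.ofReal (‖u‖ ^ 2) := by
  apply le_antisymm
  · refine iSup_le fun v => ENNReal.ofReal_le_ofReal ?_
    have := real_inner_le_norm v u
    nlinarith [sq_nonneg (‖v‖ / 2 - ‖u‖)]
  · have := ofReal_norm_sq_le_cost (Λ := fun v : F => ‖v‖ ^ 2 / 4) (κ := 1 / 4) (by norm_num)
      (fun v => by linarith) u
    simpa using this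

theorem memLp_of_lintegral_cost [MeasurableSpace F] [BorelSpace F] [SecondCountableTopology F]
    {Λ : F → ℝ} {κ : ℝ} (hκ : 0 < κ)
    (hΛ : ∀ v, Λ v ≤ κ * ‖v‖ ^ 2) {h : ℝ → F} (hm : AEStronglyMeasurable h volUnit) {a : ℝ} (ha : 0 ≤ a)
    (hcost : ∫⁻ s, cost Λ (h s) ∂volUnit ≤ ENNReal.ofReal a) :
    MemLp h 2 volUnit ∧ ∫ s, ‖h s‖ ^ 2 ∂volUnit ≤ 4 * κ * a := by
  have h1 : ∫⁻ s, ENNReal.ofReal (‖h s‖ ^ 2) ∂volUnit ≤ ENNReal.ofReal (4 * κ * a) := by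
    have e : ∀ s, ENNReal.ofReal (‖h s‖ ^ 2) = ENNReal.ofReal (4 * κ) *
        ENNReal.ofReal (‖h s‖ ^ 2 / (4 * κ)) := by
      intro s
      rw [← ENNReal.ofReal_mul (by positivity)]
      congr 1
      field_simp
    simp_rw [e]
    rw [lintegral_const_mul' _ _ ENNReal.ofReal_ne_top, ENNReal.ofReal_mul (p := 4 * κ) (q := a) (by positivity)]
    exact mul_le_mul' le_rfl
      ((lintegral_mono fun s => ofReal_norm_sq_le_cost hκ hΛ (h s)).trans hcost)
  have hint : Integrable (fun s => ‖h s‖ ^ 2) volUnit := by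
    refine ⟨hm.norm.pow 2, ?_⟩
    rw [hasFiniteIntegral_iff_ofReal (Eventually.of_forall fun s => by positivity)]
    exact h1.trans_lt ENNReal.ofReal_lt_top
  refine ⟨(memLp_two_iff_integrable_sq_norm hm).mpr hint, ?_⟩
  rw [← ENNReal.ofReal_le_ofReal_iff (by positivity), ofReal_integral_eq_lintegral_ofReal hint
    (Eventually.of_forall fun s => by positivity)]
  exact h1

theorem ofReal_integral_le_lintegral {α : Type*} {m : MeasurableSpace α} {ν : Measure α} (f : α → ℝ) :
    ENNReal.ofReal (∫ a, f a ∂ν) ≤ ∫⁻ a, ENNReal.ofReal (f a) ∂ν := by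
  by_cases hf : Integrable f ν
  · rw [integral_eq_lintegral_pos_part_sub_lintegral_neg_part hf]
    refine (ENNReal.ofReal_le_ofReal (sub_le_self _ ENNReal.toReal_nonneg)).trans ?_
    exact ENNReal.ofReal_toReal_le
  · simp [integral_undef hf]

/-- Jensen's inequality for the cost. -/
theorem cost_smul_integral_le [CompleteSpace F] (Λ : F → ℝ) {h : ℝ → F} {a b : ℝ} (hab : a < b)
    (hh : IntegrableOn h (Ico a b)) :
    ENNReal.ofReal (b - a) * cost Λ ((b - a)⁻¹ • ∫ s in Ico a b, h s) ≤
      ∫⁻ s in Ico a b, cost Λ (h s) := by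
  have hba : 0 < b - a := sub_pos.mpr hab
  rw [cost, ENNReal.mul_iSup]
  refine iSup_le fun v => ?_
  rw [← ENNReal.ofReal_mul hba.le]
  have e : (b - a) * (⟪v, (b - a)⁻¹ • ∫ s in Ico a b, h s⟫ - Λ v) =
      ∫ s in Ico a b, (⟪v, h s⟫ - Λ v) := by
    rw [integral_sub (hh.const_inner v) (by simp), integral_inner hh, real_inner_smul_right]
    simp only [integral_const, measureReal_restrict_apply_univ, Real.volume_real_Ico_of_le hab.le,
      smul_eq_mul]
    field_simp
  rw [e]
  exact (ofReal_integral_le_lintegral _).trans (lintegral_mono fun s => ofReal_le_cost Λ (h s) v)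

end Cost

/-! ### Weak compactness of controls and weak lower semicontinuity of the cost -/

section Weak

variable {F : Type*} [NormedAddCommGroup F] [InnerProductSpace ℝ F] [FiniteDimensional ℝ F]

/-- Sequential Banach–Alaoglu in the dual of $L^2$, transported by the Riesz isomorphism. -/
theorem exists_weak_limit {h : ℕ → ℝ → F} (hh : ∀ n, MemLp (h n) 2 volUnit) {C : ℝ}
    (hC : ∀ n, ∫ s, ‖h n s‖ ^ 2 ∂volUnit ≤ C) :
    ∃ h' : ℝ → F, MemLp h' 2 volUnit ∧ ∃ φ : ℕ → ℕ, StrictMono φ ∧ ∀ g : ℝ → F, MemLp g 2 volUnit →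
      Tendsto (fun n => ∫ s, ⟪g s, h (φ n) s⟫ ∂volUnit) atTop (𝓝 (∫ s, ⟪g s, h' s⟫ ∂volUnit)) := by
  have : Fact ((2 : ℝ≥0∞) ≠ ∞) := ⟨by simp⟩
  set x : ℕ → Lp F 2 volUnit := fun n => (hh n).toLp (h n) with hx
  have hinner : ∀ {f g : ℝ → F} (hf : MemLp f 2 volUnit) (hg : MemLp g 2 volUnit),
      ⟪hf.toLp f, hg.toLp g⟫ = ∫ s, ⟪f s, g s⟫ ∂volUnit := by
    intro f g hf hg
    rw [L2.inner_def]
    refine integral_congr_ae ?_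
    filter_upwards [hf.coeFn_toLp, hg.coeFn_toLp] with s h1 h2
    rw [h1, h2]
  have hxn : ∀ n, ‖x n‖ ≤ √C := by
    intro n
    refine Real.le_sqrt_of_sq_le ?_
    rw [← real_inner_self_eq_norm_sq, hinner]
    simpa only [real_inner_self_eq_norm_sq] using hC n
  set ψ : ℕ → WeakDual ℝ (Lp F 2 volUnit) := fun n =>
    WeakDual.toStrongDual.symm (InnerProductSpace.toDual ℝ _ (x n)) with hψ
  obtain ⟨ψ', -, φ, hφ, hlim⟩ := WeakDual.isSeqCompact_closedBall ℝ (Lp F 2 volUnit) 0 (√C)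
    (x := ψ) (fun n => by
      simp only [hψ, mem_preimage, LinearEquiv.apply_symm_apply, mem_closedBall_zero_iff]
      rw [LinearIsometryEquiv.norm_map]
      exact hxn n)
  set y := (InnerProductSpace.toDual ℝ (Lp F 2 volUnit)).symm (WeakDual.toStrongDual ψ') with hy
  refine ⟨y, Lp.memLp y, φ, hφ, fun g hg => ?_⟩
  have h1 : Tendsto (fun n => ψ (φ n) (hg.toLp g)) atTop (𝓝 (ψ' (hg.toLp g))) :=
    ((WeakDual.eval_continuous (hg.toLp g)).tendsto ψ').comp hlim
  have h2 : ∀ n, ψ (φ n) (hg.toLp g) = ∫ s, ⟪g s, h (φ n) s⟫ ∂volUnit := by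
    intro n
    have : ψ (φ n) (hg.toLp g) = ⟪x (φ n), hg.toLp g⟫ := InnerProductSpace.toDual_apply_apply
    rw [this, real_inner_comm, hx, hinner]
  have h3 : ψ' (hg.toLp g) = ∫ s, ⟪g s, y s⟫ ∂volUnit := by
    have e1 : ψ' (hg.toLp g) = ⟪y, hg.toLp g⟫ := by
      rw [hy, InnerProductSpace.toDual_symm_apply]; rfl
    have e2 := hinner hg (Lp.memLp y)
    rw [Lp.toLp_coeFn] at e2
    rw [e1, real_inner_comm, e2]
  simp only [h2, h3] at h1
  exact h1

theorem tendsto_primitive_of_weak {h : ℕ → ℝ → F} {h' : ℝ → F}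
    (hh : ∀ n, MemLp (h n) 2 volUnit) (hh' : MemLp h' 2 volUnit)
    (hlim : ∀ g : ℝ → F, MemLp g 2 volUnit →
      Tendsto (fun n => ∫ s, ⟪g s, h n s⟫ ∂volUnit) atTop (𝓝 (∫ s, ⟪g s, h' s⟫ ∂volUnit)))
    {t : ℝ} (ht : t ∈ Icc (0 : ℝ) 1) :
    Tendsto (fun n => ∫ s in (0 : ℝ)..t, h n s) atTop (𝓝 (∫ s in (0 : ℝ)..t, h' s)) := by
  have key : ∀ (v : F) (f : ℝ → F), MemLp f 2 volUnit →
      ∫ s, ⟪(Ioc 0 t).indicator (fun _ => v) s, f s⟫ ∂volUnit = ⟪v, ∫ s in (0 : ℝ)..t, f s⟫ := by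
    intro v f hf
    have hsub : Ioc 0 t ⊆ Icc 0 1 := fun x hx => ⟨hx.1.le, hx.2.trans ht.2⟩
    have hfi : IntegrableOn f (Ioc 0 t) := hf.integrableOn_unit.mono_set hsub
    rw [intervalIntegral.integral_of_le ht.1, ← integral_inner hfi]
    have : (fun s => ⟪(Ioc 0 t).indicator (fun _ => v) s, f s⟫) =
        (Ioc 0 t).indicator fun s => ⟪v, f s⟫ := by
      ext s
      by_cases hs : s ∈ Ioc 0 t <;> simp [hs]
    rw [this, integral_indicator measurableSet_Ioc, Measure.restrict_restrict measurableSet_Ioc,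
      inter_eq_left.mpr hsub]
  set b := stdOrthonormalBasis ℝ F
  have hcoord : ∀ i, Tendsto (fun n => ⟪b i, ∫ s in (0 : ℝ)..t, h n s⟫) atTop
      (𝓝 ⟪b i, ∫ s in (0 : ℝ)..t, h' s⟫) := by
    intro i
    have hm : MemLp ((Ioc 0 t).indicator fun _ => b i) 2 volUnit :=
      (memLp_const (b i)).indicator measurableSet_Ioc
    have := hlim _ hm
    rw [key _ _ hh'] at this
    exact this.congr fun n => key _ _ (hh n)
  have := tendsto_finsetSum Finset.univ fun i _ => (hcoord i).smul_const (b i)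
  simpa only [b.sum_repr'] using this

theorem cost_eq_iSup_denseSeq {Λ : F → ℝ} (hΛ : Continuous Λ) (u : F) :
    cost Λ u = ⨆ k, ENNReal.ofReal (⟪TopologicalSpace.denseSeq F k, u⟫ -
      Λ (TopologicalSpace.denseSeq F k)) := by
  have hc : Continuous fun v => ENNReal.ofReal (⟪v, u⟫ - Λ v) :=
    ENNReal.continuous_ofReal.comp (by fun_prop)
  refine le_antisymm (iSup_le fun v => ?_) (iSup_le fun k => ofReal_le_cost Λ u _)
  have hcl : IsClosed {v | ENNReal.ofReal (⟪v, u⟫ - Λ v) ≤ ⨆ k, ENNReal.ofReal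
      (⟪TopologicalSpace.denseSeq F k, u⟫ - Λ (TopologicalSpace.denseSeq F k))} :=
    isClosed_le hc continuous_const
  refine closure_minimal ?_ hcl ((TopologicalSpace.denseRange_denseSeq F) v)
  rintro _ ⟨k, rfl⟩
  exact le_iSup (fun k => ENNReal.ofReal
    (⟪TopologicalSpace.denseSeq F k, u⟫ - Λ (TopologicalSpace.denseSeq F k))) k

/-- A measurable approximation of the optimal dual variable along `h`. -/
def dualApprox (Λ : F → ℝ) (h : ℝ → F) : ℕ → ℝ → F
  | 0 => fun _ => 0
  | k + 1 => fun s => if ⟪dualApprox Λ h k s, h s⟫ - Λ (dualApprox Λ h k s) <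
      ⟪TopologicalSpace.denseSeq F k, h s⟫ - Λ (TopologicalSpace.denseSeq F k) then
      TopologicalSpace.denseSeq F k else dualApprox Λ h k s

theorem measurable_dualApprox [MeasurableSpace F] [BorelSpace F] {Λ : F → ℝ} (hΛ : Continuous Λ)
    {h : ℝ → F} (hm : Measurable h) (k : ℕ) :
    Measurable (dualApprox Λ h k) := by
  induction k with
  | zero => exact measurable_const
  | succ k ih =>
    refine Measurable.ite (measurableSet_lt ?_ ?_) measurable_const ih
    · exact (ih.inner hm).sub (hΛ.measurable.comp ih)
    · exact (measurable_const.inner hm).sub measurable_const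

theorem exists_norm_dualApprox_le (Λ : F → ℝ) (h : ℝ → F) (k : ℕ) :
    ∃ C, ∀ s, ‖dualApprox Λ h k s‖ ≤ C ∧ |Λ (dualApprox Λ h k s)| ≤ C := by
  induction k with
  | zero => exact ⟨max 0 |Λ 0|, fun s => by simp [dualApprox]⟩
  | succ k ih =>
    obtain ⟨C, hC⟩ := ih
    refine ⟨max C (max ‖TopologicalSpace.denseSeq F k‖ |Λ (TopologicalSpace.denseSeq F k)|),
      fun s => ?_⟩
    simp only [dualApprox]
    split_ifs
    · simp
    · exact ⟨(hC s).1.trans (le_max_left _ _), (hC s).2.trans (le_max_left _ _)⟩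

/-- For a bounded measurable dual variable $g$, the functional $\int\langle g,h\rangle-\Lambda(g)$
is weakly continuous in $h$ and lies below the cost. The choices `dualApprox` along $h'$ make its
integrand increase to $\Lambda^*(h')$, and monotone convergence concludes. -/
theorem lintegral_cost_le_of_weak [MeasurableSpace F] [BorelSpace F] {Λ : F → ℝ} (hΛ : Continuous Λ)
    (hΛ0 : Λ 0 = 0) {h : ℕ → ℝ → F} {h' : ℝ → F}
    (hh : ∀ n, MemLp (h n) 2 volUnit) (hh' : MemLp h' 2 volUnit)
    (hlim : ∀ g : ℝ → F, MemLp g 2 volUnit →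
      Tendsto (fun n => ∫ s, ⟪g s, h n s⟫ ∂volUnit) atTop (𝓝 (∫ s, ⟪g s, h' s⟫ ∂volUnit)))
    {a : ℝ} (ha : 0 ≤ a) (hcost : ∀ n, ∫⁻ s, cost Λ (h n s) ∂volUnit ≤ ENNReal.ofReal a) :
    ∫⁻ s, cost Λ (h' s) ∂volUnit ≤ ENNReal.ofReal a := by
  wlog hm : Measurable h' generalizing h'
  · have hae := hh'.1.ae_eq_mk
    have := this (h' := hh'.1.mk h') ((memLp_congr_ae hae).mp hh') (fun g hg => by
      have e : ∫ s, ⟪g s, hh'.1.mk h' s⟫ ∂volUnit = ∫ s, ⟪g s, h' s⟫ ∂volUnit :=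
        integral_congr_ae (hae.mono fun s hs => by simp only [hs])
      rw [e]; exact hlim g hg) hh'.1.stronglyMeasurable_mk.measurable
    refine le_trans (le_of_eq (lintegral_congr_ae (hae.mono fun s hs => ?_))) this
    simp only [hs]
  set q : ℕ → ℝ → ℝ := fun k s => ⟪dualApprox Λ h' k s, h' s⟫ - Λ (dualApprox Λ h' k s) with hq
  have hqstep : ∀ k s, q (k + 1) s = max (q k s) (⟪TopologicalSpace.denseSeq F k, h' s⟫ -
      Λ (TopologicalSpace.denseSeq F k)) := by
    intro k s
    simp only [hq, dualApprox]
    split_ifs with hlt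
    · rw [max_eq_right hlt.le]
    · rw [max_eq_left (not_lt.mp hlt)]
  have hqmono : ∀ s, Monotone fun k => q k s := fun s =>
    monotone_nat_of_le_succ fun k => by rw [hqstep]; exact le_max_left _ _
  -- The approximation starts from the dual variable $0$, whose value is $0$ because $\Lambda(0)=0$.
  have hq0 : ∀ k s, 0 ≤ q k s := fun k s => by
    have := hqmono s (Nat.zero_le k)
    simpa [hq, dualApprox, hΛ0] using this
  have hqm : ∀ k, Measurable (q k) := fun k =>
    ((measurable_dualApprox hΛ hm k).inner hm).sub (hΛ.measurable.comp (measurable_dualApprox hΛ hm k))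
  have hcostq : ∀ s, cost Λ (h' s) = ⨆ k, ENNReal.ofReal (q k s) := by
    intro s
    rw [cost_eq_iSup_denseSeq hΛ]
    refine le_antisymm (iSup_le fun k => ?_) (iSup_le fun k => ?_)
    · refine le_trans (ENNReal.ofReal_le_ofReal ?_) (le_iSup (fun k => ENNReal.ofReal (q k s)) (k + 1))
      rw [hqstep]; exact le_max_right _ _
    · rw [← cost_eq_iSup_denseSeq hΛ]
      exact ofReal_le_cost _ _ _
  simp_rw [hcostq]
  rw [lintegral_iSup (fun k => (hqm k).ennreal_ofReal)
    fun i j hij s => ENNReal.ofReal_le_ofReal (hqmono s hij)]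
  refine iSup_le fun k => ?_
  obtain ⟨C, hC⟩ := exists_norm_dualApprox_le Λ h' k
  have hdm := measurable_dualApprox hΛ hm k
  have hgL : MemLp (dualApprox Λ h' k) 2 volUnit :=
    MemLp.of_bound hdm.aestronglyMeasurable C (Eventually.of_forall fun s => (hC s).1)
  have hΛi : Integrable (fun s => Λ (dualApprox Λ h' k s)) volUnit :=
    Integrable.of_bound (hΛ.measurable.comp hdm).aestronglyMeasurable C
      (Eventually.of_forall fun s => (hC s).2)
  have hii : ∀ f : ℝ → F, MemLp f 2 volUnit → Integrable (fun s => ⟪dualApprox Λ h' k s, f s⟫) volUnit :=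
    fun f hf => ((hgL.norm.integrable_mul hf.norm).mono' (hgL.1.inner hf.1)
      (Eventually.of_forall fun s => norm_inner_le_norm _ _))
  have hqi : Integrable (fun s => q k s) volUnit := (hii h' hh').sub hΛi
  rw [← ofReal_integral_eq_lintegral_ofReal hqi
    (Eventually.of_forall fun s => hq0 k s)]
  refine ENNReal.ofReal_le_ofReal ?_
  rw [hq]
  simp only
  rw [integral_sub (hii h' hh') hΛi]
  refine le_of_tendsto ((hlim _ hgL).sub_const _) (Eventually.of_forall fun n => ?_)
  rw [← integral_sub (hii _ (hh n)) hΛi, ← ENNReal.ofReal_le_ofReal_iff ha]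
  exact (ofReal_integral_le_lintegral _).trans
    ((lintegral_mono fun s => ofReal_le_cost Λ (h n s) _).trans (hcost n))

end Weak

/-! ### Step controls -/

section Step

variable {F : Type*}

/-- The control equal to `a j` on `[j / m, (j + 1) / m)`. -/
def stepCtl (m : ℕ) (a : ℕ → F) (s : ℝ) : F := a ⌊s * m⌋₊

/-- The interval `[j / m, (j + 1) / m)`. -/
def cell (m j : ℕ) : Set ℝ := Ico ((j : ℝ) / m) (((j + 1 : ℕ) : ℝ) / m)

theorem measurableSet_cell (m j : ℕ) : MeasurableSet (cell m j) := measurableSet_Ico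

theorem stepCtl_of_mem {m : ℕ} (hm : 0 < m) (a : ℕ → F) {j : ℕ} {s : ℝ} (hs : s ∈ cell m j) :
    stepCtl m a s = a j := by
  have hm' : (0 : ℝ) < m := by exact_mod_cast hm
  have h1 := (div_le_iff₀ hm').mp hs.1
  have h2 := (lt_div_iff₀ hm').mp hs.2
  rw [stepCtl, (Nat.floor_eq_iff ((Nat.cast_nonneg j).trans h1)).mpr ⟨h1, by exact_mod_cast h2⟩]

theorem Ico_zero_div_succ {m : ℕ} (hm : 0 < m) (k : ℕ) :
    Ico (0 : ℝ) (((k + 1 : ℕ) : ℝ) / m) = Ico (0 : ℝ) ((k : ℝ) / m) ∪ cell m k := by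
  rw [cell, Ico_union_Ico_eq_Ico (by positivity)]
  gcongr
  exact Nat.le_succ k

theorem disjoint_Ico_cell (m k : ℕ) : Disjoint (Ico (0 : ℝ) ((k : ℝ) / m)) (cell m k) :=
  Ico_disjoint_Ico_same

theorem lintegral_Ico_eq_sum_cell {m : ℕ} (hm : 0 < m) (f : ℝ → ℝ≥0∞) (k : ℕ) :
    ∫⁻ s in Ico (0 : ℝ) ((k : ℝ) / m), f s = ∑ j ∈ Finset.range k, ∫⁻ s in cell m j, f s := by
  induction k with
  | zero => simp
  | succ k ih =>
    rw [Ico_zero_div_succ hm, lintegral_union (measurableSet_cell m k) (disjoint_Ico_cell m k), ih,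
      Finset.sum_range_succ]

theorem volUnit_eq_restrict_Ico {m : ℕ} (hm : 0 < m) :
    volUnit = volume.restrict (Ico (0 : ℝ) ((m : ℝ) / m)) := by
  rw [div_self (by exact_mod_cast hm.ne'), volUnit, Measure.restrict_congr_set Ico_ae_eq_Icc]

theorem volume_cell {m : ℕ} (j : ℕ) : volume (cell m j) = ENNReal.ofReal ((m : ℝ)⁻¹) := by
  rw [cell, Real.volume_Ico]
  congr 1
  push_cast
  ring

theorem cell_subset {m j : ℕ} (hm : 0 < m) (hj : j < m) : cell m j ⊆ Icc 0 1 := fun s hs => by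
  have hm' : (0 : ℝ) < m := by exact_mod_cast hm
  refine ⟨le_trans (by positivity) hs.1, hs.2.le.trans ?_⟩
  rw [div_le_one hm']
  exact_mod_cast hj

theorem div_mem_unit {m k : ℕ} (hk : k ≤ m) : (k : ℝ) / m ∈ Icc (0 : ℝ) 1 :=
  ⟨by positivity, div_le_one_of_le₀ (by exact_mod_cast hk) (by positivity)⟩

theorem measurable_stepCtl [MeasurableSpace F] (m : ℕ) (a : ℕ → F) : Measurable (stepCtl m a) :=
  (measurable_from_top (f := a)).comp (Nat.measurable_floor.comp (measurable_id.mul_const _))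

section Measurable

variable [NormedAddCommGroup F] [MeasurableSpace F] [BorelSpace F]

variable [SecondCountableTopology F]

theorem memLp_stepCtl (m : ℕ) (a : ℕ → F) : MemLp (stepCtl m a) 2 volUnit := by
  refine MemLp.of_bound (measurable_stepCtl m a).aestronglyMeasurable
    (∑ j ∈ Finset.range (m + 1), ‖a j‖) ?_
  filter_upwards [ae_restrict_mem measurableSet_Icc] with s hs
  refine Finset.single_le_sum (f := fun j => ‖a j‖) (fun _ _ => norm_nonneg _) ?_
  rw [Finset.mem_range, Nat.lt_succ_iff]
  refine Nat.floor_le_of_le ?_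
  nlinarith [hs.2, (Nat.cast_nonneg m : (0 : ℝ) ≤ m)]

end Measurable

theorem lintegral_comp_stepCtl {m : ℕ} (hm : 0 < m) (a : ℕ → F) (f : F → ℝ≥0∞) :
    ∫⁻ s, f (stepCtl m a s) ∂volUnit = ∑ j ∈ Finset.range m, ENNReal.ofReal ((m : ℝ)⁻¹) * f (a j) := by
  rw [volUnit_eq_restrict_Ico hm, lintegral_Ico_eq_sum_cell hm]
  refine Finset.sum_congr rfl fun j _ => ?_
  rw [setLIntegral_congr_fun (g := fun _ => f (a j)) (measurableSet_cell m j)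
    (fun s hs => by simp only [stepCtl_of_mem hm a hs])]
  rw [setLIntegral_const, volume_cell, mul_comm]

end Step

/-! ### Averages of a control over cells -/

section Average

variable {F : Type*} [NormedAddCommGroup F] [InnerProductSpace ℝ F]

/-- The average of `h` over the `j`-th cell. -/
def cellAvg (m : ℕ) (h : ℝ → F) (j : ℕ) : F := (m : ℝ) • ∫ s in cell m j, h s

theorem lintegral_cost_cellAvg_le [CompleteSpace F] (Λ : F → ℝ) {m : ℕ} (hm : 0 < m) {h : ℝ → F}
    (hh : IntegrableOn h (Icc 0 1)) :
    ∫⁻ s, cost Λ (stepCtl m (cellAvg m h) s) ∂volUnit ≤ ∫⁻ s, cost Λ (h s) ∂volUnit := by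
  have hm' : (0 : ℝ) < m := by exact_mod_cast hm
  rw [lintegral_comp_stepCtl hm, volUnit_eq_restrict_Ico hm, lintegral_Ico_eq_sum_cell hm]
  refine Finset.sum_le_sum fun j hj => ?_
  have hlt : (j : ℝ) / m < ((j + 1 : ℕ) : ℝ) / m := by gcongr; exact Nat.lt_succ_self j
  have e : ((j + 1 : ℕ) : ℝ) / m - (j : ℝ) / m = (m : ℝ)⁻¹ := by push_cast; ring
  have := cost_smul_integral_le Λ hlt (hh.mono_set (cell_subset hm (Finset.mem_range.mp hj)))
  rwa [e, inv_inv] at this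

theorem intervalIntegral_eq_cell {m : ℕ} (h : ℝ → F) (j : ℕ) :
    ∫ s in ((j : ℝ) / m)..(((j + 1 : ℕ) : ℝ) / m), h s = ∫ s in cell m j, h s := by
  rw [intervalIntegral.integral_of_le (by gcongr; exact Nat.le_succ j), cell,
    Measure.restrict_congr_set Ico_ae_eq_Ioc]

variable [FiniteDimensional ℝ F] [MeasurableSpace F] [BorelSpace F]

theorem integral_sq_cellAvg_le {m : ℕ} (hm : 0 < m) {h : ℝ → F}
    (hh : MemLp h 2 volUnit) :
    ∫ s, ‖stepCtl m (cellAvg m h) s‖ ^ 2 ∂volUnit ≤ ∫ s, ‖h s‖ ^ 2 ∂volUnit := by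
  have h1 := lintegral_cost_cellAvg_le (fun v => ‖v‖ ^ 2 / 4) hm hh.integrableOn_unit
  simp only [cost_norm_sq] at h1
  have i1 := (memLp_two_iff_integrable_sq_norm (memLp_stepCtl m (cellAvg m h)).1).mp
    (memLp_stepCtl m (cellAvg m h))
  have i2 := (memLp_two_iff_integrable_sq_norm hh.1).mp hh
  rw [← ofReal_integral_eq_lintegral_ofReal i1 (Eventually.of_forall fun s => by positivity),
    ← ofReal_integral_eq_lintegral_ofReal i2 (Eventually.of_forall fun s => by positivity)] at h1
  exact (ENNReal.ofReal_le_ofReal_iff (integral_nonneg fun s => by positivity)).mp h1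

theorem integral_cell_stepCtl {m : ℕ} (hm : 0 < m) (a : ℕ → F) (j : ℕ) :
    ∫ s in cell m j, stepCtl m a s = (m : ℝ)⁻¹ • a j := by
  rw [setIntegral_congr_fun (g := fun _ => a j) (measurableSet_cell m j)
    (fun s hs => stepCtl_of_mem hm a hs), setIntegral_const, measureReal_def, volume_cell,
    ENNReal.toReal_ofReal (by positivity)]

theorem integral_stepCtl_cellAvg {m : ℕ} (hm : 0 < m) {h : ℝ → F} (hh : IntegrableOn h (Icc 0 1))
    {k : ℕ} (hk : k ≤ m) :
    ∫ s in (0 : ℝ)..((k : ℝ) / m), stepCtl m (cellAvg m h) s = ∫ s in (0 : ℝ)..((k : ℝ) / m), h s := by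
  induction k with
  | zero => simp
  | succ k ih =>
    have hm' : (m : ℝ) ≠ 0 := by exact_mod_cast hm.ne'
    have key : ∀ {f : ℝ → F}, IntegrableOn f (Icc 0 1) → (∫ s in (0 : ℝ)..(((k + 1 : ℕ) : ℝ) / m), f s) =
        (∫ s in (0 : ℝ)..((k : ℝ) / m), f s) + ∫ s in cell m k, f s := by
      intro f hf
      rw [← intervalIntegral_eq_cell, intervalIntegral.integral_add_adjacent_intervals
        (intervalIntegrable_of_integrableOn_unit hf (by simp) (div_mem_unit (by omega)))
        (intervalIntegrable_of_integrableOn_unit hf (div_mem_unit (by omega)) (div_mem_unit hk))]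
    rw [key hh, key (memLp_stepCtl m _).integrableOn_unit, ih (by omega), integral_cell_stepCtl hm,
      cellAvg, smul_smul, inv_mul_cancel₀ hm', one_smul]

/-- The two primitives agree at every grid point. From the last grid point before $t$ there remains
an interval of length at most $1/(m+1)$, on which both integrals are small by Cauchy–Schwarz. -/
theorem tendsto_integral_stepCtl_cellAvg {h : ℝ → F} (hh : MemLp h 2 volUnit) {t : ℝ}
    (ht : t ∈ Icc (0 : ℝ) 1) :
    Tendsto (fun m : ℕ => ∫ s in (0 : ℝ)..t, stepCtl (m + 1) (cellAvg (m + 1) h) s) atTop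
      (𝓝 (∫ s in (0 : ℝ)..t, h s)) := by
  set C := ∫ s, ‖h s‖ ^ 2 ∂volUnit with hC
  rw [tendsto_iff_norm_sub_tendsto_zero]
  have hlim : Tendsto (fun m : ℕ => 2 * (√(1 / ((m : ℝ) + 1)) * √C)) atTop (𝓝 0) := by
    have := ((Real.continuous_sqrt.tendsto 0).comp
      (tendsto_one_div_add_atTop_nhds_zero_nat (𝕜 := ℝ))).mul_const √C |>.const_mul 2
    simpa using this
  refine squeeze_zero (fun _ => norm_nonneg _) (fun m => ?_) hlim
  have hm' : (0 : ℝ) < ((m + 1 : ℕ) : ℝ) := by positivity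
  set k := ⌊t * (m + 1 : ℕ)⌋₊ with hk
  have hk1 : (k : ℝ) ≤ t * (m + 1 : ℕ) := Nat.floor_le (by have := ht.1; positivity)
  have hk2 : t * (m + 1 : ℕ) < k + 1 := Nat.lt_floor_add_one _
  have hkm : k ≤ m + 1 := by
    have : (k : ℝ) ≤ (m + 1 : ℕ) := hk1.trans (by nlinarith [ht.2])
    exact_mod_cast this
  have hkt : (k : ℝ) / (m + 1 : ℕ) ≤ t := by rwa [div_le_iff₀ hm']
  have htk : t - (k : ℝ) / (m + 1 : ℕ) ≤ 1 / ((m : ℝ) + 1) := by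
    have e : t - (k : ℝ) / (m + 1 : ℕ) = (t * (m + 1 : ℕ) - k) / (m + 1 : ℕ) := by field_simp
    rw [e, Nat.cast_succ]
    gcongr
    rw [Nat.cast_succ] at hk2
    linarith
  have hk0 := div_mem_unit hkm
  have hs := memLp_stepCtl (m + 1) (cellAvg (m + 1) h)
  have split : ∀ {f : ℝ → F}, IntegrableOn f (Icc 0 1) → (∫ s in (0 : ℝ)..t, f s) =
        (∫ s in (0 : ℝ)..((k : ℝ) / (m + 1 : ℕ)), f s) + ∫ s in ((k : ℝ) / (m + 1 : ℕ))..t, f s :=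
    fun hf => (intervalIntegral.integral_add_adjacent_intervals
        (intervalIntegrable_of_integrableOn_unit hf (by simp) hk0)
        (intervalIntegrable_of_integrableOn_unit hf hk0 ht)).symm
  rw [split hh.integrableOn_unit, split hs.integrableOn_unit,
    integral_stepCtl_cellAvg m.succ_pos hh.integrableOn_unit hkm, add_sub_add_left_eq_sub]
  have bound : ∀ {f : ℝ → F}, MemLp f 2 volUnit → ∫ s, ‖f s‖ ^ 2 ∂volUnit ≤ C →
      ‖∫ s in ((k : ℝ) / (m + 1 : ℕ))..t, f s‖ ≤ √(1 / ((m : ℝ) + 1)) * √C := fun hf hfC =>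
    (intervalIntegral.norm_integral_le_integral_norm hkt).trans
      ((intervalIntegral_norm_le hf hfC hk0.1 hkt ht.2).trans (by gcongr))
  refine (norm_sub_le _ _).trans ?_
  have b1 := bound hs (integral_sq_cellAvg_le m.succ_pos hh)
  have b2 := bound hh le_rfl
  linarith

end Average

/-! ### The flow of a step control is a product of exponentials -/

section StepFlow

variable {F A : Type*} [NormedAddCommGroup F] [InnerProductSpace ℝ F] [FiniteDimensional ℝ F]
  [MeasurableSpace F] [BorelSpace F] [NormedRing A] [NormedAlgebra ℝ A] [CompleteSpace A]
  {σ : F →L[ℝ] A} {N : ℕ}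

theorem hasDerivAt_exp_sub_smul (x : A) (a s : ℝ) :
    HasDerivAt (fun s : ℝ => NormedSpace.exp ((s - a) • x)) (NormedSpace.exp ((s - a) • x) * x) s := by
  have := (hasDerivAt_exp_smul_const (𝕂 := ℝ) x (s - a)).comp_sub_const s a
  exact this

/-- On a cell the equation has a constant coefficient; the explicit exponential solves it, and
uniqueness identifies the two. -/
theorem flow_stepCtl_cell (hσ : ∀ v : Fin N → F, (List.ofFn fun i => σ (v i)).prod = 0) {m : ℕ} (hm : 0 < m)
    (a : ℕ → F) {k : ℕ} (hk : k < m) {t : ℝ} (ht : t ∈ Icc ((k : ℝ) / m) (((k + 1 : ℕ) : ℝ) / m)) :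
    flow N σ (stepCtl m a) t = flow N σ (stepCtl m a) ((k : ℝ) / m) *
      NormedSpace.exp ((t - (k : ℝ) / m) • σ (a k)) := by
  have hi := (memLp_stepCtl m a).integrableOn_unit
  have hk0 := div_mem_unit (m := m) (k := k) (by omega)
  have hk1 := div_mem_unit (m := m) (k := k + 1) hk
  set g0 := flow N σ (stepCtl m a) ((k : ℝ) / m) with hg0
  have hexp : ∀ t : ℝ, HasDerivAt (fun s : ℝ => g0 * NormedSpace.exp ((s - (k : ℝ) / m) • σ (a k)))
      (g0 * NormedSpace.exp ((t - (k : ℝ) / m) • σ (a k)) * σ (a k)) t := fun t => by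
    rw [mul_assoc]
    exact (hasDerivAt_exp_sub_smul _ _ _).const_mul g0
  have hcexp : Continuous fun s : ℝ => g0 * NormedSpace.exp ((s - (k : ℝ) / m) • σ (a k)) :=
    continuous_iff_continuousAt.mpr fun t => (hexp t).continuousAt
  have hsub : Icc ((k : ℝ) / m) (((k + 1 : ℕ) : ℝ) / m) ⊆ Icc 0 1 := Icc_subset_Icc hk0.1 hk1.2
  have hz := eq_zero_of_integral_eq hσ hi hk0.1 hk1.2
    (D := fun t => flow N σ (stepCtl m a) t - g0 * NormedSpace.exp ((t - (k : ℝ) / m) • σ (a k)))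
    (((continuousOn_flow hi).mono hsub).sub hcexp.continuousOn) (fun t ht => by
      have htu := hsub ht
      have hfi : ∀ {x y : ℝ}, x ∈ Icc (0 : ℝ) 1 → y ∈ Icc (0 : ℝ) 1 →
          IntervalIntegrable (fun s => flow N σ (stepCtl m a) s * σ (stepCtl m a s)) volume x y :=
        fun hx hy => intervalIntegrable_of_integrableOn_unit
          (integrableOn_mul_control σ hi (continuousOn_flow hi)) hx hy
      have hei := intervalIntegrable_of_integrableOn_unit
        (integrableOn_mul_control σ hi hcexp.continuousOn) hk0 htu
      simp only [sub_mul]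
      rw [intervalIntegral.integral_sub (hfi hk0 htu) hei]
      have e1 : flow N σ (stepCtl m a) t = g0 +
          ∫ s in ((k : ℝ) / m)..t, flow N σ (stepCtl m a) s * σ (stepCtl m a s) := by
        rw [hg0, flow_eq hσ hi htu, flow_eq hσ hi hk0, add_assoc,
          intervalIntegral.integral_add_adjacent_intervals (hfi (by simp) hk0) (hfi hk0 htu)]
      have e2 : ∫ s in ((k : ℝ) / m)..t, g0 * NormedSpace.exp ((s - (k : ℝ) / m) • σ (a k)) *
          σ (stepCtl m a s) = g0 * NormedSpace.exp ((t - (k : ℝ) / m) • σ (a k)) - g0 := by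
        have e3 : ∫ s in ((k : ℝ) / m)..t, g0 * NormedSpace.exp ((s - (k : ℝ) / m) • σ (a k)) *
            σ (stepCtl m a s) = ∫ s in ((k : ℝ) / m)..t, g0 *
            NormedSpace.exp ((s - (k : ℝ) / m) • σ (a k)) * σ (a k) := by
          refine intervalIntegral.integral_congr_ae ?_
          -- At the right end of the cell the step control already takes the next value.
          have hne : ∀ᵐ s : ℝ, s ≠ ((k + 1 : ℕ) : ℝ) / m := by simp [ae_iff, measure_singleton]
          filter_upwards [hne] with s hs hst
          rw [uIoc_of_le ht.1] at hst
          rw [stepCtl_of_mem hm a ⟨hst.1.le, lt_of_le_of_ne (hst.2.trans ht.2) hs⟩]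
        rw [e3, intervalIntegral.integral_eq_sub_of_hasDerivAt (fun s _ => hexp s)
          ((hcexp.mul continuous_const).intervalIntegrable _ _)]
        simp
      rw [e1, e2]
      abel) ht
  exact sub_eq_zero.mp hz

theorem flow_stepCtl (hσ : ∀ v : Fin N → F, (List.ofFn fun i => σ (v i)).prod = 0) {m : ℕ} (hm : 0 < m)
    (a : ℕ → F) {k : ℕ} (hk : k ≤ m) :
    flow N σ (stepCtl m a) ((k : ℝ) / m) = expProd (fun j => σ ((m : ℝ)⁻¹ • a j)) k := by
  induction k with
  | zero => rw [flow_eq hσ (memLp_stepCtl m a).integrableOn_unit (by simp)]; simp [expProd]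
  | succ k ih =>
    have hle : (k : ℝ) / m ≤ ((k + 1 : ℕ) : ℝ) / m := by gcongr; exact Nat.le_succ k
    rw [flow_stepCtl_cell hσ hm a hk ⟨hle, le_rfl⟩, ih (by omega), expProd]
    congr 2
    rw [map_smul]
    congr 1
    push_cast
    ring

end StepFlow

/-! ### The rate function in the algebra -/

section CtlRate

variable {F A : Type*} [NormedAddCommGroup F] [InnerProductSpace ℝ F] [FiniteDimensional ℝ F]
  [MeasurableSpace F] [BorelSpace F] [NormedRing A] [NormedAlgebra ℝ A]

/-- The least cost of a control which steers the flow to `M` at time `1`. -/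
def ctlRate (Λ : F → ℝ) (N : ℕ) (σ : F →L[ℝ] A) (M : A) : ℝ≥0∞ :=
  ⨅ (h : ℝ → F) (_ : MemLp h 2 volUnit ∧ flow N σ h 1 = M), ∫⁻ s, cost Λ (h s) ∂volUnit

theorem ctlRate_le {Λ : F → ℝ} {N : ℕ} {σ : F →L[ℝ] A} {h : ℝ → F} (hh : MemLp h 2 volUnit) :
    ctlRate Λ N σ (flow N σ h 1) ≤ ∫⁻ s, cost Λ (h s) ∂volUnit :=
  iInf₂_le h ⟨hh, rfl⟩

theorem exists_of_ctlRate_lt {Λ : F → ℝ} {N : ℕ} {σ : F →L[ℝ] A} {M : A} {b : ℝ≥0∞}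
    (hM : ctlRate Λ N σ M < b) : ∃ h : ℝ → F, MemLp h 2 volUnit ∧ flow N σ h 1 = M ∧
      ∫⁻ s, cost Λ (h s) ∂volUnit < b := by
  simp only [ctlRate, iInf_lt_iff] at hM
  obtain ⟨h, ⟨h1, h2⟩, h3⟩ := hM
  exact ⟨h, h1, h2, h3⟩

variable [NormOneClass A] [CompleteSpace A] {Λ : F → ℝ} {N : ℕ} {σ : F →L[ℝ] A} {κ : ℝ}

theorem exists_tendsto_flow (hΛ : Continuous Λ) (hΛ0 : Λ 0 = 0) (hκ : 0 < κ) (hle : ∀ v, Λ v ≤ κ * ‖v‖ ^ 2)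
    {h : ℕ → ℝ → F} (hh : ∀ n, MemLp (h n) 2 volUnit) {a : ℝ} (ha : 0 ≤ a)
    (hcost : ∀ n, ∫⁻ s, cost Λ (h n s) ∂volUnit ≤ ENNReal.ofReal a) :
    ∃ h' : ℝ → F, MemLp h' 2 volUnit ∧ ∫⁻ s, cost Λ (h' s) ∂volUnit ≤ ENNReal.ofReal a ∧
      ∃ φ : ℕ → ℕ, StrictMono φ ∧ Tendsto (fun n => flow N σ (h (φ n)) 1) atTop (𝓝 (flow N σ h' 1)) := by
  have hC := fun n => (memLp_of_lintegral_cost hκ hle (hh n).1 ha (hcost n)).2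
  obtain ⟨h', hh', φ, hφ, hlim⟩ := exists_weak_limit hh hC
  refine ⟨h', hh', lintegral_cost_le_of_weak hΛ hΛ0 (fun n => hh (φ n)) hh' hlim ha fun n => hcost _,
    φ, hφ, ?_⟩
  exact tendsto_flow (fun n => hh (φ n)) hh' (fun n => hC (φ n))
    (fun t ht => tendsto_primitive_of_weak (fun n => hh (φ n)) hh' hlim ht) N (by simp)

theorem exists_tendsto_of_ctlRate_lt (hΛ : Continuous Λ) (hΛ0 : Λ 0 = 0) (hκ : 0 < κ)
    (hle : ∀ v, Λ v ≤ κ * ‖v‖ ^ 2) {M : ℕ → A} {a : ℝ} (ha : 0 ≤ a)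
    (hM : ∀ n, ctlRate Λ N σ (M n) < ENNReal.ofReal a) :
    ∃ M' : A, ctlRate Λ N σ M' ≤ ENNReal.ofReal a ∧ ∃ φ : ℕ → ℕ, StrictMono φ ∧
      Tendsto (fun n => M (φ n)) atTop (𝓝 M') := by
  choose h h1 h2 h3 using fun n => exists_of_ctlRate_lt (hM n)
  obtain ⟨h', hh', hc, φ, hφ, hlim⟩ := exists_tendsto_flow (N := N) (σ := σ) hΛ hΛ0 hκ hle h1 ha
    fun n => (h3 n).le
  exact ⟨_, (ctlRate_le hh').trans hc, φ, hφ, by simpa only [h2] using hlim⟩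

theorem lowerSemicontinuous_ctlRate (hΛ : Continuous Λ) (hΛ0 : Λ 0 = 0) (hκ : 0 < κ)
    (hle : ∀ v, Λ v ≤ κ * ‖v‖ ^ 2) : LowerSemicontinuous (ctlRate Λ N σ) := by
  intro M y hy
  by_contra hcon
  obtain ⟨u, hu, hu'⟩ := exists_seq_forall_of_frequently (not_eventually.mp hcon)
  obtain ⟨c, hyc, hcM⟩ := exists_between hy
  have hctop : c ≠ ∞ := ne_top_of_lt hcM
  obtain ⟨M', hM', φ, hφ, hlim⟩ := exists_tendsto_of_ctlRate_lt (N := N) (σ := σ) (M := u) hΛ hΛ0 hκ hle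
    (a := c.toReal) ENNReal.toReal_nonneg
    fun n => by rw [ENNReal.ofReal_toReal hctop]; exact (not_lt.mp (hu' n)).trans_lt hyc
  rw [tendsto_nhds_unique hlim (hu.comp hφ.tendsto_atTop), ENNReal.ofReal_toReal hctop] at hM'
  exact absurd hcM hM'.not_gt

/-- Otherwise points ever closer to $C$ with rate below $a$ would, by compactness of controls of
bounded cost, accumulate at a point of $C$ of rate at most $a$. The room $\delta$ is needed because
the block products are only close to the walk. -/
theorem exists_thickening_le_ctlRate (hΛ : Continuous Λ) (hΛ0 : Λ 0 = 0) (hκ : 0 < κ)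
    (hle : ∀ v, Λ v ≤ κ * ‖v‖ ^ 2) {C : Set A} (hC : IsClosed C) {a : ℝ} (ha : 0 ≤ a)
    (hCa : ∀ M ∈ C, ENNReal.ofReal a < ctlRate Λ N σ M) :
    ∃ δ > 0, ∀ M, ∀ M' ∈ C, dist M M' ≤ δ → ENNReal.ofReal a ≤ ctlRate Λ N σ M := by
  by_contra! hcon
  choose M M' hM' hd hlt using fun n : ℕ => hcon (1 / ((n : ℝ) + 1)) (by positivity)
  obtain ⟨L, hL, φ, hφ, hlim⟩ := exists_tendsto_of_ctlRate_lt (N := N) (σ := σ) hΛ hΛ0 hκ hle ha hlt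
  have hd0 : Tendsto (fun n => dist (M (φ n)) (M' (φ n))) atTop (𝓝 0) :=
    squeeze_zero (fun _ => dist_nonneg) (fun n => hd (φ n))
      ((tendsto_one_div_add_atTop_nhds_zero_nat (𝕜 := ℝ)).comp hφ.tendsto_atTop)
  have hlim' : Tendsto (fun n => M' (φ n)) atTop (𝓝 L) := (tendsto_iff_of_dist hd0).mp hlim
  exact absurd (hCa L (hC.mem_of_tendsto hlim' (Eventually.of_forall fun n => hM' _))) hL.not_gt

theorem flow_stepCtl_one (hσ : ∀ v : Fin N → F, (List.ofFn fun i => σ (v i)).prod = 0) {m : ℕ} (hm : 0 < m)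
    (a : ℕ → F) : flow N σ (stepCtl m a) 1 = expProd (fun j => σ ((m : ℝ)⁻¹ • a j)) m := by
  have hm' : (m : ℝ) ≠ 0 := by exact_mod_cast hm.ne'
  have := flow_stepCtl hσ hm a le_rfl
  rwa [div_self hm'] at this

theorem ctlRate_expProd_le (hσ : ∀ v : Fin N → F, (List.ofFn fun i => σ (v i)).prod = 0) {m : ℕ} (hm : 0 < m)
    (a : ℕ → F) : ctlRate Λ N σ (expProd (fun j => σ ((m : ℝ)⁻¹ • a j)) m) ≤
      ∑ j ∈ Finset.range m, ENNReal.ofReal ((m : ℝ)⁻¹) * cost Λ (a j) := by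
  rw [← flow_stepCtl_one hσ hm, ← lintegral_comp_stepCtl hm]
  exact ctlRate_le (memLp_stepCtl m a)

theorem tendsto_flow_stepCtl_cellAvg {h : ℝ → F} (hh : MemLp h 2 volUnit) {t : ℝ} (ht : t ∈ Icc (0 : ℝ) 1) :
    Tendsto (fun m => flow N σ (stepCtl (m + 1) (cellAvg (m + 1) h)) t) atTop (𝓝 (flow N σ h t)) :=
  tendsto_flow (fun _ => memLp_stepCtl _ _) hh (fun m => integral_sq_cellAvg_le m.succ_pos hh)
    (fun _ ht => tendsto_integral_stepCtl_cellAvg hh ht) N ht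

/-- A nearly optimal control is replaced by its cell averages: the cost does not increase and the
endpoint of the flow converges. -/
theorem eventually_exists_expProd_mem (hσ : ∀ v : Fin N → F, (List.ofFn fun i => σ (v i)).prod = 0)
    {O : Set A} (hO : IsOpen O) {M : A} (hMO : M ∈ O) {b : ℝ≥0∞} (hb : ctlRate Λ N σ M < b) :
    ∀ᶠ m : ℕ in atTop, ∃ a : ℕ → F, expProd (fun j => σ (((m + 1 : ℕ) : ℝ)⁻¹ • a j)) (m + 1) ∈ O ∧
      ∑ j ∈ Finset.range (m + 1), ENNReal.ofReal (((m + 1 : ℕ) : ℝ)⁻¹) * cost Λ (a j) < b := by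
  obtain ⟨h, hh, rfl, hlt⟩ := exists_of_ctlRate_lt hb
  filter_upwards [(tendsto_flow_stepCtl_cellAvg hh (by simp)).eventually (hO.mem_nhds hMO)] with m hm
  refine ⟨cellAvg (m + 1) h, ?_, ?_⟩
  · rwa [← flow_stepCtl_one hσ m.succ_pos]
  · rw [← lintegral_comp_stepCtl m.succ_pos]
    exact (lintegral_cost_cellAvg_le Λ m.succ_pos hh.integrableOn_unit).trans_lt hlt

end CtlRate

/-! ### Absolutely continuous functions with values in a normed space -/

section AC

variable {X Y : Type*} [PseudoMetricSpace X] [PseudoMetricSpace Y]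

theorem AbsolutelyContinuousOnInterval.of_dist_le {f : ℝ → X} {g : ℝ → Y} {a b K : ℝ}
    (hg : AbsolutelyContinuousOnInterval g a b)
    (hfg : ∀ x ∈ uIcc a b, ∀ y ∈ uIcc a b, dist (f x) (f y) ≤ K * dist (g x) (g y)) :
    AbsolutelyContinuousOnInterval f a b := by
  rw [absolutelyContinuousOnInterval_iff] at hg ⊢
  intro ε hε
  obtain ⟨δ, hδ, H⟩ := hg (ε / (|K| + 1)) (by positivity)
  refine ⟨δ, hδ, fun I hI hlen => ?_⟩
  have h1 := H I hI hlen
  have hmem : ∀ i ∈ Finset.range I.1, (I.2 i).1 ∈ uIcc a b ∧ (I.2 i).2 ∈ uIcc a b := hI.1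
  calc ∑ i ∈ Finset.range I.1, dist (f (I.2 i).1) (f (I.2 i).2)
      ≤ ∑ i ∈ Finset.range I.1, (|K| + 1) * dist (g (I.2 i).1) (g (I.2 i).2) := by
        refine Finset.sum_le_sum fun i hi => (hfg _ (hmem i hi).1 _ (hmem i hi).2).trans ?_
        gcongr
        linarith [le_abs_self K]
    _ = (|K| + 1) * ∑ i ∈ Finset.range I.1, dist (g (I.2 i).1) (g (I.2 i).2) := by rw [Finset.mul_sum]
    _ < (|K| + 1) * (ε / (|K| + 1)) := by gcongr
    _ = ε := by field_simp

variable {V W : Type*} [NormedAddCommGroup V] [NormedSpace ℝ V] [NormedAddCommGroup W] [NormedSpace ℝ W]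

theorem AbsolutelyContinuousOnInterval.contDiff_comp [ProperSpace V] {f : ℝ → V} {g : V → W} {a b : ℝ}
    (hf : AbsolutelyContinuousOnInterval f a b) (hg : ContDiff ℝ 1 g) :
    AbsolutelyContinuousOnInterval (fun t => g (f t)) a b := by
  obtain ⟨C, hC⟩ := hf.exists_bound
  obtain ⟨K, hK⟩ := hg.contDiffOn.exists_lipschitzOnWith (by decide) (convex_closedBall (0 : V) C)
    (isCompact_closedBall 0 C)
  exact hf.of_dist_le fun x hx y hy => hK.dist_le_mul _ (by simpa using hC x hx) _ (by simpa using hC y hy)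

theorem absolutelyContinuousOnInterval_integral {f : ℝ → V} {a b : ℝ}
    (hf : IntervalIntegrable f volume a b) :
    AbsolutelyContinuousOnInterval (fun t => ∫ s in a..t, f s) a b := by
  have hsub : ∀ {x y : ℝ}, x ∈ uIcc a b → y ∈ uIcc a b → IntervalIntegrable f volume x y := fun hx hy =>
    hf.mono_set (uIcc_subset_uIcc hx hy)
  refine (hf.norm.absolutelyContinuousOnInterval_intervalIntegral left_mem_uIcc).of_dist_le (K := 1)
    fun x hx y hy => ?_
  have e1 := intervalIntegral.integral_interval_sub_left (hsub left_mem_uIcc hx) (hsub left_mem_uIcc hy)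
  have e2 := intervalIntegral.integral_interval_sub_left (hsub left_mem_uIcc hx).norm
    (hsub left_mem_uIcc hy).norm
  rw [dist_eq_norm, dist_eq_norm, e1, e2, one_mul]
  exact intervalIntegral.norm_integral_le_abs_integral_norm

theorem AbsolutelyContinuousOnInterval.ae_differentiableAt_of_finiteDimensional {V : Type*}
    [NormedAddCommGroup V] [InnerProductSpace ℝ V]
    [FiniteDimensional ℝ V] {f : ℝ → V} {a b : ℝ} (hf : AbsolutelyContinuousOnInterval f a b) :
    ∀ᵐ x, x ∈ uIcc a b → DifferentiableAt ℝ f x := by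
  set e := stdOrthonormalBasis ℝ V
  have h : ∀ i, ∀ᵐ x, x ∈ uIcc a b → DifferentiableAt ℝ (fun t => ⟪e i, f t⟫) x := fun i => by
    refine AbsolutelyContinuousOnInterval.ae_differentiableAt (hf.of_dist_le (K := ‖e i‖) fun x _ y _ => ?_)
    rw [Real.dist_eq, ← inner_sub_right, dist_eq_norm]
    exact abs_real_inner_le_norm _ _
  filter_upwards [ae_all_iff.mpr h] with x hx hxm
  have e1 : f = fun t => ∑ i, ⟪e i, f t⟫ • e i := funext fun t => (e.sum_repr' (f t)).symm
  rw [e1]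
  exact DifferentiableAt.fun_sum fun i _ => (hx i hxm).smul_const _

end AC

/-! ### Horizontal paths and controls -/

namespace StratifiedLieAlgebra

variable {E : Type*} [NormedAddCommGroup E] [InnerProductSpace ℝ E] {r : ℕ}
  {S : StratifiedLieAlgebra E r} {A : Type*} [NormedRing A] [NormedAlgebra ℝ A] {N : ℕ}

namespace NilRep

/-- The restriction of the representation to the horizontal layer. -/
def sigma (R : S.NilRep A N) : S.H →L[ℝ] A := R.rho.comp S.H.subtypeL

theorem sigma_apply (R : S.NilRep A N) (x : S.H) : R.sigma x = R.rho x := rfl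

theorem sigma_prod_eq_zero (R : S.NilRep A N) (v : Fin N → S.H) :
    (List.ofFn fun i => R.sigma (v i)).prod = 0 := R.prod_eq_zero fun i => v i

variable [FiniteDimensional ℝ E] [MeasurableSpace E] [BorelSpace E] [CompleteSpace A] (R : S.NilRep A N)

theorem flow_stepCtl_mem_range (hN : r ≤ N) {m : ℕ} (hm : 0 < m) (a : ℕ → S.H) {t : ℝ}
    (ht : t ∈ Icc (0 : ℝ) 1) : flow N R.sigma (stepCtl m a) t ∈ range R.emb := by
  have hm' : (m : ℝ) ≠ 0 := by exact_mod_cast hm.ne'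
  have key : ∀ k ≤ m, ∀ t ∈ Icc (0 : ℝ) ((k : ℝ) / m), flow N R.sigma (stepCtl m a) t ∈ range R.emb := by
    intro k
    induction k with
    | zero =>
      intro _ t ht
      have : t = 0 := by simpa using ht
      rw [this, flow_eq R.sigma_prod_eq_zero (memLp_stepCtl m a).integrableOn_unit (by simp)]
      exact ⟨0, by simp [R.emb_zero]⟩
    | succ k ih =>
      intro hk t ht
      rcases le_total t ((k : ℝ) / m) with h | h
      · exact ih (by omega) t ⟨ht.1, h⟩
      · obtain ⟨x, hx⟩ := ih (by omega) ((k : ℝ) / m) ⟨by positivity, le_rfl⟩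
        rw [flow_stepCtl_cell R.sigma_prod_eq_zero hm a hk ⟨h, ht.2⟩, ← hx]
        refine ⟨S.mul x ((t - (k : ℝ) / m) • (a k : E)), ?_⟩
        rw [R.emb_mul hN]
        simp only [emb, map_smul, sigma_apply]
  exact key m le_rfl t (by rwa [div_self hm'])

variable [FiniteDimensional ℝ A]

/-- The flow stays in the image of the group. For step controls it is a product of exponentials of
horizontal vectors; being fixed by `emb` after `theta` is a closed condition, and averages of $h$
approximate its flow. -/
theorem emb_theta_flow [NormOneClass A] (hN : r ≤ N) {h : ℝ → S.H} (hh : MemLp h 2 volUnit) {t : ℝ}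
    (ht : t ∈ Icc (0 : ℝ) 1) : R.emb (R.theta (flow N R.sigma h t)) = flow N R.sigma h t := by
  have hcl : IsClosed {M : A | R.emb (R.theta M) = M} :=
    isClosed_eq (R.contDiff_emb.continuous.comp R.contDiff_theta.continuous) continuous_id
  refine hcl.mem_of_tendsto (tendsto_flow_stepCtl_cellAvg hh ht) (Eventually.of_forall fun m => ?_)
  obtain ⟨x, hx⟩ := R.flow_stepCtl_mem_range hN m.succ_pos (cellAvg (m + 1) h) ht
  rw [mem_ofPred_eq, ← hx, R.theta_emb]

theorem eq_of_emb_mul_rho {x y z : E} (h : R.emb x * R.rho y = R.emb x * R.rho z) : y = z := by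
  have := congrArg (R.emb (-x) * ·) h
  simp only [← mul_assoc, emb_neg_mul_emb, one_mul] at this
  exact R.injective this

theorem _root_.uIcc_zero_one : uIcc (0 : ℝ) 1 = Icc 0 1 := uIcc_of_le zero_le_one

theorem component_one_of_eq {x : E} {y : S.H} (h : x = y) : S.component 1 x = y := by
  apply Subtype.ext
  rw [S.coe_component, h, S.compL_of_mem y.2, if_pos rfl]

/-- A control is turned into the path `theta` of its flow; the flow equation says that the
Maurer–Cartan form of this path is the control. -/
theorem rate_le_ctlRate [NormOneClass A] (hN : r ≤ N) (Λ : S.H → ℝ) (g : E) :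
    S.rate (legendre Λ) g ≤ ctlRate Λ N R.sigma (R.emb g) := by
  refine le_iInf₂ fun h ⟨hh, hflow⟩ => ?_
  have hi := hh.integrableOn_unit
  set G := flow N R.sigma h with hG
  set γ : ℝ → E := fun t => R.theta (G t) with hγ
  have hIG := integrableOn_mul_control R.sigma hi (continuousOn_flow (N := N) (σ := R.sigma) hi)
  have hII : IntervalIntegrable (fun s => G s * R.sigma (h s)) volume 0 1 :=
    intervalIntegrable_of_integrableOn_unit hIG (by simp) (by simp)
  have hGeq : ∀ t ∈ Icc (0 : ℝ) 1, G t = 1 + ∫ s in (0 : ℝ)..t, G s * R.sigma (h s) :=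
    fun t ht => flow_eq R.sigma_prod_eq_zero hi ht
  have hGAC : AbsolutelyContinuousOnInterval G 0 1 := by
    refine (absolutelyContinuousOnInterval_integral hII).of_dist_le (K := 1) fun x hx y hy => ?_
    rw [uIcc_zero_one] at hx hy
    rw [hGeq x hx, hGeq y hy, one_mul, dist_add_left]
  have : ProperSpace A := FiniteDimensional.proper ℝ A
  have hγAC : AbsolutelyContinuousOnInterval γ 0 1 := hGAC.contDiff_comp R.contDiff_theta
  have hmc : ∀ᵐ t ∂(volume.restrict (Icc (0 : ℝ) 1)), S.maurerCartan γ t = h t := by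
    rw [ae_restrict_iff' measurableSet_Icc]
    -- The flow equation holds only on $[0,1]$, so the endpoints are discarded to have two-sided
    -- derivatives.
    have hne0 : ∀ᵐ s : ℝ, s ≠ 0 := by simp [ae_iff, measure_singleton]
    have hne1 : ∀ᵐ s : ℝ, s ≠ 1 := by simp [ae_iff, measure_singleton]
    filter_upwards [hII.ae_hasDerivAt_integral, hne0, hne1] with t ht h0 h1 htm
    have hnhds : Icc (0 : ℝ) 1 ∈ 𝓝 t := Icc_mem_nhds (lt_of_le_of_ne htm.1 h0.symm) (lt_of_le_of_ne htm.2 h1)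
    have hd := (ht (by rwa [uIcc_zero_one]) 0 left_mem_uIcc).const_add (1 : A)
    have hd' : HasDerivAt G (G t * R.sigma (h t)) t :=
      hd.congr_of_eventuallyEq (by filter_upwards [hnhds] with s hs using hGeq s hs)
    have hγd : DifferentiableAt ℝ γ t :=
      ((R.contDiff_theta.differentiable one_ne_zero) (G t)).comp t hd'.differentiableAt
    have hd2 : HasDerivAt G (R.emb (γ t) * R.rho (S.maurerCartan γ t)) t :=
      (R.hasDerivAt_emb hN hγd).congr_of_eventuallyEq (by
        filter_upwards [hnhds] with s hs using (R.emb_theta_flow hN hh hs).symm)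
    have heq := hd2.unique hd'
    refine R.eq_of_emb_mul_rho (x := γ t) (heq.trans ?_)
    rw [hγ, sigma_apply]
    exact congrArg (· * _) (R.emb_theta_flow hN hh htm).symm
  have hγ0 : γ 0 = 0 := by
    have : G 0 = R.emb 0 := by
      rw [hGeq 0 (by simp), intervalIntegral.integral_same, add_zero, R.emb_zero]
    exact (congrArg R.theta this).trans (R.theta_emb 0)
  have hγ1 : γ 1 = g := (congrArg R.theta hflow).trans (R.theta_emb g)
  refine (iInf₂_le γ ⟨⟨hγAC, ?_⟩, hγ0, hγ1⟩).trans ?_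
  · refine le_of_eq (lintegral_congr_ae (hmc.mono fun t ht => ?_))
    simp only
    rw [toENNReal_legendre, component_one_of_eq ht]
  · filter_upwards [hmc] with t ht
    rw [ht]
    exact (h t).2

/-- The horizontal component of $\gamma'$ serves as control: it is measurable and agrees almost
everywhere with the Maurer–Cartan form. When its cost is finite, the quadratic bound on $\Lambda$
makes it square integrable. -/
theorem ctlRate_le_rate [NormOneClass A] (hN : r ≤ N) {Λ : S.H → ℝ} {κ : ℝ} (hκ : 0 < κ)
    (hle : ∀ v, Λ v ≤ κ * ‖v‖ ^ 2) (g : E) :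
    ctlRate Λ N R.sigma (R.emb g) ≤ S.rate (legendre Λ) g := by
  refine le_iInf₂ fun γ ⟨⟨hAC, hhor⟩, h0, h1⟩ => ?_
  have hdiff : ∀ᵐ t ∂volUnit, DifferentiableAt ℝ γ t := by
    rw [ae_restrict_iff' measurableSet_Icc]
    filter_upwards [hAC.ae_differentiableAt_of_finiteDimensional] with t ht htm
    exact ht (by rwa [uIcc_zero_one])
  set h : ℝ → S.H := fun t => S.component 1 (deriv γ t) with hh
  have hcomp : Continuous (fun x : E => S.component 1 x) := by
    rw [continuous_induced_rng]
    exact (LinearMap.continuous_of_finiteDimensional (S.compL 1))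
  have hmeas : Measurable h := hcomp.measurable.comp (measurable_deriv γ)
  have hmc : ∀ᵐ t ∂volUnit, S.component 1 (S.maurerCartan γ t) = h t := by
    filter_upwards [hdiff] with t ht
    apply Subtype.ext
    rw [hh, S.coe_component, S.coe_component, R.compL_one_maurerCartan hN ht]
  have hmc' : ∀ᵐ t ∂volUnit, S.maurerCartan γ t = h t := by
    filter_upwards [hmc, hhor] with t ht1 ht2
    rw [← ht1, S.coe_component, S.compL_of_mem ht2, if_pos rfl]
  have hcost : ∫⁻ t in Icc (0 : ℝ) 1, (legendre Λ (S.component 1 (S.maurerCartan γ t))).toENNReal =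
      ∫⁻ t, cost Λ (h t) ∂volUnit := lintegral_congr_ae (hmc.mono fun t ht => by
    simp only
    rw [toENNReal_legendre, ht])
  rw [hcost]
  by_cases htop : ∫⁻ t, cost Λ (h t) ∂volUnit = ∞
  · rw [htop]; exact le_top
  have hL := (memLp_of_lintegral_cost hκ hle hmeas.aestronglyMeasurable ENNReal.toReal_nonneg
    (ENNReal.ofReal_toReal htop).ge).1
  have hi := hL.integrableOn_unit
  refine iInf₂_le h ⟨hL, ?_⟩
  set G : ℝ → A := fun t => R.emb (γ t) with hG
  have : ProperSpace E := FiniteDimensional.proper ℝ E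
  have hGAC : AbsolutelyContinuousOnInterval G 0 1 := hAC.contDiff_comp R.contDiff_emb
  have hGc : ContinuousOn G (Icc 0 1) := uIcc_zero_one ▸ hGAC.continuousOn
  have hII : IntervalIntegrable (fun s => G s * R.sigma (h s)) volume 0 1 :=
    intervalIntegrable_of_integrableOn_unit (integrableOn_mul_control R.sigma hi hGc) (by simp) (by simp)
  -- An absolutely continuous function with derivative zero almost everywhere is constant; this
  -- turns the differential equation into the integral equation that has a unique solution.
  obtain ⟨c, hc⟩ := (hGAC.sub (absolutelyContinuousOnInterval_integral hII)).const_of_ae_hasDerivAt_zero (by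
    rw [uIcc_zero_one, ← ae_restrict_iff' measurableSet_Icc]
    have h3 := (ae_restrict_iff' (measurableSet_Icc (a := (0 : ℝ)) (b := 1))).mpr
      (uIcc_zero_one ▸ hII.ae_hasDerivAt_integral)
    filter_upwards [hdiff, hmc', h3] with t ht1 ht2 ht3
    have hd := R.hasDerivAt_emb hN ht1
    rw [ht2] at hd
    have := hd.sub (ht3 0 (by simp))
    rwa [sigma_apply, sub_self] at this)
  rw [uIcc_zero_one] at hc
  have hc1 : c = 1 := by
    rw [← hc 0 (by simp)]
    simp [hG, h0, R.emb_zero]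
  rw [← h1]
  refine (eqOn_flow R.sigma_prod_eq_zero hi hGc (fun t ht => ?_) (by simp)).symm
  have := hc t ht
  rw [Pi.sub_apply, hc1, sub_eq_iff_eq_add] at this
  exact this

theorem rate_eq_ctlRate [NormOneClass A] (hN : r ≤ N) {Λ : S.H → ℝ} {κ : ℝ} (hκ : 0 < κ)
    (hle : ∀ v, Λ v ≤ κ * ‖v‖ ^ 2) (g : E) :
    S.rate (legendre Λ) g = ctlRate Λ N R.sigma (R.emb g) :=
  (R.rate_le_ctlRate hN Λ g).antisymm (R.ctlRate_le_rate hN hκ hle g)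

end NilRep

end StratifiedLieAlgebra

/-! ### The Gärtner–Ellis theorem in finite dimension -/

/-- Covers the complement of a ball by finitely many half-spaces, on which exponential Chebyshev
applies. If every $|\langle e_i,z\rangle|$ were below $|z|/(d+1)$, expanding $z$ would give
$|z|<|z|$. The vector $0$ settles $z=0$, in particular dimension zero. -/
theorem exists_norming_finset (V : Type*) [NormedAddCommGroup V] [InnerProductSpace ℝ V]
    [FiniteDimensional ℝ V] : ∃ (T : Finset V) (c : ℝ), 0 < c ∧ (∀ v ∈ T, ‖v‖ ≤ 1) ∧
      ∀ z : V, ∃ v ∈ T, c * ‖z‖ ≤ ⟪v, z⟫ := by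
  classical
  set e := stdOrthonormalBasis ℝ V
  set d := Module.finrank ℝ V
  refine ⟨insert 0 (Finset.univ.image e ∪ Finset.univ.image fun i => -e i), 1 / ((d : ℝ) + 1), by positivity,
    ?_, fun z => ?_⟩
  · intro v hv
    simp only [Finset.mem_insert, Finset.mem_union, Finset.mem_image, Finset.mem_univ, true_and] at hv
    rcases hv with rfl | ⟨i, rfl⟩ | ⟨i, rfl⟩ <;> simp
  · by_contra! hcon
    have h0 := hcon 0 (by simp)
    rw [inner_zero_left] at h0
    have hz : 0 < ‖z‖ := by by_contra h; simp at h; simp [h] at h0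
    have hi : ∀ i, ‖⟪e i, z⟫ • e i‖ ≤ 1 / ((d : ℝ) + 1) * ‖z‖ := fun i => by
      have h1 := hcon (e i) (by simp)
      have h2 := hcon (-e i) (by simp)
      rw [inner_neg_left] at h2
      rw [norm_smul, OrthonormalBasis.norm_eq_one, mul_one, Real.norm_eq_abs, abs_le]
      constructor <;> linarith
    have h3 : ‖z‖ ≤ d * (1 / ((d : ℝ) + 1) * ‖z‖) := by
      conv_lhs => rw [← e.sum_repr' z]
      refine (norm_sum_le_of_le _ fun i _ => hi i).trans ?_
      simp [d]
    have h4 : (d : ℝ) * (1 / ((d : ℝ) + 1) * ‖z‖) < ‖z‖ := by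
      have : (d : ℝ) * (1 / ((d : ℝ) + 1) * ‖z‖) = ‖z‖ - ‖z‖ / (d + 1) := by field_simp; ring
      rw [this]
      have : 0 < ‖z‖ / ((d : ℝ) + 1) := by positivity
      linarith
    linarith

theorem eventually_le_exp_mul {K : ℝ} {τ : ℝ} (hτ : 0 < τ) : ∀ᶠ n : ℕ in atTop, K ≤ Real.exp (n * τ) :=
  (Real.tendsto_exp_atTop.comp
    (tendsto_natCast_atTop_atTop.atTop_mul_const hτ)).eventually_ge_atTop K

section ExpSmall

variable {Ω : Type*} [MeasurableSpace Ω] {P : Measure Ω} [IsProbabilityMeasure P]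

/-- The number of sets is a constant factor, absorbed by any loss in the exponential rate. -/
theorem eventually_measureReal_biUnion_le {ι : Type*} (T : Finset ι) {B : ι → ℕ → Set Ω} {b b' : ℝ}
    (hb : b' < b) (hB : ∀ i ∈ T, ∀ᶠ n : ℕ in atTop, P.real (B i n) ≤ Real.exp (-(n * b))) :
    ∀ᶠ n : ℕ in atTop, P.real (⋃ i ∈ T, B i n) ≤ Real.exp (-(n * b')) := by
  filter_upwards [(Filter.eventually_all_finset T).mpr hB,
    eventually_le_exp_mul (K := (T.card : ℝ)) (sub_pos.mpr hb)] with n hn hK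
  calc P.real (⋃ i ∈ T, B i n) ≤ ∑ i ∈ T, P.real (B i n) := measureReal_biUnion_finset_le T _
    _ ≤ ∑ _i ∈ T, Real.exp (-(n * b)) := Finset.sum_le_sum hn
    _ = T.card * Real.exp (-(n * b)) := by simp
    _ ≤ Real.exp (n * (b - b')) * Real.exp (-(n * b)) := by gcongr
    _ = Real.exp (-(n * b')) := by rw [← Real.exp_add]; congr 1; ring

theorem eventually_measureReal_union_le {B B' : ℕ → Set Ω} {b b' : ℝ}
    (hb : b' < b) (hB : ∀ᶠ n : ℕ in atTop, P.real (B n) ≤ Real.exp (-(n * b)))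
    (hB' : ∀ᶠ n : ℕ in atTop, P.real (B' n) ≤ Real.exp (-(n * b))) :
    ∀ᶠ n : ℕ in atTop, P.real (B n ∪ B' n) ≤ Real.exp (-(n * b')) := by
  have := eventually_measureReal_biUnion_le (P := P) Finset.univ
    (B := fun (i : Bool) n => cond i (B n) (B' n)) hb (by rintro (_ | _) - <;> assumption)
  filter_upwards [this] with n hn
  convert hn using 2
  ext ω
  simp [or_comm]

end ExpSmall

section GartnerEllis

variable {V : Type*} [NormedAddCommGroup V] [InnerProductSpace ℝ V] [FiniteDimensional ℝ V]
  [MeasurableSpace V] [BorelSpace V]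
  {Ω : Type*} [MeasurableSpace Ω] {P : Measure Ω} [IsProbabilityMeasure P]
  {Z : ℕ → Ω → V} {L : ℕ → V → ℝ} {Lb : V → ℝ}

theorem integrable_of_integral_eq_exp {f : Ω → ℝ} {c : ℝ} (h : ∫ ω, f ω ∂P = Real.exp c) : Integrable f P := by
  by_contra hf
  rw [integral_undef hf] at h
  exact (Real.exp_pos c).ne h

/-- Exponential Chebyshev inequality for the law tilted by $u$; $u=0$ is the untilted case. -/
theorem setIntegral_exp_inner_le (hZ : ∀ n, Measurable (Z n))
    (hE : ∀ n v, ∫ ω, Real.exp (n * ⟪v, Z n ω⟫) ∂P = Real.exp (n * L n v)) (n : ℕ) (u v : V) (c : ℝ) :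
    ∫ ω in {ω | c ≤ ⟪v, Z n ω⟫}, Real.exp (n * ⟪u, Z n ω⟫) ∂P ≤ Real.exp (n * (L n (u + v) - c)) := by
  have hS : MeasurableSet {ω | c ≤ ⟪v, Z n ω⟫} := measurableSet_le measurable_const
    (measurable_const.inner (hZ n))
  have e : Real.exp (n * (L n (u + v) - c)) =
      ∫ ω, Real.exp (-(n * c)) * Real.exp (n * ⟪u + v, Z n ω⟫) ∂P := by
    rw [integral_const_mul, hE, ← Real.exp_add]
    congr 1
    ring
  have hi : Integrable (fun ω => Real.exp (-(n * c)) * Real.exp (n * ⟪u + v, Z n ω⟫)) P :=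
    (integrable_of_integral_eq_exp (hE n (u + v))).const_mul _
  rw [e]
  refine le_trans ?_ (setIntegral_le_integral (s := {ω | c ≤ ⟪v, Z n ω⟫}) hi
    (Eventually.of_forall fun ω => by positivity))
  refine setIntegral_mono_on (integrable_of_integral_eq_exp (hE n u)).integrableOn hi.integrableOn hS
    fun ω hω => ?_
  rw [← Real.exp_add, inner_add_left]
  refine Real.exp_le_exp.mpr ?_
  have : (n : ℝ) * c ≤ n * ⟪v, Z n ω⟫ := mul_le_mul_of_nonneg_left hω (Nat.cast_nonneg n)
  linarith

theorem eventually_measureReal_halfSpace_le (hZ : ∀ n, Measurable (Z n))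
    (hE : ∀ n v, ∫ ω, Real.exp (n * ⟪v, Z n ω⟫) ∂P = Real.exp (n * L n v))
    (hL : ∀ v, Tendsto (fun n => L n v) atTop (𝓝 (Lb v))) {v : V} {c b : ℝ} (hb : b < c - Lb v) :
    ∀ᶠ n : ℕ in atTop, P.real {ω | c ≤ ⟪v, Z n ω⟫} ≤ Real.exp (-(n * b)) := by
  filter_upwards [(hL v).eventually_lt_const (by linarith : Lb v < c - b)] with n hn
  have h := setIntegral_exp_inner_le hZ hE n 0 v c
  simp only [inner_zero_left, mul_zero, Real.exp_zero, zero_add, integral_const, smul_eq_mul, mul_one,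
    measureReal_restrict_apply_univ] at h
  refine h.trans (Real.exp_le_exp.mpr ?_)
  nlinarith [(Nat.cast_nonneg n : (0 : ℝ) ≤ n)]

theorem exists_eventually_measureReal_norm_gt_le (hZ : ∀ n, Measurable (Z n))
    (hE : ∀ n v, ∫ ω, Real.exp (n * ⟪v, Z n ω⟫) ∂P = Real.exp (n * L n v))
    (hL : ∀ v, Tendsto (fun n => L n v) atTop (𝓝 (Lb v))) (b : ℝ) :
    ∃ K : ℝ, ∀ᶠ n : ℕ in atTop, P.real {ω | K < ‖Z n ω‖} ≤ Real.exp (-(n * b)) := by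
  obtain ⟨T, c, hc, -, hT⟩ := exists_norming_finset V
  obtain ⟨K, hK⟩ : ∃ K : ℝ, ∀ v ∈ T, b + 1 + Lb v + 1 ≤ c * K := by
    obtain ⟨B, hB⟩ := (T.image Lb).exists_le
    refine ⟨(b + 2 + B) / c, fun v hv => ?_⟩
    rw [mul_div_cancel₀ _ hc.ne']
    linarith [hB _ (Finset.mem_image_of_mem Lb hv)]
  refine ⟨K, ?_⟩
  filter_upwards [eventually_measureReal_biUnion_le (P := P) T (lt_add_one b)
    (B := fun v n => {ω | c * K ≤ ⟪v, Z n ω⟫})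
    fun v hv => eventually_measureReal_halfSpace_le hZ hE hL (by linarith [hK v hv])] with n hn
  refine (measureReal_mono (fun ω hω => ?_) (measure_ne_top P _)).trans hn
  obtain ⟨v, hv, hvz⟩ := hT (Z n ω)
  simp only [mem_iUnion]
  exact ⟨v, hv, le_trans (mul_le_mul_of_nonneg_left (le_of_lt hω) hc.le) hvz⟩

/-- Exponential tightness reduces to a compact part of $C$, which is covered by finitely many
half-spaces, each given by a nearly optimal dual variable at a point of $C$. -/
theorem eventually_measureReal_closed_le (hZ : ∀ n, Measurable (Z n))
    (hE : ∀ n v, ∫ ω, Real.exp (n * ⟪v, Z n ω⟫) ∂P = Real.exp (n * L n v))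
    (hL : ∀ v, Tendsto (fun n => L n v) atTop (𝓝 (Lb v))) {C : Set V} (hC : IsClosed C) {b b' : ℝ}
    (hCb : ∀ u ∈ C, ENNReal.ofReal b ≤ cost Lb u) (hb : b' < b) :
    ∀ᶠ n : ℕ in atTop, P.real {ω | Z n ω ∈ C} ≤ Real.exp (-(n * b')) := by
  rcases lt_or_ge b' 0 with hneg | hpos
  · refine Eventually.of_forall fun n => measureReal_le_one.trans (Real.one_le_exp ?_)
    have : (n : ℝ) * b' ≤ 0 := mul_nonpos_of_nonneg_of_nonpos (Nat.cast_nonneg n) hneg.le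
    linarith
  -- The chain $b'<b_3<b_1<b_2<b$ leaves room for, from the right, choosing the dual variables, the
  -- half-space bound, the union of half-spaces, and the union with the complement of a large ball.
  obtain ⟨b2, hb2, hb2b⟩ := exists_between hb
  obtain ⟨b1, hb1, hb12⟩ := exists_between hb2
  obtain ⟨b3, hb3, hb31⟩ := exists_between hb1
  obtain ⟨K, hK⟩ := exists_eventually_measureReal_norm_gt_le hZ hE hL b3
  have hdual : ∀ u ∈ C, ∃ v, b2 < ⟪v, u⟫ - Lb v := by
    intro u hu
    have : ENNReal.ofReal b2 < cost Lb u :=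
      ((ENNReal.ofReal_lt_ofReal_iff (by linarith)).mpr hb2b).trans_le (hCb u hu)
    obtain ⟨v, hv⟩ := lt_iSup_iff.mp this
    exact ⟨v, (ENNReal.ofReal_lt_ofReal_iff_of_nonneg (by linarith)).mp hv⟩
  choose! v hv using hdual
  have : ProperSpace V := FiniteDimensional.proper ℝ V
  obtain ⟨t, htC, htcov⟩ := ((isCompact_closedBall (0 : V) K).inter_left hC).elim_nhds_subcover
    (fun u => {z | b2 + Lb (v u) < ⟪v u, z⟫})
    (fun u hu => (isOpen_lt continuous_const (by fun_prop)).mem_nhds (by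
      have := hv u hu.1
      simp only [mem_ofPred_eq]
      linarith))
  have h1 := eventually_measureReal_biUnion_le (P := P) t hb31
    (B := fun u n => {ω | b2 + Lb (v u) ≤ ⟪v u, Z n ω⟫})
    fun u _ => eventually_measureReal_halfSpace_le hZ hE hL (by linarith)
  filter_upwards [eventually_measureReal_union_le hb3 hK h1] with n hn
  refine (measureReal_mono (fun ω hω => ?_) (measure_ne_top P _)).trans hn
  rcases lt_or_ge K ‖Z n ω‖ with h | h
  · exact Or.inl h
  · right
    obtain ⟨u, hu, huz⟩ := mem_iUnion₂.mp (htcov ⟨hω, by simpa using h⟩)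
    have huz' : b2 + Lb (v u) < ⟪v u, Z n ω⟫ := huz
    exact mem_iUnion₂.mpr ⟨u, hu, huz'.le⟩

/-- Change of measure. When $u$ is the gradient of the limiting function at $l$, the law tilted by
$l$ concentrates near $u$: at least half of its mass lies in the ball, where the tilting density is
at most $e^{n(\langle l,u\rangle+|l|\rho)}$. -/
theorem eventually_le_measureReal_ball_of_hasDerivAt (hZ : ∀ n, Measurable (Z n))
    (hE : ∀ n v, ∫ ω, Real.exp (n * ⟪v, Z n ω⟫) ∂P = Real.exp (n * L n v))
    (hL : ∀ v, Tendsto (fun n => L n v) atTop (𝓝 (Lb v))) {u l : V}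
    (hd : ∀ v, HasDerivAt (fun s : ℝ => Lb (l + s • v)) ⟪v, u⟫ 0) {ρ b : ℝ} (hρ : 0 < ρ)
    (hb : ⟪l, u⟫ - Lb l + ‖l‖ * ρ < b) :
    ∀ᶠ n : ℕ in atTop, Real.exp (-(n * b)) ≤ P.real {ω | Z n ω ∈ Metric.ball u ρ} := by
  obtain ⟨T, c, hc, -, hT⟩ := exists_norming_finset V
  -- The expression has slope $-c\rho<0$ at $s=0$, so a small further tilt in the direction $v$
  -- shows the half-space to be exponentially unlikely.
  have hs : ∀ v, ∃ s : ℝ, 0 < s ∧ Lb (l + s • v) - s * (c * ρ + ⟪v, u⟫) < Lb l := by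
    intro v
    have h1 : HasDerivAt (fun s : ℝ => Lb (l + s • v) - s * (c * ρ + ⟪v, u⟫)) (-(c * ρ)) 0 := by
      have : HasDerivAt (fun s : ℝ => Lb (l + s • v) - s * (c * ρ + ⟪v, u⟫))
          (⟪v, u⟫ - 1 * (c * ρ + ⟪v, u⟫)) 0 :=
        (hd v).sub ((hasDerivAt_id (0 : ℝ)).mul_const (c * ρ + ⟪v, u⟫))
      rwa [show ⟪v, u⟫ - 1 * (c * ρ + ⟪v, u⟫) = -(c * ρ) by ring] at this
    have h2 := (h1.tendsto_slope_zero_right).eventually_lt_const (u := 0) (by nlinarith)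
    obtain ⟨s, hs, hs0⟩ := (h2.and self_mem_nhdsWithin).exists
    refine ⟨s, hs0, ?_⟩
    simp only [zero_add, zero_smul, add_zero, zero_mul, sub_zero, smul_eq_mul] at hs
    have := (inv_mul_lt_iff₀ (show (0 : ℝ) < s from hs0)).mp hs
    linarith
  choose s hs0 hs using hs
  set bad : V → ℕ → Set Ω := fun v n => {ω | s v * (c * ρ + ⟪v, u⟫) ≤ ⟪s v • v, Z n ω⟫} with hbad
  -- The constant makes all the bad half-spaces together carry at most half of the tilted mass.
  have hbad_le : ∀ v, ∀ᶠ n : ℕ in atTop, ∫ ω in bad v n, Real.exp (n * ⟪l, Z n ω⟫) ∂P ≤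
      (1 / (2 * ((T.card : ℝ) + 1))) * Real.exp (n * L n l) := by
    intro v
    have h1 : Tendsto (fun n : ℕ => (n : ℝ) * (L n (l + s v • v) - s v * (c * ρ + ⟪v, u⟫) - L n l)) atTop atBot :=
      tendsto_natCast_atTop_atTop.atTop_mul_neg (sub_neg.mpr (hs v))
        (((hL _).sub_const _).sub (hL l))
    have h2 := (Real.tendsto_exp_atBot.comp h1).eventually_le_const
      (u := 1 / (2 * ((T.card : ℝ) + 1))) (by positivity)
    filter_upwards [h2] with n hn
    refine (setIntegral_exp_inner_le hZ hE n l (s v • v) _).trans ?_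
    simp only [Function.comp_apply] at hn
    refine le_trans (le_of_eq ?_) (mul_le_mul_of_nonneg_right hn (Real.exp_pos _).le)
    rw [← Real.exp_add]
    congr 1
    ring
  -- Half of the gap in `hb` pays for the convergence of $L_n(l)$, the other half for the factor
  -- $2$.
  have hL' := (hL l).eventually_const_lt
    (show Lb l - (b - (⟪l, u⟫ - Lb l + ‖l‖ * ρ)) / 2 < Lb l by linarith)
  filter_upwards [(Filter.eventually_all_finset T).mpr fun v _ => hbad_le v, hL',
    eventually_le_exp_mul (K := 2) (show 0 < (b - (⟪l, u⟫ - Lb l + ‖l‖ * ρ)) / 2 by linarith)] with n hn hLn h2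
  set good : Set Ω := {ω | Z n ω ∈ Metric.ball u ρ} with hgood
  have hgm : MeasurableSet good := hZ n Metric.isOpen_ball.measurableSet
  have hint := integrable_of_integral_eq_exp (hE n l)
  have hcov : goodᶜ ⊆ ⋃ v ∈ T, bad v n := by
    intro ω hω
    have hω' : ρ ≤ ‖Z n ω - u‖ := by
      simpa [hgood, mem_ball_iff_norm, dist_eq_norm] using hω
    obtain ⟨v, hv, hvz⟩ := hT (Z n ω - u)
    refine mem_iUnion₂.mpr ⟨v, hv, ?_⟩
    simp only [hbad, mem_ofPred_eq, real_inner_smul_left]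
    refine mul_le_mul_of_nonneg_left ?_ (hs0 v).le
    rw [inner_sub_right] at hvz
    nlinarith
  have h3 : ∫ ω in goodᶜ, Real.exp (n * ⟪l, Z n ω⟫) ∂P ≤ 1 / 2 * Real.exp (n * L n l) := by
    have hbm : ∀ v ∈ T, MeasurableSet (bad v n) := fun v _ =>
      measurableSet_le measurable_const (measurable_const.inner (hZ n))
    calc ∫ ω in goodᶜ, Real.exp (n * ⟪l, Z n ω⟫) ∂P
        ≤ ∫ ω, ∑ v ∈ T, (bad v n).indicator (fun ω => Real.exp (n * ⟪l, Z n ω⟫)) ω ∂P := by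
          rw [← integral_indicator hgm.compl]
          refine integral_mono (hint.indicator hgm.compl)
            (integrable_finsetSum _ fun v hv => hint.indicator (hbm v hv)) fun ω => ?_
          have hnn : ∀ v ∈ T, 0 ≤ (bad v n).indicator (fun ω => Real.exp (n * ⟪l, Z n ω⟫)) ω :=
            fun v _ => indicator_nonneg (fun _ _ => (Real.exp_pos _).le) ω
          by_cases hω : ω ∈ goodᶜ
          · obtain ⟨v, hv, hvω⟩ := mem_iUnion₂.mp (hcov hω)
            rw [indicator_of_mem hω]
            refine le_trans (le_of_eq ?_) (Finset.single_le_sum hnn hv)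
            rw [indicator_of_mem hvω]
          · rw [indicator_of_notMem hω]
            exact Finset.sum_nonneg hnn
      _ = ∑ v ∈ T, ∫ ω in bad v n, Real.exp (n * ⟪l, Z n ω⟫) ∂P := by
          rw [integral_finsetSum _ fun v hv => hint.indicator (hbm v hv)]
          exact Finset.sum_congr rfl fun v hv => integral_indicator (hbm v hv)
      _ ≤ ∑ _v ∈ T, (1 / (2 * ((T.card : ℝ) + 1))) * Real.exp (n * L n l) := Finset.sum_le_sum hn
      _ = (T.card / ((T.card : ℝ) + 1)) * (1 / 2 * Real.exp (n * L n l)) := by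
          rw [Finset.sum_const, nsmul_eq_mul]; field_simp
      _ ≤ 1 * (1 / 2 * Real.exp (n * L n l)) := by
          gcongr
          rw [div_le_one (by positivity)]
          linarith
      _ = _ := one_mul _
  have h4 : ∫ ω in good, Real.exp (n * ⟪l, Z n ω⟫) ∂P ≤
      Real.exp (n * (⟪l, u⟫ + ‖l‖ * ρ)) * P.real good := by
    rw [mul_comm, ← smul_eq_mul, ← setIntegral_const]
    refine setIntegral_mono_on hint.integrableOn (integrableOn_const (by simp)) hgm fun ω hω => ?_
    refine Real.exp_le_exp.mpr (mul_le_mul_of_nonneg_left ?_ (Nat.cast_nonneg n))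
    have h5 : ⟪l, Z n ω⟫ = ⟪l, u⟫ + ⟪l, Z n ω - u⟫ := by rw [inner_sub_right]; ring
    have h6 : ‖Z n ω - u‖ ≤ ρ := (mem_ball_iff_norm.mp hω).le
    rw [h5]
    linarith [(real_inner_le_norm l (Z n ω - u)).trans (mul_le_mul_of_nonneg_left h6 (norm_nonneg l))]
  have h7 := integral_add_compl hgm hint
  rw [hE] at h7
  have h8 : Real.exp (n * L n l) ≤ 2 * (Real.exp (n * (⟪l, u⟫ + ‖l‖ * ρ)) * P.real good) := by linarith
  have h9 : Real.exp (n * L n l) * Real.exp (-(n * (⟪l, u⟫ + ‖l‖ * ρ))) ≤ 2 * P.real good := by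
    have := mul_le_mul_of_nonneg_right h8 (Real.exp_pos (-(n * (⟪l, u⟫ + ‖l‖ * ρ)))).le
    refine this.trans (le_of_eq ?_)
    have e : Real.exp (n * (⟪l, u⟫ + ‖l‖ * ρ)) * Real.exp (-(n * (⟪l, u⟫ + ‖l‖ * ρ))) = 1 := by
      rw [← Real.exp_add, add_neg_cancel, Real.exp_zero]
    linear_combination 2 * P.real good * e
  have h10 : 2 * Real.exp (-(n * b)) ≤ Real.exp (n * L n l) * Real.exp (-(n * (⟪l, u⟫ + ‖l‖ * ρ))) := by
    refine (mul_le_mul_of_nonneg_right h2 (Real.exp_pos _).le).trans ?_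
    rw [← Real.exp_add, ← Real.exp_add]
    refine Real.exp_le_exp.mpr ?_
    nlinarith [(Nat.cast_nonneg n : (0 : ℝ) ≤ n)]
  linarith

/-- The point $u$ need not be a gradient of $\Lambda$. Maximizing $\langle
v,u\rangle-\Lambda(v)-\frac\varepsilon2|v|^2$ gives $l$ with gradient $u'=u-\varepsilon l$. This
$u'$ is close to $u$, because $\frac\varepsilon2|l|^2\le\Lambda^*(u)$, and $\langle
l,u'\rangle-\Lambda(l)\le\Lambda^*(u)$. The change of measure then applies at $u'$. -/
theorem eventually_le_measureReal_open (hZ : ∀ n, Measurable (Z n))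
    (hE : ∀ n v, ∫ ω, Real.exp (n * ⟪v, Z n ω⟫) ∂P = Real.exp (n * L n v))
    (hL : ∀ v, Tendsto (fun n => L n v) atTop (𝓝 (Lb v))) (hLb : Differentiable ℝ Lb) (hLb0 : Lb 0 = 0)
    {O : Set V} (hO : IsOpen O) {u : V} (hu : u ∈ O) {b : ℝ}
    (hb : cost Lb u < ENNReal.ofReal b) :
    ∀ᶠ n : ℕ in atTop, Real.exp (-(n * b)) ≤ P.real {ω | Z n ω ∈ O} := by
  obtain ⟨δ, hδ, hball⟩ := Metric.isOpen_iff.mp hO u hu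
  have htop : cost Lb u ≠ ∞ := ne_top_of_lt hb
  set c := (cost Lb u).toReal with hc
  have hc0 : 0 ≤ c := ENNReal.toReal_nonneg
  have hcb : c < b := by
    rw [hc]; exact (ENNReal.lt_ofReal_iff_toReal_lt htop).mp hb
  have hcv : ∀ v, ⟪v, u⟫ - Lb v ≤ c := fun v =>
    (ENNReal.ofReal_le_iff_le_toReal htop).mp (ofReal_le_cost Lb u v)
  -- Then $|\varepsilon l|^2\le2\varepsilon c\le\delta^2/8$, so $u'$ is within $\delta/2$ of $u$.
  set ε := δ ^ 2 / (16 * (c + 1)) with hε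
  have hε0 : 0 < ε := by positivity
  set f : V → ℝ := fun v => ⟪v, u⟫ - Lb v - ε / 2 * ‖v‖ ^ 2 with hf
  have hfc : Continuous f := by
    have := hLb.continuous
    fun_prop
  have : ProperSpace V := FiniteDimensional.proper ℝ V
  obtain ⟨l, hl⟩ := hfc.exists_forall_ge' 0 (by
    have h1 : Tendsto (fun v : V => ε / 2 * ‖v‖ ^ 2) (cocompact V) atTop :=
      ((tendsto_pow_atTop two_ne_zero).comp tendsto_norm_cocompact_atTop).const_mul_atTop (by positivity)
    filter_upwards [h1.eventually_ge_atTop c] with v hv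
    simp only [hf, inner_zero_left, hLb0, norm_zero]
    linarith [hcv v])
  set u' := u - ε • l with hu'
  have hd : ∀ v, HasDerivAt (fun s : ℝ => Lb (l + s • v)) ⟪v, u'⟫ 0 := by
    intro v
    have hline : HasDerivAt (fun s : ℝ => l + s • v) v 0 := by
      simpa using ((hasDerivAt_id (0 : ℝ)).smul_const v).const_add l
    have h1 : HasDerivAt (fun s : ℝ => Lb (l + s • v)) (fderiv ℝ Lb (l + (0 : ℝ) • v) v) 0 :=
      (hLb _).hasFDerivAt.comp_hasDerivAt 0 hline
    have h2 : HasDerivAt (fun s : ℝ => f (l + s • v)) (⟪v, u⟫ -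
        fderiv ℝ Lb (l + (0 : ℝ) • v) v - ε / 2 * (2 * ⟪l + (0 : ℝ) • v, v⟫)) 0 := by
      have h3 : HasDerivAt (fun s : ℝ => ⟪l + s • v, u⟫) ⟪v, u⟫ 0 := by
        have := hline.inner ℝ (hasDerivAt_const (0 : ℝ) u)
        simpa using this
      exact (h3.sub h1).sub ((hline.norm_sq).const_mul _)
    have hmax : IsLocalMax (fun s : ℝ => f (l + s • v)) 0 := Eventually.of_forall fun s => by
      simpa using hl (l + s • v)
    have h3 := hmax.hasDerivAt_eq_zero h2
    simp only [zero_smul, add_zero] at h3 h1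
    convert h1 using 1
    rw [hu', inner_sub_right, real_inner_smul_right]
    rw [real_inner_comm v l] at h3
    linarith
  have hl0 := hl 0
  simp only [hf, inner_zero_left, hLb0, norm_zero] at hl0
  have hdist : ‖u' - u‖ < δ / 2 := by
    have e : ‖u' - u‖ = ε * ‖l‖ := by
      rw [hu', sub_sub_cancel_left, norm_neg, norm_smul, Real.norm_of_nonneg hε0.le]
    have h1 : ε / 2 * ‖l‖ ^ 2 ≤ c := by linarith [hcv l]
    have h2 : (ε * ‖l‖) ^ 2 ≤ δ ^ 2 / 8 := by
      have h3 : (ε * ‖l‖) ^ 2 = 2 * ε * (ε / 2 * ‖l‖ ^ 2) := by ring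
      have h4 : ε * (c + 1) = δ ^ 2 / 16 := by rw [hε]; field_simp
      rw [h3]
      nlinarith
    rw [e]
    refine lt_of_pow_lt_pow_left₀ 2 (by positivity) ?_
    nlinarith [sq_pos_of_pos hδ]
  set ρ := min (δ / 2) ((b - c) / (2 * (‖l‖ + 1))) with hρ
  have hρ0 : 0 < ρ := lt_min (by positivity) (div_pos (by linarith) (by positivity))
  have hlρ : ‖l‖ * ρ ≤ (b - c) / 2 := by
    have h1 : ρ ≤ (b - c) / (2 * (‖l‖ + 1)) := min_le_right _ _
    have h2 : (‖l‖ + 1) * ((b - c) / (2 * (‖l‖ + 1))) = (b - c) / 2 := by field_simp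
    nlinarith [norm_nonneg l]
  have hlow : ⟪l, u'⟫ - Lb l + ‖l‖ * ρ < b := by
    have h1 : ⟪l, u'⟫ = ⟪l, u⟫ - ε * ‖l‖ ^ 2 := by
      rw [hu', inner_sub_right, real_inner_smul_right, real_inner_self_eq_norm_sq]
    have : 0 ≤ ε * ‖l‖ ^ 2 := by positivity
    linarith [hcv l]
  filter_upwards [eventually_le_measureReal_ball_of_hasDerivAt hZ hE hL hd hρ0 hlow] with n hn
  refine hn.trans (measureReal_mono fun ω hω => hball ?_)
  have h1 : ‖Z n ω - u'‖ < ρ := mem_ball_iff_norm.mp hω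
  rw [mem_ball_iff_norm]
  calc ‖Z n ω - u‖ = ‖(Z n ω - u') + (u' - u)‖ := by rw [sub_add_sub_cancel]
    _ ≤ ‖Z n ω - u'‖ + ‖u' - u‖ := norm_add_le _ _
    _ < δ := by linarith [min_le_left (δ / 2) ((b - c) / (2 * (‖l‖ + 1)))]

end GartnerEllis

/-! ### The log-moment generating function -/

section LogMGF

variable {F : Type*} [NormedAddCommGroup F] [InnerProductSpace ℝ F] [FiniteDimensional ℝ F]
  [MeasurableSpace F] [BorelSpace F]
  {Ω : Type*} [MeasurableSpace Ω] {P : Measure Ω} [IsProbabilityMeasure P] {Y : Ω → F}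

theorem integrable_exp_mul_norm (hY : Measurable Y) (hΛ : ∀ v, Integrable (fun ω => Real.exp ⟪v, Y ω⟫) P)
    {K : ℝ} (hK : 0 ≤ K) : Integrable (fun ω => Real.exp (K * ‖Y ω‖)) P := by
  obtain ⟨T, c, hc, -, hT⟩ := exists_norming_finset F
  refine (integrable_finsetSum T fun v _ => hΛ ((K / c) • v)).mono'
    (by fun_prop) (Eventually.of_forall fun ω => ?_)
  obtain ⟨v, hv, h⟩ := hT (Y ω)
  rw [Real.norm_of_nonneg (Real.exp_pos _).le]
  refine le_trans (Real.exp_le_exp.mpr ?_) (Finset.single_le_sum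
    (f := fun v => Real.exp ⟪(K / c) • v, Y ω⟫) (fun _ _ => (Real.exp_pos _).le) hv)
  rw [real_inner_smul_left]
  calc K * ‖Y ω‖ = K / c * (c * ‖Y ω‖) := by field_simp
    _ ≤ K / c * ⟪v, Y ω⟫ := by gcongr

theorem exp_logMGF (hΛ : ∀ v, Integrable (fun ω => Real.exp ⟪v, Y ω⟫) P) (v : F) :
    Real.exp (logMGF P Y v) = ∫ ω, Real.exp ⟪v, Y ω⟫ ∂P :=
  Real.exp_log (integral_exp_pos (hΛ v))

theorem logMGF_zero : logMGF P Y 0 = 0 := by simp [logMGF]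

theorem differentiable_integral_exp_inner (hY : Measurable Y)
    (hΛ : ∀ v, Integrable (fun ω => Real.exp ⟪v, Y ω⟫) P) :
    Differentiable ℝ fun v => ∫ ω, Real.exp ⟪v, Y ω⟫ ∂P := by
  intro v₀
  have hd : ∀ (ω : Ω) (v : F), HasFDerivAt (fun v => Real.exp ⟪v, Y ω⟫)
      (Real.exp ⟪v, Y ω⟫ • innerSL ℝ (Y ω)) v := fun ω v => by
    have h1 : HasFDerivAt (fun v => ⟪v, Y ω⟫) (innerSL ℝ (Y ω)) v := by
      have := (innerSL ℝ (Y ω)).hasFDerivAt (x := v)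
      refine this.congr_of_eventuallyEq (Eventually.of_forall fun w => ?_)
      simp only [innerSL_apply_apply]
      exact real_inner_comm _ _
    exact h1.exp
  refine (hasFDerivAt_integral_of_dominated_of_fderiv_le (F := fun v ω => Real.exp ⟪v, Y ω⟫)
    (F' := fun v ω => Real.exp ⟪v, Y ω⟫ • innerSL ℝ (Y ω)) (Metric.ball_mem_nhds v₀ one_pos)
    (bound := fun ω => Real.exp ((‖v₀‖ + 2) * ‖Y ω‖))
    (Eventually.of_forall fun v => (hΛ v).1) (hΛ v₀) ?_ (Eventually.of_forall fun ω v hv => ?_)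
    (integrable_exp_mul_norm hY hΛ (by positivity))
    (Eventually.of_forall fun ω v _ => hd ω v)).differentiableAt
  · exact (Continuous.measurable (by fun_prop : Continuous fun y : F => Real.exp ⟪v₀, y⟫ • innerSL ℝ y)
      |>.comp hY).aestronglyMeasurable
  · have h1 : ‖v‖ ≤ ‖v₀‖ + 1 := by
      have := norm_sub_norm_le v v₀
      linarith [mem_ball_iff_norm.mp hv]
    rw [norm_smul, innerSL_apply_norm, Real.norm_of_nonneg (Real.exp_pos _).le]
    calc Real.exp ⟪v, Y ω⟫ * ‖Y ω‖ ≤ Real.exp ((‖v₀‖ + 1) * ‖Y ω‖) * Real.exp ‖Y ω‖ := by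
          gcongr
          · exact (real_inner_le_norm _ _).trans (by gcongr)
          · linarith [Real.add_one_le_exp ‖Y ω‖]
      _ = Real.exp ((‖v₀‖ + 2) * ‖Y ω‖) := by rw [← Real.exp_add]; congr 1; ring

theorem differentiable_logMGF (hY : Measurable Y)
    (hΛ : ∀ v, Integrable (fun ω => Real.exp ⟪v, Y ω⟫) P) : Differentiable ℝ (logMGF P Y) :=
  (differentiable_integral_exp_inner hY hΛ).log fun v => (integral_exp_pos (hΛ v)).ne'

theorem integrable_of_integrable_exp_inner (hY : Measurable Y)
    (hΛ : ∀ v, Integrable (fun ω => Real.exp ⟪v, Y ω⟫) P) : Integrable Y P := by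
  refine (integrable_exp_mul_norm hY hΛ zero_le_one).mono' hY.aestronglyMeasurable
    (Eventually.of_forall fun ω => ?_)
  linarith [Real.add_one_le_exp (1 * ‖Y ω‖)]

/-- Uses $e^x\ge1+x$ and the zero mean; it makes the constant control $0$ free of cost. -/
theorem logMGF_nonneg (hY : Measurable Y) (hΛ : ∀ v, Integrable (fun ω => Real.exp ⟪v, Y ω⟫) P)
    (hmean : ∫ ω, Y ω ∂P = 0) (v : F) : 0 ≤ logMGF P Y v := by
  refine Real.log_nonneg ?_
  have hi := integrable_of_integrable_exp_inner hY hΛ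
  have h1 : ∫ ω, (⟪v, Y ω⟫ + 1) ∂P = 1 := by
    rw [integral_add (hi.const_inner v) (integrable_const _), integral_inner hi, hmean]
    simp
  rw [← h1]
  exact integral_mono ((hi.const_inner v).add (integrable_const _)) (hΛ v)
    fun ω => Real.add_one_le_exp _

/-- The hypothesis gives a constant for each direction separately. Convexity of $\exp$ over the $d$
coordinates reduces to the basis directions, finitely many, at the price of a factor $d^2$. -/
theorem exists_logMGF_le (hΛ : ∀ v, Integrable (fun ω => Real.exp ⟪v, Y ω⟫) P)
    (hsub : ∀ v, ∃ c : ℝ≥0, HasSubgaussianMGF (fun ω => ⟪v, Y ω⟫) c P) :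
    ∃ κ : ℝ, 0 < κ ∧ ∀ v, logMGF P Y v ≤ κ * ‖v‖ ^ 2 := by
  set e := stdOrthonormalBasis ℝ F
  set d := Module.finrank ℝ F with hd
  choose c hc using fun i => hsub (e i)
  obtain ⟨C, hC⟩ := (Finset.univ.image c).exists_le
  have hcC : ∀ i, c i ≤ C := fun i => hC _ (Finset.mem_image_of_mem c (Finset.mem_univ i))
  refine ⟨d ^ 2 * C + 1, by positivity, fun v => ?_⟩
  rw [← Real.exp_le_exp, exp_logMGF hΛ]
  rcases Nat.eq_zero_or_pos d with h0 | h0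
  · have : Subsingleton F := Module.finrank_zero_iff.mp h0
    have hv : v = 0 := Subsingleton.elim _ _
    simp [hv]
  have hd0 : (0 : ℝ) < d := by exact_mod_cast h0
  have hpt : ∀ ω, Real.exp ⟪v, Y ω⟫ ≤ ∑ i, (d : ℝ)⁻¹ * Real.exp (d * ⟪e i, v⟫ * ⟪e i, Y ω⟫) := by
    intro ω
    have h1 : ⟪v, Y ω⟫ = ∑ i, (d : ℝ)⁻¹ • (d * ⟪e i, v⟫ * ⟪e i, Y ω⟫) := by
      rw [← e.sum_inner_mul_inner v (Y ω)]
      refine Finset.sum_congr rfl fun i _ => ?_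
      rw [smul_eq_mul, real_inner_comm]
      field_simp
    rw [h1]
    have := convexOn_exp.map_sum_le (t := Finset.univ) (w := fun _ : Fin d => (d : ℝ)⁻¹)
      (p := fun i => d * ⟪e i, v⟫ * ⟪e i, Y ω⟫) (fun _ _ => by positivity) (by simp [hd0.ne'])
      (fun _ _ => mem_univ _)
    simpa only [smul_eq_mul] using this
  have hint : ∀ i, Integrable (fun ω => (d : ℝ)⁻¹ * Real.exp (d * ⟪e i, v⟫ * ⟪e i, Y ω⟫)) P := fun i =>
    ((hc i).integrable_exp_mul _).const_mul _
  calc ∫ ω, Real.exp ⟪v, Y ω⟫ ∂P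
      ≤ ∫ ω, ∑ i, (d : ℝ)⁻¹ * Real.exp (d * ⟪e i, v⟫ * ⟪e i, Y ω⟫) ∂P :=
        integral_mono (hΛ v) (integrable_finsetSum _ fun i _ => hint i) hpt
    _ = ∑ i, (d : ℝ)⁻¹ * mgf (fun ω => ⟪e i, Y ω⟫) P (d * ⟪e i, v⟫) := by
        rw [integral_finsetSum _ fun i _ => hint i]
        simp only [integral_const_mul, mgf]
    _ ≤ ∑ _i : Fin d, (d : ℝ)⁻¹ * Real.exp ((d ^ 2 * C + 1) * ‖v‖ ^ 2) := by
        gcongr with i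
        refine ((hc i).mgf_le _).trans (Real.exp_le_exp.mpr ?_)
        have h2 : ⟪e i, v⟫ ^ 2 ≤ ‖v‖ ^ 2 := by
          have h3 := abs_real_inner_le_norm (e i) v
          rw [e.norm_eq_one, one_mul] at h3
          rw [← sq_abs]
          gcongr
        have h4 : (c i : ℝ) ≤ C := hcC i
        have h5 : (c i : ℝ) * (d * ⟪e i, v⟫) ^ 2 ≤ C * (d ^ 2 * ‖v‖ ^ 2) := by
          rw [mul_pow]; gcongr
        have h6 : 0 ≤ (C : ℝ) * (d ^ 2 * ‖v‖ ^ 2) := by positivity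
        nlinarith [sq_nonneg ‖v‖]
    _ = Real.exp ((d ^ 2 * C + 1) * ‖v‖ ^ 2) := by
        rw [Finset.sum_const, Finset.card_univ, Fintype.card_fin, nsmul_eq_mul]
        field_simp

theorem hasSubgaussianMGF_inner_of_bounded (hY : Measurable Y) (hmean : ∫ ω, Y ω ∂P = 0) {R : ℝ}
    (hR : ∀ᵐ ω ∂P, ‖Y ω‖ ≤ R) (v : F) : ∃ c : ℝ≥0, HasSubgaussianMGF (fun ω => ⟪v, Y ω⟫) c P := by
  have hi : Integrable Y P := Integrable.of_bound hY.aestronglyMeasurable R hR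
  refine ⟨_, hasSubgaussianMGF_of_mem_Icc_of_integral_eq_zero (a := -(‖v‖ * R)) (b := ‖v‖ * R)
    (measurable_const.inner hY).aemeasurable ?_ ?_⟩
  · filter_upwards [hR] with ω hω
    have := abs_real_inner_le_norm v (Y ω)
    exact abs_le.mp (this.trans (by gcongr))
  · rw [integral_inner hi, hmean, inner_zero_right]

end LogMGF

section Independent

variable {F : Type*} [NormedAddCommGroup F] [InnerProductSpace ℝ F] [FiniteDimensional ℝ F]
  [MeasurableSpace F] [BorelSpace F]
  {Ω : Type*} [MeasurableSpace Ω] {P : Measure Ω} [IsProbabilityMeasure P] {X : ℕ → Ω → F}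

theorem integral_exp_sum_inner (hmeas : ∀ k, Measurable (X k)) (hindep : iIndepFun X P)
    (hident : ∀ k, IdentDistrib (X k) (X 0) P P)
    (hΛ : ∀ v : F, Integrable (fun ω => Real.exp ⟪v, X 0 ω⟫) P) (l : ℕ → F) (s : Finset ℕ) :
    ∫ ω, Real.exp (∑ k ∈ s, ⟪l k, X k ω⟫) ∂P = Real.exp (∑ k ∈ s, logMGF P (X 0) (l k)) := by
  have h1 : iIndepFun (fun k ω => ⟪l k, X k ω⟫) P :=
    hindep.comp (fun k x => ⟪l k, x⟫) fun k => by fun_prop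
  have h2 := h1.mgf_sum (t := 1) (fun k => measurable_const.inner (hmeas k)) s
  simp only [mgf, one_mul, Finset.sum_apply] at h2
  rw [h2, Real.exp_sum]
  refine Finset.prod_congr rfl fun k _ => ?_
  rw [exp_logMGF hΛ]
  exact ((hident k).comp (u := fun x => Real.exp ⟪l k, x⟫) (by fun_prop)).integral_eq

end Independent

/-! ### Block sums -/

section Blocks

/-- The left end of the `j`-th of `m` blocks of nearly equal length in `{0, …, n - 1}`. -/
def blk (n m j : ℕ) : ℕ := j * n / m

theorem blk_zero (n m : ℕ) : blk n m 0 = 0 := by simp [blk]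

theorem blk_self {m : ℕ} (hm : 0 < m) (n : ℕ) : blk n m m = n := Nat.mul_div_cancel_left n hm

theorem blk_mono (n m : ℕ) : Monotone (blk n m) := fun _ _ h =>
  Nat.div_le_div_right (Nat.mul_le_mul_right n h)

theorem blk_succ_le (n m j : ℕ) : blk n m (j + 1) ≤ blk n m j + n / m + 1 := by
  rcases Nat.eq_zero_or_pos m with rfl | hm
  · simp [blk]
  rw [blk, blk, add_mul, one_mul, Nat.add_div hm]
  split_ifs <;> omega

theorem tendsto_blk_div {m : ℕ} (hm : 0 < m) (j : ℕ) :
    Tendsto (fun n : ℕ => (blk n m j : ℝ) / n) atTop (𝓝 ((j : ℝ) / m)) := by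
  have hm' : (0 : ℝ) < m := by exact_mod_cast hm
  have h1 : Tendsto (fun n : ℕ => (j : ℝ) / m - 1 / (n : ℝ)) atTop (𝓝 ((j : ℝ) / m)) := by
    simpa using (tendsto_one_div_atTop_nhds_zero_nat (𝕜 := ℝ)).const_sub ((j : ℝ) / m)
  refine tendsto_of_tendsto_of_tendsto_of_le_of_le' h1 tendsto_const_nhds ?_ ?_
  all_goals
    filter_upwards [eventually_gt_atTop 0] with n hn
    have hn' : (0 : ℝ) < n := by exact_mod_cast hn
  · have h2 : ((j * n : ℕ) : ℝ) < ((blk n m j : ℕ) + 1) * m := by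
      have := Nat.lt_div_mul_add (a := j * n) hm
      have h3 : j * n < (blk n m j + 1) * m := by rw [add_mul, one_mul]; exact this
      exact_mod_cast h3
    rw [le_div_iff₀ hn', sub_mul, one_div_mul_cancel hn'.ne', sub_le_iff_le_add, div_mul_eq_mul_div,
      div_le_iff₀ hm']
    push_cast at h2
    exact h2.le
  · rw [div_le_iff₀ hn', div_mul_eq_mul_div, le_div_iff₀ hm']
    exact_mod_cast Nat.div_mul_le_self (j * n) m

theorem sum_Ico_blocks {M : Type*} [AddCommMonoid M] {b : ℕ → ℕ} (hb : Monotone b) (f : ℕ → M) (m : ℕ) :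
    ∑ j ∈ Finset.range m, ∑ k ∈ Finset.Ico (b j) (b (j + 1)), f k = ∑ k ∈ Finset.Ico (b 0) (b m), f k := by
  induction m with
  | zero => simp
  | succ m ih => rw [Finset.sum_range_succ, ih, Finset.sum_Ico_consecutive _ (hb m.zero_le) (hb m.le_succ)]

theorem exists_block_index {b : ℕ → ℕ} (hb : Monotone b) (m : ℕ) :
    ∃ g : ℕ → ℕ, ∀ j < m, ∀ k ∈ Finset.Ico (b j) (b (j + 1)), g k = j := by
  refine ⟨fun k => Nat.findGreatest (fun j => b j ≤ k) m, fun j hj k hk => ?_⟩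
  rw [Finset.mem_Ico] at hk
  rw [Nat.findGreatest_eq_iff]
  exact ⟨hj.le, fun _ => hk.1, fun i hi _ => not_le.mpr (hk.2.trans_le (hb hi))⟩

end Blocks

/-! ### The cost of a vector of independent blocks -/

section SeparableCost

variable {F : Type*} [NormedAddCommGroup F] [InnerProductSpace ℝ F]

/-- The sequence of coordinates, extended by zero. -/
def coordSeq {m : ℕ} (u : PiLp 2 fun _ : Fin m => F) (j : ℕ) : F := if h : j < m then u ⟨j, h⟩ else 0

theorem coordSeq_coe {m : ℕ} (u : PiLp 2 fun _ : Fin m => F) (j : Fin m) : coordSeq u j = u j := by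
  simp [coordSeq]

theorem sum_range_coordSeq {m : ℕ} {M : Type*} [AddCommMonoid M] (u : PiLp 2 fun _ : Fin m => F) (f : ℕ → F → M) :
    ∑ j ∈ Finset.range m, f j (coordSeq u j) = ∑ j : Fin m, f j (u j) := by
  rw [Finset.sum_range]
  simp only [coordSeq_coe]

/-- The average of `Λ` over the coordinates. -/
def avgFun (Λ : F → ℝ) (m : ℕ) (l : PiLp 2 fun _ : Fin m => F) : ℝ := ∑ j, (m : ℝ)⁻¹ * Λ (l j)

theorem inner_sub_avgFun (Λ : F → ℝ) {m : ℕ} (hm : 0 < m) (l u : PiLp 2 fun _ : Fin m => F) :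
    ⟪l, u⟫ - avgFun Λ m l = ∑ j, (m : ℝ)⁻¹ * (⟪l j, (m : ℝ) • u j⟫ - Λ (l j)) := by
  have hm' : (m : ℝ) ≠ 0 := by exact_mod_cast hm.ne'
  rw [PiLp.inner_apply, avgFun, ← Finset.sum_sub_distrib]
  refine Finset.sum_congr rfl fun j _ => ?_
  rw [real_inner_smul_right, mul_sub, ← mul_assoc, inv_mul_cancel₀ hm', one_mul]

/-- The dual variables of the coordinates are chosen independently, so the supremum splits. The
right side is the cost of the step control with heights $m\,u_j$. -/
theorem cost_avgFun (Λ : F → ℝ) (hΛ0 : Λ 0 = 0) {m : ℕ} (hm : 0 < m) (u : PiLp 2 fun _ : Fin m => F) :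
    cost (avgFun Λ m) u = ∑ j, ENNReal.ofReal ((m : ℝ)⁻¹) * cost Λ ((m : ℝ) • u j) := by
  have hm0 : (0 : ℝ) ≤ (m : ℝ)⁻¹ := by positivity
  set x : Fin m → F → ℝ := fun j v => (m : ℝ)⁻¹ * (⟪v, (m : ℝ) • u j⟫ - Λ v) with hx
  apply le_antisymm
  · refine iSup_le fun l => ?_
    rw [inner_sub_avgFun Λ hm]
    refine (Finset.le_sum_of_subadditive ENNReal.ofReal ENNReal.ofReal_zero.le
      (fun _ _ => ENNReal.ofReal_add_le) _ _).trans (Finset.sum_le_sum fun j _ => ?_)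
    rw [ENNReal.ofReal_mul hm0]
    exact mul_le_mul' le_rfl (ofReal_le_cost Λ _ _)
  · have e : ∀ j, ENNReal.ofReal ((m : ℝ)⁻¹) * cost Λ ((m : ℝ) • u j) =
        ⨆ l : Fin m → F, ENNReal.ofReal (x j (l j)) := by
      intro j
      rw [cost, ENNReal.mul_iSup]
      simp only [hx, ENNReal.ofReal_mul hm0]
      have hs : Function.Surjective (fun l : Fin m → F => l j) := Function.surjective_eval j
      exact (hs.iSup_comp
        (g := fun v => ENNReal.ofReal ((m : ℝ)⁻¹) * ENNReal.ofReal (⟪v, (m : ℝ) • u j⟫ - Λ v))).symm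
    simp only [e]
    -- Choosing the better of two dual vectors in each coordinate makes the family directed, so sum
    -- and supremum commute.
    rw [ENNReal.finsetSum_iSup fun l l' => ⟨fun j => if x j (l j) ≤ x j (l' j) then l' j else l j,
      fun j => by
        by_cases h : x j (l j) ≤ x j (l' j)
        · simp only [h, if_true]; exact ⟨ENNReal.ofReal_le_ofReal h, le_rfl⟩
        · simp only [h, if_false]; exact ⟨le_rfl, ENNReal.ofReal_le_ofReal (not_le.mp h).le⟩⟩]
    refine iSup_le fun l => ?_
    -- Truncation at $0$ is not additive; coordinates with negative value are reset to the dual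
    -- variable $0$, whose value is $0$.
    set l' : PiLp 2 fun _ : Fin m => F := WithLp.toLp 2 fun j => if x j (l j) ≤ 0 then 0 else l j with hl'
    have hx' : ∀ j, x j (l' j) = max (x j (l j)) 0 := by
      intro j
      by_cases h : x j (l j) ≤ 0
      · have : l' j = 0 := by simp [hl', h]
        rw [this, max_eq_right h]
        simp [hx, hΛ0]
      · have : l' j = l j := by simp [hl', h]
        rw [this, max_eq_left (not_le.mp h).le]
    have h1 : ∑ j, ENNReal.ofReal (x j (l j)) = ENNReal.ofReal (⟪l', u⟫ - avgFun Λ m l') := by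
      rw [inner_sub_avgFun Λ hm, ENNReal.ofReal_sum_of_nonneg fun j _ => by
        rw [show (m : ℝ)⁻¹ * (⟪l' j, (m : ℝ) • u j⟫ - Λ (l' j)) = x j (l' j) from rfl, hx']
        exact le_max_right _ _]
      refine Finset.sum_congr rfl fun j _ => ?_
      rw [show (m : ℝ)⁻¹ * (⟪l' j, (m : ℝ) • u j⟫ - Λ (l' j)) = x j (l' j) from rfl, hx',
        ENNReal.ofReal_max]
      simp
    rw [h1]
    exact ofReal_le_cost _ _ _

theorem differentiable_avgFun {Λ : F → ℝ} (hΛ : Differentiable ℝ Λ) (m : ℕ) :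
    Differentiable ℝ (avgFun Λ m) :=
  Differentiable.fun_sum fun j _ => (hΛ.comp
    (PiLp.proj (𝕜 := ℝ) 2 (fun _ : Fin m => F) j).differentiable).const_mul _

end SeparableCost

/-! ### Large deviations for products of block sums -/

section BlockLDP

variable {F : Type*} [NormedAddCommGroup F] [InnerProductSpace ℝ F] [FiniteDimensional ℝ F]
  [MeasurableSpace F] [BorelSpace F]

/-- The normalized block sums. -/
def blockSum (n m : ℕ) (x : ℕ → F) (j : ℕ) : F :=
  (n : ℝ)⁻¹ • ∑ k ∈ Finset.Ico (blk n m j) (blk n m (j + 1)), x k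

/-- The vector of normalized block sums. -/
def blockVec (n m : ℕ) (x : ℕ → F) : PiLp 2 fun _ : Fin m => F := WithLp.toLp 2 fun j => blockSum n m x j

theorem mul_inner_blockVec (n m : ℕ) (x : ℕ → F) (l : PiLp 2 fun _ : Fin m => F) :
    (n : ℝ) * ⟪l, blockVec n m x⟫ = ∑ j : Fin m, ∑ k ∈ Finset.Ico (blk n m j) (blk n m (j + 1)), ⟪l j, x k⟫ := by
  rw [PiLp.inner_apply, Finset.mul_sum]
  refine Finset.sum_congr rfl fun j _ => ?_
  rw [← inner_sum]
  simp only [blockVec, blockSum, real_inner_smul_right]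
  rcases Nat.eq_zero_or_pos n with rfl | hn
  · simp [blk]
  · have : (n : ℝ) ≠ 0 := by exact_mod_cast hn.ne'
    rw [← mul_assoc, mul_inv_cancel₀ this, one_mul]

variable {Ω : Type*} [MeasurableSpace Ω] {P : Measure Ω} [IsProbabilityMeasure P] {X : ℕ → Ω → F}

theorem integral_exp_inner_blockVec (hmeas : ∀ k, Measurable (X k)) (hindep : iIndepFun X P)
    (hident : ∀ k, IdentDistrib (X k) (X 0) P P)
    (hΛ : ∀ v : F, Integrable (fun ω => Real.exp ⟪v, X 0 ω⟫) P) {m : ℕ} (hm : 0 < m) (n : ℕ)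
    (l : PiLp 2 fun _ : Fin m => F) :
    ∫ ω, Real.exp (n * ⟪l, blockVec n m (fun k => X k ω)⟫) ∂P =
      Real.exp (n * ∑ j : Fin m, ((blk n m (j + 1) : ℝ) / n - (blk n m j : ℝ) / n) * logMGF P (X 0) (l j)) := by
  obtain ⟨g, hg⟩ := exists_block_index (blk_mono n m) m
  have hrange : Finset.range n = Finset.Ico (blk n m 0) (blk n m m) := by
    rw [blk_zero, blk_self hm, Finset.range_eq_Ico]
  have key : ∀ f : ℕ → F → ℝ, ∑ j : Fin m, ∑ k ∈ Finset.Ico (blk n m j) (blk n m (j + 1)), f k (l j) =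
      ∑ k ∈ Finset.range n, f k (coordSeq l (g k)) := by
    intro f
    rw [← sum_range_coordSeq l fun j v => ∑ k ∈ Finset.Ico (blk n m j) (blk n m (j + 1)), f k v,
      hrange, ← sum_Ico_blocks (blk_mono n m)]
    refine Finset.sum_congr rfl fun j hj => Finset.sum_congr rfl fun k hk => ?_
    rw [hg j (Finset.mem_range.mp hj) k hk]
  have h1 := fun ω => key fun k v => ⟪v, X k ω⟫
  simp only [mul_inner_blockVec, h1]
  rw [integral_exp_sum_inner hmeas hindep hident hΛ, ← key fun _ v => logMGF P (X 0) v, Finset.mul_sum]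
  congr 1
  refine Finset.sum_congr rfl fun j _ => ?_
  rw [Finset.sum_const, Nat.card_Ico, nsmul_eq_mul, Nat.cast_sub (blk_mono n m (Nat.le_succ _))]
  rcases Nat.eq_zero_or_pos n with rfl | hn
  · simp [blk]
  · have : (n : ℝ) ≠ 0 := by exact_mod_cast hn.ne'
    field_simp

theorem tendsto_block_logMGF {m : ℕ} (hm : 0 < m) (Λ : F → ℝ) (l : PiLp 2 fun _ : Fin m => F) :
    Tendsto (fun n : ℕ => ∑ j : Fin m, ((blk n m (j + 1) : ℝ) / n - (blk n m j : ℝ) / n) * Λ (l j))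
      atTop (𝓝 (avgFun Λ m l)) := by
  refine tendsto_finsetSum _ fun j _ => Tendsto.mul_const _ ?_
  have := (tendsto_blk_div hm (j + 1)).sub (tendsto_blk_div hm j)
  convert this using 2
  push_cast
  ring

theorem measurable_blockVec (hmeas : ∀ k, Measurable (X k)) (n m : ℕ) :
    Measurable fun ω => blockVec n m (fun k => X k ω) := by
  refine (WithLp.measurable_toLp 2 _).comp (measurable_pi_lambda _ fun j => ?_)
  exact (Finset.measurable_fun_sum _ fun k _ => hmeas k).const_smul _

variable {A : Type*} [NormedRing A] [NormedAlgebra ℝ A] [CompleteSpace A] {σ : F →L[ℝ] A} {N : ℕ}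

theorem continuous_expProd_coordSeq (σ : F →L[ℝ] A) (m k : ℕ) :
    Continuous fun u : PiLp 2 fun _ : Fin m => F => expProd (fun j => σ (coordSeq u j)) k := by
  induction k with
  | zero => exact continuous_const
  | succ k ih =>
    refine ih.mul (continuous_exp_real.comp (σ.continuous.comp ?_))
    by_cases h : k < m
    · simp only [coordSeq, h, dif_pos]
      fun_prop
    · simp only [coordSeq, h, dif_neg, not_false_eq_true]
      exact continuous_const

theorem expProd_congr {a b : ℕ → A} {n : ℕ} (h : ∀ j < n, a j = b j) : expProd a n = expProd b n := by
  induction n with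
  | zero => rfl
  | succ n ih => rw [expProd, expProd, ih fun j hj => h j (hj.trans n.lt_succ_self), h n n.lt_succ_self]

theorem expProd_blockVec (σ : F →L[ℝ] A) (n m : ℕ) (x : ℕ → F) :
    expProd (fun j => σ (coordSeq (blockVec n m x) j)) m = expProd (fun j => σ (blockSum n m x j)) m :=
  expProd_congr fun j hj => by simp [coordSeq, hj, blockVec]

theorem eventually_le_measureReal_expProd_blockSum (hmeas : ∀ k, Measurable (X k)) (hindep : iIndepFun X P)
    (hident : ∀ k, IdentDistrib (X k) (X 0) P P)
    (hΛ : ∀ v : F, Integrable (fun ω => Real.exp ⟪v, X 0 ω⟫) P) {m : ℕ} (hm : 0 < m)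
    {O : Set A} (hO : IsOpen O) {a : ℕ → F} (ha : expProd (fun j => σ ((m : ℝ)⁻¹ • a j)) m ∈ O) {b : ℝ}
    (hb : ∑ j ∈ Finset.range m, ENNReal.ofReal ((m : ℝ)⁻¹) * cost (logMGF P (X 0)) (a j) < ENNReal.ofReal b) :
    ∀ᶠ n : ℕ in atTop, Real.exp (-(n * b)) ≤
      P.real {ω | expProd (fun j => σ (blockSum n m (fun k => X k ω) j)) m ∈ O} := by
  have hm' : (m : ℝ) ≠ 0 := by exact_mod_cast hm.ne'
  set u : PiLp 2 fun _ : Fin m => F := WithLp.toLp 2 fun j => (m : ℝ)⁻¹ • a j with hu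
  have hcost : cost (avgFun (logMGF P (X 0)) m) u < ENNReal.ofReal b := by
    rw [cost_avgFun _ logMGF_zero hm]
    refine lt_of_eq_of_lt ?_ hb
    rw [Finset.sum_range]
    refine Finset.sum_congr rfl fun j _ => ?_
    simp only [hu, smul_smul, mul_inv_cancel₀ hm', one_smul]
  have huO : u ∈ (fun u : PiLp 2 fun _ : Fin m => F => expProd (fun j => σ (coordSeq u j)) m) ⁻¹' O := by
    rw [mem_preimage]
    convert ha using 1
    exact expProd_congr fun j hj => by simp [coordSeq, hj, hu]
  have := eventually_le_measureReal_open (P := P) (fun n => measurable_blockVec hmeas n m)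
    (integral_exp_inner_blockVec hmeas hindep hident hΛ hm) (tendsto_block_logMGF hm _)
    (differentiable_avgFun (differentiable_logMGF (hmeas 0) hΛ) m) (by simp [avgFun, logMGF_zero])
    (hO.preimage (continuous_expProd_coordSeq σ m m)) huO hcost
  simpa only [mem_preimage, expProd_blockVec] using this

/-- A vector whose product of exponentials lies in $C$ defines a step control steering the flow into
$C$, so its cost is at least the rate there. -/
theorem eventually_measureReal_expProd_blockSum_le [NormOneClass A] (hmeas : ∀ k, Measurable (X k)) (hindep : iIndepFun X P)
    (hident : ∀ k, IdentDistrib (X k) (X 0) P P)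
    (hΛ : ∀ v : F, Integrable (fun ω => Real.exp ⟪v, X 0 ω⟫) P)
    (hσ : ∀ v : Fin N → F, (List.ofFn fun i => σ (v i)).prod = 0) {m : ℕ} (hm : 0 < m)
    {C : Set A} (hC : IsClosed C) {b b' : ℝ}
    (hb : ∀ M ∈ C, ENNReal.ofReal b ≤ ctlRate (logMGF P (X 0)) N σ M) (hbb : b' < b) :
    ∀ᶠ n : ℕ in atTop, P.real {ω | expProd (fun j => σ (blockSum n m (fun k => X k ω) j)) m ∈ C} ≤
      Real.exp (-(n * b')) := by
  have hm' : (m : ℝ) ≠ 0 := by exact_mod_cast hm.ne'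
  have := eventually_measureReal_closed_le (P := P) (fun n => measurable_blockVec hmeas n m)
    (integral_exp_inner_blockVec hmeas hindep hident hΛ hm) (tendsto_block_logMGF hm _)
    (hC.preimage (continuous_expProd_coordSeq σ m m)) (b := b) (b' := b') (fun u hu => by
      rw [cost_avgFun _ logMGF_zero hm]
      refine (hb _ hu).trans ?_
      have h1 := ctlRate_expProd_le (Λ := logMGF P (X 0)) hσ hm (fun j => (m : ℝ) • coordSeq u j)
      simp only [smul_smul, inv_mul_cancel₀ hm', one_smul] at h1
      rwa [sum_range_coordSeq u fun _ v => ENNReal.ofReal ((m : ℝ)⁻¹) *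
        cost (logMGF P (X 0)) ((m : ℝ) • v)] at h1) hbb
  simpa only [mem_preimage, expProd_blockVec] using this

end BlockLDP

/-! ### Products of exponentials and exponentials of block sums -/

section ExpEstimates

variable {A : Type*} [NormedRing A] [NormedAlgebra ℝ A] [NormOneClass A] [CompleteSpace A]

theorem norm_exp_le_real (x : A) : ‖NormedSpace.exp x‖ ≤ Real.exp ‖x‖ := by
  rw [NormedSpace.exp_eq_tsum ℝ, Real.exp_eq_exp_ℝ]
  refine tsum_of_norm_bounded (NormedSpace.expSeries_div_hasSum_exp ‖x‖) fun n => ?_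
  rw [norm_smul, norm_inv, Real.norm_of_nonneg (Nat.cast_nonneg _), inv_mul_eq_div]
  gcongr
  exact norm_pow_le x n

theorem norm_exp_sub_one_le_real (x : A) : ‖NormedSpace.exp x - 1‖ ≤ ‖x‖ * Real.exp ‖x‖ := by
  have h := norm_image_sub_le_of_norm_deriv_le_segment_01' (f := fun t : ℝ => NormedSpace.exp (t • x))
    (f' := fun t => NormedSpace.exp (t • x) * x) (C := ‖x‖ * Real.exp ‖x‖)
    (fun t _ => (hasDerivAt_exp_smul_const (𝕂 := ℝ) x t).hasDerivWithinAt) fun t ht => by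
      rw [mul_comm ‖x‖]
      refine (norm_mul_le _ _).trans (mul_le_mul_of_nonneg_right ?_ (norm_nonneg x))
      refine (norm_exp_le_real _).trans (Real.exp_le_exp.mpr ?_)
      rw [norm_smul, Real.norm_of_nonneg ht.1]
      exact mul_le_of_le_one_left (norm_nonneg x) ht.2.le
  simpa using h

theorem norm_exp_sub_one_sub_le_real (x : A) : ‖NormedSpace.exp x - 1 - x‖ ≤ ‖x‖ ^ 2 * Real.exp ‖x‖ := by
  have h := norm_image_sub_le_of_norm_deriv_le_segment_01'
    (f := fun t : ℝ => NormedSpace.exp (t • x) - t • x)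
    (f' := fun t => NormedSpace.exp (t • x) * x - (1 : ℝ) • x) (C := ‖x‖ ^ 2 * Real.exp ‖x‖)
    (fun t _ => ((hasDerivAt_exp_smul_const (𝕂 := ℝ) x t).sub
      ((hasDerivAt_id t).smul_const x)).hasDerivWithinAt) fun t ht => by
      have h1 : NormedSpace.exp (t • x) * x - (1 : ℝ) • x = (NormedSpace.exp (t • x) - 1) * x := by
        rw [one_smul, sub_mul, one_mul]
      have h2 : ‖t • x‖ ≤ ‖x‖ := by
        rw [norm_smul, Real.norm_of_nonneg ht.1]
        exact mul_le_of_le_one_left (norm_nonneg x) ht.2.le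
      rw [h1]
      calc ‖(NormedSpace.exp (t • x) - 1) * x‖ ≤ (‖t • x‖ * Real.exp ‖t • x‖) * ‖x‖ :=
            (norm_mul_le _ _).trans (mul_le_mul_of_nonneg_right (norm_exp_sub_one_le_real _) (norm_nonneg x))
        _ ≤ (‖x‖ * Real.exp ‖x‖) * ‖x‖ := by gcongr
        _ = _ := by ring
  have e : NormedSpace.exp ((1 : ℝ) • x) - (1 : ℝ) • x - (NormedSpace.exp ((0 : ℝ) • x) - (0 : ℝ) • x) =
      NormedSpace.exp x - 1 - x := by simp; abel
  rwa [e] at h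

variable {y : ℕ → A} {η : ℝ}

theorem norm_expProd_le (hy : ∀ k, ‖y k‖ ≤ η) (n : ℕ) : ‖expProd y n‖ ≤ Real.exp (n * η) := by
  induction n with
  | zero => simp [expProd]
  | succ n ih =>
    calc ‖expProd y n * NormedSpace.exp (y n)‖ ≤ Real.exp (n * η) * Real.exp η :=
          (norm_mul_le _ _).trans (mul_le_mul ih ((norm_exp_le_real _).trans
            (Real.exp_le_exp.mpr (hy n))) (norm_nonneg _) (Real.exp_pos _).le)
      _ = Real.exp ((n + 1 : ℕ) * η) := by rw [← Real.exp_add]; congr 1; push_cast; ring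

theorem norm_sum_range_le (hy : ∀ k, ‖y k‖ ≤ η) (n : ℕ) : ‖∑ k ∈ Finset.range n, y k‖ ≤ n * η := by
  refine (norm_sum_le_of_le _ fun k _ => hy k).trans ?_
  simp

/-- To first order a product of exponentials is $1$ plus the sum of the exponents. The new errors
$\eta^2+n\eta^2$ at each step fit into the increment $(2n+1)\eta^2$ of $(n\eta)^2$. -/
theorem norm_expProd_sub_one_sub_le (hη : 0 ≤ η) (hy : ∀ k, ‖y k‖ ≤ η) (n : ℕ) :
    ‖expProd y n - 1 - ∑ k ∈ Finset.range n, y k‖ ≤ (n * η) ^ 2 * Real.exp (n * η) := by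
  induction n with
  | zero => simp [expProd]
  | succ n ih =>
    set S := ∑ k ∈ Finset.range n, y k with hS
    have e : expProd y (n + 1) - 1 - ∑ k ∈ Finset.range (n + 1), y k =
        (expProd y n - 1 - S) * NormedSpace.exp (y n) + (NormedSpace.exp (y n) - 1 - y n) +
          S * (NormedSpace.exp (y n) - 1) := by
      rw [expProd, Finset.sum_range_succ, ← hS]
      noncomm_ring
    have hexp : Real.exp ‖y n‖ ≤ Real.exp η := Real.exp_le_exp.mpr (hy n)
    have h1 : ‖(expProd y n - 1 - S) * NormedSpace.exp (y n)‖ ≤ ((n * η) ^ 2 * Real.exp (n * η)) * Real.exp η :=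
      (norm_mul_le _ _).trans (mul_le_mul ih ((norm_exp_le_real _).trans hexp) (norm_nonneg _) (by positivity))
    have h2 : ‖NormedSpace.exp (y n) - 1 - y n‖ ≤ η ^ 2 * Real.exp η :=
      (norm_exp_sub_one_sub_le_real _).trans (by gcongr; exact hy n)
    have h3 : ‖S * (NormedSpace.exp (y n) - 1)‖ ≤ (n * η) * (η * Real.exp η) :=
      (norm_mul_le _ _).trans (mul_le_mul (norm_sum_range_le hy n)
        ((norm_exp_sub_one_le_real _).trans (by gcongr; exact hy n)) (norm_nonneg _) (by positivity))
    have hE : 1 ≤ Real.exp (n * η) := Real.one_le_exp (by positivity)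
    rw [e]
    refine (norm_add₃_le).trans ?_
    have e2 : Real.exp (((n + 1 : ℕ) : ℝ) * η) = Real.exp (n * η) * Real.exp η := by
      rw [← Real.exp_add]; congr 1; push_cast; ring
    rw [e2]
    push_cast
    have hpos : 0 < Real.exp η := Real.exp_pos η
    have h4 : (η ^ 2 + n * η * η) * Real.exp η ≤ (η ^ 2 + n * η * η) * Real.exp η * Real.exp (n * η) :=
      le_mul_of_one_le_right (by positivity) hE
    have h5 : 0 ≤ n * η * η * Real.exp η * Real.exp (n * η) := by positivity
    nlinarith

theorem expProd_add (y : ℕ → A) (p q : ℕ) :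
    expProd y (p + q) = expProd y p * expProd (fun k => y (p + k)) q := by
  induction q with
  | zero => simp [expProd]
  | succ q ih => rw [← add_assoc, expProd, ih, expProd, mul_assoc]

/-- Blocks are replaced one at a time. Within a block the product and the exponential of the sum
agree to first order, so each replacement costs the square of the block length. -/
theorem norm_expProd_sub_expProd_blocks_le (hη : 0 ≤ η) (hy : ∀ k, ‖y k‖ ≤ η) {b : ℕ → ℕ} (hb : Monotone b)
    (hb0 : b 0 = 0) (m : ℕ) :
    ‖expProd y (b m) - expProd (fun j => ∑ k ∈ Finset.Ico (b j) (b (j + 1)), y k) m‖ ≤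
      Real.exp (b m * η) * ∑ j ∈ Finset.range m, 2 * (((b (j + 1) : ℝ) - b j) * η) ^ 2 := by
  induction m with
  | zero => simp [hb0, expProd]
  | succ m ih =>
    set Y : ℕ → A := fun j => ∑ k ∈ Finset.Ico (b j) (b (j + 1)), y k with hY
    obtain ⟨q, hq⟩ := Nat.exists_eq_add_of_le (hb m.le_succ)
    have hqc : ((b (m + 1) : ℝ) - b m) = q := by rw [hq]; push_cast; ring
    have hYm : Y m = ∑ k ∈ Finset.range q, y (b m + k) := by
      simp only [hY]
      rw [Finset.sum_Ico_eq_sum_range, hq, Nat.add_sub_cancel_left]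
    have hy' : ∀ k, ‖y (b m + k)‖ ≤ η := fun k => hy _
    have hYn : ‖Y m‖ ≤ q * η := by rw [hYm]; exact norm_sum_range_le hy' q
    have hYe : Real.exp ‖Y m‖ ≤ Real.exp (q * η) := Real.exp_le_exp.mpr hYn
    set Q := expProd (fun k => y (b m + k)) q with hQ
    have h1 : ‖Q - NormedSpace.exp (Y m)‖ ≤ 2 * (q * η) ^ 2 * Real.exp (q * η) := by
      have e : Q - NormedSpace.exp (Y m) = (Q - 1 - Y m) - (NormedSpace.exp (Y m) - 1 - Y m) := by abel
      rw [e]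
      refine (norm_sub_le _ _).trans ?_
      have h2 : ‖Q - 1 - Y m‖ ≤ (q * η) ^ 2 * Real.exp (q * η) := by
        rw [hYm]; exact norm_expProd_sub_one_sub_le hη hy' q
      have h3 : ‖NormedSpace.exp (Y m) - 1 - Y m‖ ≤ (q * η) ^ 2 * Real.exp (q * η) :=
        (norm_exp_sub_one_sub_le_real _).trans (by gcongr)
      linarith
    have e : expProd y (b (m + 1)) - expProd Y (m + 1) = expProd y (b m) * (Q - NormedSpace.exp (Y m)) +
        (expProd y (b m) - expProd Y m) * NormedSpace.exp (Y m) := by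
      rw [hq, expProd_add, expProd]
      noncomm_ring
    have e2 : Real.exp (b (m + 1) * η) = Real.exp (b m * η) * Real.exp (q * η) := by
      rw [← Real.exp_add, hq]; congr 1; push_cast; ring
    rw [e, e2, Finset.sum_range_succ, hqc]
    refine (norm_add_le _ _).trans ?_
    have h4 := (norm_mul_le (expProd y (b m)) (Q - NormedSpace.exp (Y m))).trans
      (mul_le_mul (norm_expProd_le hy (b m)) h1 (norm_nonneg _) (Real.exp_pos _).le)
    have h5 := (norm_mul_le (expProd y (b m) - expProd Y m) (NormedSpace.exp (Y m))).trans
      (mul_le_mul ih ((norm_exp_le_real _).trans hYe) (norm_nonneg _)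
        (mul_nonneg (Real.exp_pos _).le (Finset.sum_nonneg fun _ _ => by positivity)))
    refine (add_le_add h4 h5).trans (le_of_eq ?_)
    ring

end ExpEstimates

/-! ### Bounded increments: a deterministic error bound -/

section Bounded

variable {F : Type*} [NormedAddCommGroup F] [InnerProductSpace ℝ F]
  {A : Type*} [NormedRing A] [NormedAlgebra ℝ A] [NormOneClass A] [CompleteSpace A]

/-- The lengths add up to $n$, and each is at most $n/m+1\le2n/m$. -/
theorem sum_sq_blk_le {m n : ℕ} (hm : 0 < m) (hmn : m ≤ n) :
    ∑ j ∈ Finset.range m, ((blk n m (j + 1) : ℝ) - blk n m j) ^ 2 ≤ 2 * (n : ℝ) ^ 2 / m := by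
  have hm' : (0 : ℝ) < m := by exact_mod_cast hm
  have hmn' : (m : ℝ) ≤ n := by exact_mod_cast hmn
  have hlen : ∀ j, (blk n m (j + 1) : ℝ) - blk n m j ≤ 2 * n / m := by
    intro j
    have h1 : (blk n m (j + 1) : ℝ) ≤ blk n m j + (n / m : ℕ) + 1 := by exact_mod_cast blk_succ_le n m j
    have h2 : ((n / m : ℕ) : ℝ) ≤ n / m := Nat.cast_div_le
    have h3 : (1 : ℝ) ≤ n / m := by rwa [le_div_iff₀ hm', one_mul]
    have : 2 * (n : ℝ) / m = n / m + n / m := by ring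
    linarith
  have hnn : ∀ j, (0 : ℝ) ≤ (blk n m (j + 1) : ℝ) - blk n m j := fun j =>
    sub_nonneg.mpr (by exact_mod_cast blk_mono n m j.le_succ)
  calc ∑ j ∈ Finset.range m, ((blk n m (j + 1) : ℝ) - blk n m j) ^ 2
      ≤ ∑ j ∈ Finset.range m, 2 * n / m * ((blk n m (j + 1) : ℝ) - blk n m j) := by
        refine Finset.sum_le_sum fun j _ => ?_
        rw [sq]
        exact mul_le_mul_of_nonneg_right (hlen j) (hnn j)
    _ = 2 * (n : ℝ) ^ 2 / m := by
        rw [← Finset.mul_sum, Finset.sum_range_sub (fun j => (blk n m j : ℝ)), blk_self hm, blk_zero]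
        push_cast
        ring

theorem sigma_blockSum (σ : F →L[ℝ] A) (n m : ℕ) (x : ℕ → F) (j : ℕ) :
    σ (blockSum n m x j) = ∑ k ∈ Finset.Ico (blk n m j) (blk n m (j + 1)), σ ((n : ℝ)⁻¹ • x k) := by
  simp only [blockSum, map_smul, map_sum, Finset.smul_sum]

theorem norm_expProd_sub_expProd_blockSum_le (σ : F →L[ℝ] A) {x : ℕ → F} {R : ℝ}
    (hx : ∀ k, ‖x k‖ ≤ R) {n m : ℕ} (hm : 0 < m) (hmn : m ≤ n) :
    ‖expProd (fun k => σ ((n : ℝ)⁻¹ • x k)) n - expProd (fun j => σ (blockSum n m x j)) m‖ ≤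
      Real.exp (‖σ‖ * R) * (4 * (‖σ‖ * R) ^ 2) / m := by
  have hn' : (0 : ℝ) < n := by exact_mod_cast hm.trans_le hmn
  have hR : 0 ≤ R := (norm_nonneg _).trans (hx 0)
  have hy : ∀ k, ‖σ ((n : ℝ)⁻¹ • x k)‖ ≤ ‖σ‖ * R / n := fun k => by
    refine (σ.le_opNorm _).trans ?_
    rw [norm_smul, norm_inv, Real.norm_of_nonneg hn'.le, mul_div_assoc, div_eq_inv_mul]
    gcongr
    exact hx k
  have h := norm_expProd_sub_expProd_blocks_le (by positivity) hy (blk_mono n m) (blk_zero n m) m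
  rw [blk_self hm] at h
  simp only [sigma_blockSum]
  refine h.trans ?_
  have e1 : (n : ℝ) * (‖σ‖ * R / n) = ‖σ‖ * R := by field_simp
  have e2 : ∑ j ∈ Finset.range m, 2 * (((blk n m (j + 1) : ℝ) - blk n m j) * (‖σ‖ * R / n)) ^ 2 =
      2 * (‖σ‖ * R / n) ^ 2 * ∑ j ∈ Finset.range m, ((blk n m (j + 1) : ℝ) - blk n m j) ^ 2 := by
    rw [Finset.mul_sum]
    exact Finset.sum_congr rfl fun j _ => by ring
  rw [e1, e2, mul_div_assoc (Real.exp _)]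
  refine mul_le_mul_of_nonneg_left ?_ (Real.exp_pos _).le
  calc 2 * (‖σ‖ * R / n) ^ 2 * ∑ j ∈ Finset.range m, ((blk n m (j + 1) : ℝ) - blk n m j) ^ 2
      ≤ 2 * (‖σ‖ * R / n) ^ 2 * (2 * (n : ℝ) ^ 2 / m) := by
        gcongr
        exact sum_sq_blk_le hm hmn
    _ = 4 * (‖σ‖ * R) ^ 2 / m := by field_simp; ring

variable {Ω : Type*} [MeasurableSpace Ω] {P : Measure Ω} [IsProbabilityMeasure P] {X : ℕ → Ω → F}

theorem exists_eventually_measureReal_dist_le_of_bounded (σ : F →L[ℝ] A) {R : ℝ}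
    (hX : ∀ k, ∀ᵐ ω ∂P, ‖X k ω‖ ≤ R) {δ : ℝ} (hδ : 0 < δ) (K : ℝ) :
    ∀ᶠ m : ℕ in atTop, ∀ᶠ n : ℕ in atTop, P.real {ω | δ < dist
      (expProd (fun k => σ ((n : ℝ)⁻¹ • X k ω)) n)
      (expProd (fun j => σ (blockSum n m (fun k => X k ω) j)) m)} ≤ Real.exp (-(n * K)) := by
  have hlim := tendsto_const_div_atTop_nhds_zero_nat (Real.exp (‖σ‖ * R) * (4 * (‖σ‖ * R) ^ 2))
  filter_upwards [hlim.eventually_le_const hδ, eventually_gt_atTop 0] with m hm hm0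
  filter_upwards [eventually_ge_atTop m] with n hn
  have h0 : P.real {ω | δ < dist (expProd (fun k => σ ((n : ℝ)⁻¹ • X k ω)) n)
      (expProd (fun j => σ (blockSum n m (fun k => X k ω) j)) m)} = 0 := by
    rw [measureReal_eq_zero_iff]
    refine measure_mono_null (fun ω hω => ?_) (ae_iff.mp (ae_all_iff.mpr hX))
    intro hcon
    have h1 := norm_expProd_sub_expProd_blockSum_le σ hcon hm0 hn
    rw [← dist_eq_norm] at h1
    exact absurd (h1.trans hm) (not_le.mpr hω)
  rw [h0]
  exact (Real.exp_pos _).le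

end Bounded

/-! ### Products of exponentials when triple products vanish -/

section StepTwo

/-- The product depends only on the sum and on the discrete Lévy area, the antisymmetric
second-order part. -/
theorem expProd_eq_of_prod_three {A : Type*} [NormedRing A] [NormedAlgebra ℝ A] {y : ℕ → A}
    (hy : ∀ i j k, y i * y j * y k = 0) (n : ℕ) :
    expProd y n = 1 + ∑ k ∈ Finset.range n, y k + (2⁻¹ : ℝ) • (∑ k ∈ Finset.range n, y k) ^ 2 +
      (2⁻¹ : ℝ) • ∑ k ∈ Finset.range n,
        ((∑ i ∈ Finset.range k, y i) * y k - y k * ∑ i ∈ Finset.range k, y i) := by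
  have h3 : ∀ (s t : Finset ℕ) (k : ℕ), (∑ i ∈ s, y i) * (∑ j ∈ t, y j) * y k = 0 := fun s t k => by
    rw [Finset.sum_mul_sum, Finset.sum_mul]
    refine Finset.sum_eq_zero fun i _ => ?_
    rw [Finset.sum_mul]
    exact Finset.sum_eq_zero fun j _ => hy i j k
  induction n with
  | zero => simp [expProd]
  | succ n ih =>
    set S := ∑ k ∈ Finset.range n, y k with hS
    set B := ∑ k ∈ Finset.range n, ((∑ i ∈ Finset.range k, y i) * y k - y k * ∑ i ∈ Finset.range k, y i)
      with hB
    have hexp : NormedSpace.exp (y n) = 1 + y n + (2⁻¹ : ℝ) • y n ^ 2 := by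
      rw [exp_eq_sum_of_pow_eq_zero (a := y n) (K := 3) (by rw [pow_succ, sq]; exact hy n n n)]
      simp [Finset.sum_range_succ, Nat.factorial]
    have hSS : S * S * y n = 0 := h3 _ _ n
    have hyy : y n * y n * y n = 0 := hy n n n
    have hSy : S * y n * y n = 0 := by
      rw [hS, Finset.sum_mul, Finset.sum_mul]
      exact Finset.sum_eq_zero fun i _ => hy i n n
    have hBy : B * y n = 0 := by
      rw [hB, Finset.sum_mul]
      refine Finset.sum_eq_zero fun k _ => ?_
      rw [sub_mul, Finset.sum_mul, Finset.sum_mul, Finset.mul_sum, Finset.sum_mul,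
        Finset.sum_eq_zero fun i _ => hy i k n, Finset.sum_eq_zero fun i _ => hy k i n, sub_zero]
    rw [expProd, ih, hexp, Finset.sum_range_succ, Finset.sum_range_succ, ← hS, ← hB]
    simp only [mul_add, add_mul, sq, mul_smul_comm, smul_mul_assoc, one_mul, mul_one, ← mul_assoc, hSS, hSy,
      hBy, smul_zero, zero_mul, smul_add, smul_sub]
    module

end StepTwo

/-! ### An exponential supermartingale -/

section Supermartingale

variable {F : Type*} [NormedAddCommGroup F] [InnerProductSpace ℝ F] [FiniteDimensional ℝ F]
  [MeasurableSpace F] [BorelSpace F]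
  {Ω : Type*} [MeasurableSpace Ω] {P : Measure Ω} [IsProbabilityMeasure P] {X : ℕ → Ω → F}

/-- The coefficient of $X_n$ depends only on earlier increments. By independence and Fubini, $X_n$
is integrated first with that coefficient fixed, and the sub-Gaussian bound is cancelled by the
compensator $\kappa|G_n|^2$. -/
theorem lintegral_exp_predictable_le_one (hmeas : ∀ k, Measurable (X k)) (hindep : iIndepFun X P) {κ : ℝ}
    (hsub : ∀ k v, ∫⁻ ω, ENNReal.ofReal (Real.exp ⟪v, X k ω⟫) ∂P ≤ ENNReal.ofReal (Real.exp (κ * ‖v‖ ^ 2)))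
    {G : ℕ → (ℕ → F) → F} (hG : ∀ k, Measurable (G k))
    (hGp : ∀ k x x', (∀ i < k, x i = x' i) → G k x = G k x') (n : ℕ) :
    ∫⁻ ω, ENNReal.ofReal (Real.exp (∑ k ∈ Finset.range n, (⟪G k (fun i => X i ω), X k ω⟫ -
      κ * ‖G k (fun i => X i ω)‖ ^ 2))) ∂P ≤ 1 := by
  induction n with
  | zero => simp
  | succ n ih =>
    set φ : (ℕ → F) → ℝ≥0∞ := fun x => ENNReal.ofReal (Real.exp (∑ k ∈ Finset.range n, (⟪G k x, x k⟫ -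
      κ * ‖G k x‖ ^ 2))) with hφ
    set S := Finset.range n
    set H : Ω → S → F := fun ω i => X i ω with hH
    -- Fills the future with zeros; predictability makes the filling irrelevant and exhibits all
    -- earlier factors as functions of the past.
    set e : (S → F) → ℕ → F := fun h k => if hk : k ∈ S then h ⟨k, hk⟩ else 0 with he
    have hem : Measurable e := by
      refine measurable_pi_lambda _ fun k => ?_
      by_cases hk : k ∈ S
      · simp only [he, hk, dif_pos]; exact measurable_pi_apply _
      · simp only [he, hk, dif_neg, not_false_eq_true]; exact measurable_const
    have hHm : Measurable H := measurable_pi_lambda _ fun i => hmeas i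
    have hφm : Measurable φ := by
      refine ENNReal.measurable_ofReal.comp (Real.measurable_exp.comp (Finset.measurable_fun_sum _ fun k _ => ?_))
      exact ((hG k).inner (measurable_pi_apply k)).sub (((hG k).norm.pow_const 2).const_mul κ)
    have hag : ∀ ω, ∀ i < n, X i ω = e (H ω) i := fun ω i hi => by
      have hiS : i ∈ S := Finset.mem_range.mpr hi
      simp only [he, hH, hiS, dif_pos]
    have hφe : ∀ ω, φ (fun i => X i ω) = φ (e (H ω)) := fun ω => by
      simp only [hφ]
      congr 2
      refine Finset.sum_congr rfl fun k hk => ?_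
      rw [Finset.mem_range] at hk
      rw [hGp k _ (e (H ω)) fun i hi => hag ω i (hi.trans hk), hag ω k hk]
    set ψ : (S → F) × F → ℝ≥0∞ := fun p => φ (e p.1) *
      ENNReal.ofReal (Real.exp (⟪G n (e p.1), p.2⟫ - κ * ‖G n (e p.1)‖ ^ 2)) with hψ
    have hGe : Measurable fun p : (S → F) × F => G n (e p.1) := (hG n).comp (hem.comp measurable_fst)
    have hψm : Measurable ψ := (hφm.comp (hem.comp measurable_fst)).mul
      (ENNReal.measurable_ofReal.comp (Real.measurable_exp.comp
        ((hGe.inner measurable_snd).sub ((hGe.norm.pow_const 2).const_mul κ))))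
    have hind : IndepFun H (X n) P := by
      have := hindep.indepFun_finset S {n} (by simp [S]) hmeas
      exact this.comp measurable_id
        (measurable_pi_apply (⟨n, Finset.mem_singleton_self n⟩ : ({n} : Finset ℕ)))
    have hmap := (indepFun_iff_map_prod_eq_prod_map_map hHm.aemeasurable (hmeas n).aemeasurable).mp hind
    have h1 : ∀ ω, ENNReal.ofReal (Real.exp (∑ k ∈ Finset.range (n + 1), (⟪G k (fun i => X i ω), X k ω⟫ -
        κ * ‖G k (fun i => X i ω)‖ ^ 2))) = ψ (H ω, X n ω) := fun ω => by
      rw [Finset.sum_range_succ, Real.exp_add, ENNReal.ofReal_mul (Real.exp_pos _).le]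
      simp only [hψ]
      rw [← hφe, hGp n _ (e (H ω)) (hag ω)]
    have : IsProbabilityMeasure (P.map (X n)) := Measure.isProbabilityMeasure_map (hmeas n).aemeasurable
    calc _ = ∫⁻ ω, ψ (H ω, X n ω) ∂P := lintegral_congr h1
      _ = ∫⁻ p, ψ p ∂(P.map fun ω => (H ω, X n ω)) := (lintegral_map hψm (hHm.prodMk (hmeas n))).symm
      _ = ∫⁻ h, ∫⁻ z, ψ (h, z) ∂(P.map (X n)) ∂(P.map H) := by
          rw [hmap, lintegral_prod _ hψm.aemeasurable]
      _ ≤ ∫⁻ h, φ (e h) ∂(P.map H) := by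
          refine lintegral_mono fun h => ?_
          simp only [hψ]
          rw [lintegral_const_mul _ (by fun_prop), lintegral_map (by fun_prop) (hmeas n)]
          refine mul_le_of_le_one_right zero_le ?_
          have h2 : ∀ ω, ENNReal.ofReal (Real.exp (⟪G n (e h), X n ω⟫ - κ * ‖G n (e h)‖ ^ 2)) =
              ENNReal.ofReal (Real.exp (-(κ * ‖G n (e h)‖ ^ 2))) *
                ENNReal.ofReal (Real.exp ⟪G n (e h), X n ω⟫) := fun ω => by
            rw [← ENNReal.ofReal_mul (Real.exp_pos _).le, ← Real.exp_add]
            congr 2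
            ring
          simp only [h2]
          rw [lintegral_const_mul' _ _ ENNReal.ofReal_ne_top]
          refine (mul_le_mul' le_rfl (hsub n (G n (e h)))).trans ?_
          rw [← ENNReal.ofReal_mul (Real.exp_pos _).le, ← Real.exp_add]
          simp
      _ = ∫⁻ ω, φ (e (H ω)) ∂P := lintegral_map (hφm.comp hem) hHm
      _ = ∫⁻ ω, φ (fun i => X i ω) ∂P := lintegral_congr fun ω => (hφe ω).symm
      _ ≤ 1 := ih

variable {κ : ℝ}

theorem lintegral_exp_inner_le (hident : ∀ k, IdentDistrib (X k) (X 0) P P)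
    (hΛ : ∀ v : F, Integrable (fun ω => Real.exp ⟪v, X 0 ω⟫) P)
    (hle : ∀ v, logMGF P (X 0) v ≤ κ * ‖v‖ ^ 2) (k : ℕ) (v : F) :
    ∫⁻ ω, ENNReal.ofReal (Real.exp ⟪v, X k ω⟫) ∂P ≤ ENNReal.ofReal (Real.exp (κ * ‖v‖ ^ 2)) := by
  have hid := (hident k).comp (u := fun x => ENNReal.ofReal (Real.exp ⟪v, x⟫)) (by fun_prop)
  have h1 := hid.lintegral_eq
  simp only [Function.comp_def] at h1
  rw [h1, ← ofReal_integral_eq_lintegral_ofReal (hΛ v)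
    (Eventually.of_forall fun _ => (Real.exp_pos _).le), ← exp_logMGF hΛ]
  exact ENNReal.ofReal_le_ofReal (Real.exp_le_exp.mpr (hle v))

theorem measureReal_inner_sum_ge_le (hmeas : ∀ k, Measurable (X k)) (hindep : iIndepFun X P)
    (hident : ∀ k, IdentDistrib (X k) (X 0) P P)
    (hΛ : ∀ v : F, Integrable (fun ω => Real.exp ⟪v, X 0 ω⟫) P) (hκ : 0 < κ)
    (hle : ∀ v, logMGF P (X 0) v ≤ κ * ‖v‖ ^ 2) {v : F} (hv : ‖v‖ ≤ 1) (s : Finset ℕ) (c : ℝ) {t : ℝ}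
    (ht : 0 ≤ t) : P.real {ω | c ≤ ⟪v, ∑ k ∈ s, X k ω⟫} ≤ Real.exp (-t * c + s.card * (κ * t ^ 2)) := by
  have h1 : ∀ ω, t * ⟪v, ∑ k ∈ s, X k ω⟫ = ∑ k ∈ s, ⟪t • v, X k ω⟫ := fun ω => by
    rw [inner_sum, Finset.mul_sum]
    simp only [real_inner_smul_left]
  have h2 := integral_exp_sum_inner hmeas hindep hident hΛ (fun _ => t • v) s
  have h3 : mgf (fun ω => ⟪v, ∑ k ∈ s, X k ω⟫) P t = Real.exp (∑ _k ∈ s, logMGF P (X 0) (t • v)) := by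
    rw [mgf, ← h2]
    simp only [h1]
  refine (measure_ge_le_exp_mul_mgf c ht (integrable_of_integral_eq_exp h3)).trans ?_
  rw [h3, ← Real.exp_add]
  refine Real.exp_le_exp.mpr ?_
  rw [Finset.sum_const, nsmul_eq_mul]
  gcongr
  refine (hle _).trans ?_
  rw [norm_smul, mul_pow, Real.norm_eq_abs, sq_abs]
  have : ‖v‖ ^ 2 ≤ 1 := pow_le_one₀ (norm_nonneg v) hv
  nlinarith [mul_nonneg hκ.le (sq_nonneg t)]

/-- A partial block sum has at most $2n/m$ terms, so for large $m$ it exceeds $\eta n$ only with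
tiny probability. Otherwise the coefficients $(K'/n)\varphi(w_k)$ are small enough for each
compensator to be at most $1$; a large quadratic form then forces a large exponential
supermartingale, and Markov's inequality applies. The starts $s$ come last among the quantifiers, as
they depend on $n$ and $m$. -/
theorem eventually_measureReal_bilinear_le (hmeas : ∀ k, Measurable (X k)) (hindep : iIndepFun X P)
    (hident : ∀ k, IdentDistrib (X k) (X 0) P P)
    (hΛ : ∀ v : F, Integrable (fun ω => Real.exp ⟪v, X 0 ω⟫) P) (hκ : 0 < κ)
    (hle : ∀ v, logMGF P (X 0) v ≤ κ * ‖v‖ ^ 2) (φ : F →L[ℝ] F) {c : ℝ} (hc : 0 < c) {K : ℝ} (hK : 0 ≤ K) :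
    ∀ᶠ m : ℕ in atTop, ∀ᶠ n : ℕ in atTop, ∀ s : ℕ → ℕ, (∀ k < n, k - s k ≤ n / m + 1) →
      P.real {ω | c * (n : ℝ) ^ 2 ≤ ∑ k ∈ Finset.range n,
        ⟪φ (∑ i ∈ Finset.Ico (s k) k, X i ω), X k ω⟫} ≤ Real.exp (-(n * K)) := by
  obtain ⟨T, c0, hc0, hT1, hT⟩ := exists_norming_finset F
  -- Chosen so that $\frac{K'}n\,c\,n^2=(K+3)n$; the compensators use up $n$ of it.
  set K' := (K + 3) / c with hK'
  have hK'0 : 0 < K' := by positivity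
  set η := 1 / (K' * (‖φ‖ + 1) * (κ + 1)) with hη
  have hη0 : 0 < η := by positivity
  have hηle : κ * (K' * ‖φ‖ * η) ^ 2 ≤ 1 := by
    have e : K' * ‖φ‖ * η = ‖φ‖ / (‖φ‖ + 1) * (1 / (κ + 1)) := by rw [hη]; field_simp
    have h1 : ‖φ‖ / (‖φ‖ + 1) ≤ 1 := by rw [div_le_one (by positivity)]; linarith
    have h2 : K' * ‖φ‖ * η ≤ 1 / (κ + 1) := by
      rw [e]; exact mul_le_of_le_one_left (by positivity) h1
    calc κ * (K' * ‖φ‖ * η) ^ 2 ≤ κ * (1 / (κ + 1)) ^ 2 := by gcongr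
      _ = κ / (κ + 1) ^ 2 := by field_simp
      _ ≤ 1 := by rw [div_le_one (by positivity)]; nlinarith
  -- The Chernoff parameter gives rate $K+4$, of which one unit pays for the variance term once
  -- $2\kappa t^2/m\le1$.
  set t := (K + 4) / (c0 * η) with ht
  have ht0 : 0 < t := by positivity
  have htc : t * (c0 * η) = K + 4 := by rw [ht]; field_simp
  have hlim := tendsto_const_div_atTop_nhds_zero_nat (2 * (κ * t ^ 2))
  filter_upwards [hlim.eventually_le_const one_pos, eventually_gt_atTop 0] with m hm hm0
  have hm0' : (0 : ℝ) < m := by exact_mod_cast hm0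
  filter_upwards [eventually_ge_atTop m, eventually_le_exp_mul (K := (T.card : ℝ)) one_pos,
    eventually_le_exp_mul (K := 2) one_pos] with n hn hTn h2n s hs
  have hn0 : (0 : ℝ) < n := by exact_mod_cast hm0.trans_le hn
  have hnm : (1 : ℝ) ≤ n / m := by rw [le_div_iff₀ hm0', one_mul]; exact_mod_cast hn
  set w : ℕ → Ω → F := fun k ω => ∑ i ∈ Finset.Ico (s k) k, X i ω with hw
  have hbad : ∀ k < n, ∀ v ∈ T, P.real {ω | c0 * (η * n) ≤ ⟪v, w k ω⟫} ≤ Real.exp (-(n * (K + 3))) := by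
    intro k hk v hv
    refine (measureReal_inner_sum_ge_le hmeas hindep hident hΛ hκ hle (hT1 v hv) _ _ ht0.le).trans
      (Real.exp_le_exp.mpr ?_)
    have h1 : ((Finset.Ico (s k) k).card : ℝ) ≤ 2 * (n / m) := by
      rw [Nat.card_Ico]
      have h2 : ((k - s k : ℕ) : ℝ) ≤ ((n / m : ℕ) : ℝ) + 1 := by exact_mod_cast hs k hk
      have h3 : ((n / m : ℕ) : ℝ) ≤ n / m := Nat.cast_div_le
      linarith
    have h4 : ((Finset.Ico (s k) k).card : ℝ) * (κ * t ^ 2) ≤ n := by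
      calc ((Finset.Ico (s k) k).card : ℝ) * (κ * t ^ 2) ≤ 2 * (n / m) * (κ * t ^ 2) := by gcongr
        _ = n * (2 * (κ * t ^ 2) / m) := by ring
        _ ≤ n * 1 := by gcongr
        _ = n := mul_one _
    have h5 : -t * (c0 * (η * n)) = -((K + 4) * n) := by rw [← htc]; ring
    rw [h5]
    linarith
  set bad : Set Ω := ⋃ k ∈ Finset.range n, ⋃ v ∈ T, {ω | c0 * (η * n) ≤ ⟪v, w k ω⟫} with hbadset
  have hPbad : P.real bad ≤ Real.exp (-(n * (K + 1))) := by
    calc P.real bad ≤ ∑ k ∈ Finset.range n, ∑ v ∈ T, P.real {ω | c0 * (η * n) ≤ ⟪v, w k ω⟫} :=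
          (measureReal_biUnion_finset_le _ _).trans
            (Finset.sum_le_sum fun k _ => measureReal_biUnion_finset_le _ _)
      _ ≤ ∑ _k ∈ Finset.range n, ∑ _v ∈ T, Real.exp (-(n * (K + 3))) :=
          Finset.sum_le_sum fun k hk => Finset.sum_le_sum fun v hv => hbad k (Finset.mem_range.mp hk) v hv
      _ = n * (T.card * Real.exp (-(n * (K + 3)))) := by simp
      _ ≤ Real.exp (n * 1) * (Real.exp (n * 1) * Real.exp (-(n * (K + 3)))) := by
          gcongr
          linarith [Real.add_one_le_exp ((n : ℝ) * 1)]
      _ = Real.exp (-(n * (K + 1))) := by rw [← Real.exp_add, ← Real.exp_add]; congr 1; ring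
  set G : ℕ → (ℕ → F) → F := fun k x => (K' / n) • φ (∑ i ∈ Finset.Ico (s k) k, x i) with hG
  have hsm := lintegral_exp_predictable_le_one (κ := κ) hmeas hindep
    (fun k v => lintegral_exp_inner_le hident hΛ hle k v) (G := G)
    (fun k => (φ.measurable.comp (Finset.measurable_fun_sum _ fun i _ => measurable_pi_apply i)).const_smul _)
    (fun k x x' h => by
      simp only [hG]
      rw [Finset.sum_congr rfl fun i hi => h i (Finset.mem_Ico.mp hi).2]) n
  set M : Ω → ℝ := fun ω => ∑ k ∈ Finset.range n, (⟪G k (fun i => X i ω), X k ω⟫ -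
      κ * ‖G k (fun i => X i ω)‖ ^ 2) with hM
  have hPM : P.real {ω | n * (K + 2) ≤ M ω} ≤ Real.exp (-(n * (K + 1))) := by
    have h1 := (mul_meas_ge_le_lintegral₀ (μ := P) (f := fun ω => ENNReal.ofReal (Real.exp (M ω))) (by
      refine (ENNReal.measurable_ofReal.comp (Real.measurable_exp.comp
        (Finset.measurable_fun_sum _ fun k _ => ?_))).aemeasurable
      have hGm : Measurable fun ω => G k (fun i => X i ω) :=
        (φ.measurable.comp (Finset.measurable_fun_sum _ fun i _ => hmeas i)).const_smul _
      exact (hGm.inner (hmeas k)).sub ((hGm.norm.pow_const 2).const_mul κ))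
      (ENNReal.ofReal (Real.exp (n * (K + 2))))).trans hsm
    have h2 : {ω | ENNReal.ofReal (Real.exp (n * (K + 2))) ≤ ENNReal.ofReal (Real.exp (M ω))} =
        {ω | n * (K + 2) ≤ M ω} := by
      ext ω
      simp only [mem_ofPred_eq]
      rw [ENNReal.ofReal_le_ofReal_iff (Real.exp_pos _).le, Real.exp_le_exp]
    rw [h2] at h1
    have h3 := ENNReal.toReal_mono ENNReal.one_ne_top h1
    rw [ENNReal.toReal_mul, ENNReal.toReal_ofReal (Real.exp_pos _).le, ENNReal.toReal_one] at h3
    have h4 : P.real {ω | n * (K + 2) ≤ M ω} ≤ Real.exp (-(n * (K + 2))) := by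
      rw [Real.exp_neg, ← one_div, le_div_iff₀ (Real.exp_pos _), mul_comm]
      exact h3
    exact h4.trans (Real.exp_le_exp.mpr (by nlinarith))
  have hsub : {ω | c * (n : ℝ) ^ 2 ≤ ∑ k ∈ Finset.range n, ⟪φ (w k ω), X k ω⟫} ⊆
      bad ∪ {ω | n * (K + 2) ≤ M ω} := by
    intro ω hω
    by_cases hb : ω ∈ bad
    · exact Or.inl hb
    right
    have hwn : ∀ k ∈ Finset.range n, ‖w k ω‖ ≤ η * n := by
      intro k hk
      by_contra hcon
      obtain ⟨v, hv, hvw⟩ := hT (w k ω)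
      refine hb (mem_iUnion₂.mpr ⟨k, hk, mem_iUnion₂.mpr ⟨v, hv, ?_⟩⟩)
      exact (mul_le_mul_of_nonneg_left (not_le.mp hcon).le hc0.le).trans hvw
    have hω' : c * (n : ℝ) ^ 2 ≤ ∑ k ∈ Finset.range n, ⟪φ (w k ω), X k ω⟫ := hω
    have h1 : ∀ k ∈ Finset.range n, K' / n * ⟪φ (w k ω), X k ω⟫ - 1 ≤
        ⟪G k (fun i => X i ω), X k ω⟫ - κ * ‖G k (fun i => X i ω)‖ ^ 2 := by
      intro k hk
      have h2 : ‖G k (fun i => X i ω)‖ ≤ K' * ‖φ‖ * η := by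
        simp only [hG]
        rw [norm_smul, Real.norm_of_nonneg (by positivity)]
        calc K' / n * ‖φ (w k ω)‖ ≤ K' / n * (‖φ‖ * (η * n)) := by
              gcongr
              exact (φ.le_opNorm _).trans (by gcongr; exact hwn k hk)
          _ = K' * ‖φ‖ * η := by field_simp
      have h3 : κ * ‖G k (fun i => X i ω)‖ ^ 2 ≤ 1 := le_trans (by gcongr) hηle
      have h4 : ⟪G k (fun i => X i ω), X k ω⟫ = K' / n * ⟪φ (w k ω), X k ω⟫ := by
        simp only [hG, real_inner_smul_left, hw]
      rw [h4]
      linarith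
    have h5 := Finset.sum_le_sum h1
    rw [Finset.sum_sub_distrib, ← Finset.mul_sum, Finset.sum_const, Finset.card_range, nsmul_eq_mul,
      mul_one] at h5
    have h6 : K' / n * (c * (n : ℝ) ^ 2) = (K + 3) * n := by rw [hK']; field_simp
    have h7 : K' / n * (c * (n : ℝ) ^ 2) ≤ K' / n * ∑ k ∈ Finset.range n, ⟪φ (w k ω), X k ω⟫ := by gcongr
    show n * (K + 2) ≤ M ω
    linarith
  calc P.real _ ≤ P.real (bad ∪ {ω | n * (K + 2) ≤ M ω}) := measureReal_mono hsub (measure_ne_top P _)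
    _ ≤ P.real bad + P.real {ω | n * (K + 2) ≤ M ω} := measureReal_union_le _ _
    _ ≤ 2 * Real.exp (-(n * (K + 1))) := by linarith
    _ ≤ Real.exp (n * 1) * Real.exp (-(n * (K + 1))) := by gcongr
    _ = Real.exp (-(n * K)) := by rw [← Real.exp_add]; congr 1; ring

end Supermartingale

/-! ### Step two -/

section StepTwo

theorem exists_block_start {m : ℕ} (hm : 0 < m) (n : ℕ) :
    ∃ s : ℕ → ℕ, (∀ k < n, k - s k ≤ n / m + 1) ∧
      ∀ j < m, ∀ k ∈ Finset.Ico (blk n m j) (blk n m (j + 1)), s k = blk n m j := by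
  obtain ⟨g, hg⟩ := exists_block_index (blk_mono n m) m
  refine ⟨fun k => blk n m (g k), fun k hk => ?_, fun j hj k hk => by simp only [hg j hj k hk]⟩
  have hex : ∃ j < m, k ∈ Finset.Ico (blk n m j) (blk n m (j + 1)) := by
    have hex : ∃ i, k < blk n m i := ⟨m, by rwa [blk_self hm]⟩
    classical
    have h1 := Nat.find_spec hex
    have h2 : Nat.find hex ≠ 0 := fun h => by rw [h, blk_zero] at h1; omega
    obtain ⟨j, hj⟩ := Nat.exists_eq_succ_of_ne_zero h2
    have h3 : Nat.find hex ≤ m := Nat.find_min' hex (by rwa [blk_self hm])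
    refine ⟨j, by omega, Finset.mem_Ico.mpr ⟨?_, by rwa [hj] at h1⟩⟩
    exact not_lt.mp (Nat.find_min hex (by omega))
  obtain ⟨j, hj, hkj⟩ := hex
  simp only [hg j hj k hkj]
  have h1 := blk_succ_le n m j
  have h2 := (Finset.mem_Ico.mp hkj).2
  generalize n / m = q at *
  omega

/-- Both products have the same sum, and commutators between different blocks occur in both areas;
only the area inside the blocks survives. -/
theorem expProd_sub_expProd_blocks_of_prod_three {A : Type*} [NormedRing A] [NormedAlgebra ℝ A] {y : ℕ → A}
    (hy : ∀ i j k, y i * y j * y k = 0) {b : ℕ → ℕ} (hb : Monotone b) (hb0 : b 0 = 0) (m : ℕ)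
    {s : ℕ → ℕ} (hs : ∀ j < m, ∀ k ∈ Finset.Ico (b j) (b (j + 1)), s k = b j) :
    expProd y (b m) - expProd (fun j => ∑ k ∈ Finset.Ico (b j) (b (j + 1)), y k) m =
      (2⁻¹ : ℝ) • ∑ k ∈ Finset.range (b m), ((∑ i ∈ Finset.Ico (s k) k, y i) * y k -
        y k * ∑ i ∈ Finset.Ico (s k) k, y i) := by
  have hrange : ∀ (j : ℕ) (f : ℕ → A), ∑ k ∈ Finset.range (b j), f k =
      ∑ i ∈ Finset.range j, ∑ k ∈ Finset.Ico (b i) (b (i + 1)), f k := fun j f => by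
    rw [sum_Ico_blocks hb, hb0, Finset.range_eq_Ico]
  have hY : ∀ i j k, (∑ k ∈ Finset.Ico (b i) (b (i + 1)), y k) * (∑ k ∈ Finset.Ico (b j) (b (j + 1)), y k) *
      (∑ l ∈ Finset.Ico (b k) (b (k + 1)), y l) = 0 := fun i j k => by
    rw [Finset.mul_sum]
    refine Finset.sum_eq_zero fun l _ => ?_
    rw [Finset.sum_mul_sum, Finset.sum_mul]
    refine Finset.sum_eq_zero fun p _ => ?_
    rw [Finset.sum_mul]
    exact Finset.sum_eq_zero fun q _ => hy p q l
  rw [expProd_eq_of_prod_three hy, expProd_eq_of_prod_three hY, ← hrange, add_sub_add_left_eq_sub, ← smul_sub]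
  congr 1
  rw [hrange m, hrange m, ← Finset.sum_sub_distrib]
  refine Finset.sum_congr rfl fun j hj => ?_
  rw [← hrange j, Finset.mul_sum, Finset.sum_mul, ← Finset.sum_sub_distrib, ← Finset.sum_sub_distrib]
  refine Finset.sum_congr rfl fun k hk => ?_
  rw [hs j (Finset.mem_range.mp hj) k hk]
  have h1 : ∑ i ∈ Finset.range k, y i = ∑ i ∈ Finset.range (b j), y i + ∑ i ∈ Finset.Ico (b j) k, y i := by
    rw [Finset.range_eq_Ico, Finset.range_eq_Ico, Finset.sum_Ico_consecutive _ (Nat.zero_le _)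
      (Finset.mem_Ico.mp hk).1]
  rw [h1, add_mul, mul_add]
  abel

variable {F E : Type*} [NormedAddCommGroup F] [InnerProductSpace ℝ F] [FiniteDimensional ℝ F]
  [NormedAddCommGroup E] [InnerProductSpace ℝ E] [FiniteDimensional ℝ E]

theorem exists_inner_bilinear (B : F →L[ℝ] F →L[ℝ] E) (v : E) :
    ∃ φ : F →L[ℝ] F, ∀ w x, ⟪φ w, x⟫ = ⟪v, B w x⟫ := by
  set e := stdOrthonormalBasis ℝ F
  refine ⟨∑ i, ((innerSL ℝ v).comp (B.flip (e i))).smulRight (e i), fun w x => ?_⟩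
  conv_rhs => rw [← e.sum_repr' x]
  simp [sum_inner, inner_sum, real_inner_smul_left, real_inner_smul_right, mul_comm]

variable [MeasurableSpace F] [BorelSpace F]
  {Ω : Type*} [MeasurableSpace Ω] {P : Measure Ω} [IsProbabilityMeasure P] {X : ℕ → Ω → F}
  {A : Type*} [NormedRing A] [NormedAlgebra ℝ A]

/-- The error is $\tau(Z)/(2n^2)$ with $Z$ the sum of the brackets inside blocks. Testing $Z$
against finitely many vectors reduces to scalar quadratic forms. -/
theorem eventually_measureReal_dist_le_of_step_two (hmeas : ∀ k, Measurable (X k)) (hindep : iIndepFun X P)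
    (hident : ∀ k, IdentDistrib (X k) (X 0) P P)
    (hΛ : ∀ v : F, Integrable (fun ω => Real.exp ⟪v, X 0 ω⟫) P) {κ : ℝ} (hκ : 0 < κ)
    (hle : ∀ v, logMGF P (X 0) v ≤ κ * ‖v‖ ^ 2) {σ : F →L[ℝ] A} (hσ : ∀ x y z, σ x * σ y * σ z = 0)
    {τ : E →L[ℝ] A} {B : F →L[ℝ] F →L[ℝ] E} (hB : ∀ x y, σ x * σ y - σ y * σ x = τ (B x y))
    {δ : ℝ} (hδ : 0 < δ) {K : ℝ} (hK : 0 ≤ K) :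
    ∀ᶠ m : ℕ in atTop, ∀ᶠ n : ℕ in atTop, P.real {ω | δ < dist
      (expProd (fun k => σ ((n : ℝ)⁻¹ • X k ω)) n)
      (expProd (fun j => σ (blockSum n m (fun k => X k ω) j)) m)} ≤ Real.exp (-(n * K)) := by
  obtain ⟨T, c, hc, -, hT⟩ := exists_norming_finset E
  choose φ hφ using exists_inner_bilinear B
  -- An error above $\delta$ forces $|Z|\ge2\delta n^2/(\|\tau\|+1)$, and some norming vector sees
  -- the fraction $c$ of it.
  set c1 := c * (2 * δ / (‖τ‖ + 1)) with hc1
  have hc10 : 0 < c1 := by positivity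
  have hev := (Filter.eventually_all_finset T).mpr fun v _ =>
    eventually_measureReal_bilinear_le hmeas hindep hident hΛ hκ hle (φ v) hc10 (K := K + 1) (by linarith)
  filter_upwards [hev, eventually_gt_atTop 0] with m hm hm0
  filter_upwards [(Filter.eventually_all_finset T).mpr hm, eventually_gt_atTop 0,
    eventually_le_exp_mul (K := (T.card : ℝ)) one_pos] with n hn hn0 hTn
  have hn0' : (0 : ℝ) < n := by exact_mod_cast hn0
  obtain ⟨s, hs1, hs2⟩ := exists_block_start hm0 n
  set Z : Ω → E := fun ω => ∑ k ∈ Finset.range n, B (∑ i ∈ Finset.Ico (s k) k, X i ω) (X k ω) with hZ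
  have hdiff : ∀ ω, expProd (fun k => σ ((n : ℝ)⁻¹ • X k ω)) n -
      expProd (fun j => σ (blockSum n m (fun k => X k ω) j)) m = (2⁻¹ * ((n : ℝ)⁻¹ * (n : ℝ)⁻¹)) • τ (Z ω) := by
    intro ω
    have h1 := expProd_sub_expProd_blocks_of_prod_three (y := fun k => σ ((n : ℝ)⁻¹ • X k ω))
      (fun i j k => hσ _ _ _) (blk_mono n m) (blk_zero n m) m hs2
    rw [blk_self hm0] at h1
    have h0 : ∀ j, σ (blockSum n m (fun k => X k ω) j) =
        ∑ k ∈ Finset.Ico (blk n m j) (blk n m (j + 1)), σ ((n : ℝ)⁻¹ • X k ω) := fun j => by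
      simp only [blockSum, map_smul, map_sum, Finset.smul_sum]
    simp only [h0]
    rw [h1, mul_smul, hZ, map_sum, Finset.smul_sum (s := Finset.range n) (r := (n : ℝ)⁻¹ * (n : ℝ)⁻¹)]
    congr 1
    refine Finset.sum_congr rfl fun k _ => ?_
    rw [← map_sum, hB, ← Finset.smul_sum]
    simp only [map_smul, _root_.smul_apply, smul_smul]
  have hsub : {ω | δ < dist (expProd (fun k => σ ((n : ℝ)⁻¹ • X k ω)) n)
      (expProd (fun j => σ (blockSum n m (fun k => X k ω) j)) m)} ⊆
      ⋃ v ∈ T, {ω | c1 * (n : ℝ) ^ 2 ≤ ∑ k ∈ Finset.range n,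
        ⟪φ v (∑ i ∈ Finset.Ico (s k) k, X i ω), X k ω⟫} := by
    intro ω hω
    have hω' : δ < dist (expProd (fun k => σ ((n : ℝ)⁻¹ • X k ω)) n)
      (expProd (fun j => σ (blockSum n m (fun k => X k ω) j)) m) := hω
    rw [dist_eq_norm, hdiff, norm_smul, Real.norm_of_nonneg (by positivity)] at hω'
    obtain ⟨v, hv, hvz⟩ := hT (Z ω)
    refine mem_iUnion₂.mpr ⟨v, hv, ?_⟩
    have e : ∑ k ∈ Finset.range n, ⟪φ v (∑ i ∈ Finset.Ico (s k) k, X i ω), X k ω⟫ = ⟪v, Z ω⟫ := by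
      simp only [hφ, hZ, inner_sum]
    show c1 * (n : ℝ) ^ 2 ≤ _
    rw [e]
    refine le_trans ?_ hvz
    have h1 : ‖τ (Z ω)‖ ≤ (‖τ‖ + 1) * ‖Z ω‖ :=
      (τ.le_opNorm _).trans (by gcongr; linarith)
    have h2 : δ < 2⁻¹ * ((n : ℝ)⁻¹ * (n : ℝ)⁻¹) * ((‖τ‖ + 1) * ‖Z ω‖) := hω'.trans_le (by gcongr)
    have h3 : 2⁻¹ * ((n : ℝ)⁻¹ * (n : ℝ)⁻¹) * ((‖τ‖ + 1) * ‖Z ω‖) =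
        ‖Z ω‖ * (‖τ‖ + 1) / (2 * (n : ℝ) ^ 2) := by field_simp
    rw [h3, lt_div_iff₀ (by positivity)] at h2
    have h4 : 2 * δ / (‖τ‖ + 1) * (n : ℝ) ^ 2 ≤ ‖Z ω‖ := by
      rw [div_mul_eq_mul_div, div_le_iff₀ (by positivity)]
      linarith
    rw [hc1, mul_assoc]
    gcongr
  calc P.real _ ≤ P.real (⋃ v ∈ T, _) := measureReal_mono hsub (measure_ne_top P _)
    _ ≤ ∑ v ∈ T, P.real {ω | c1 * (n : ℝ) ^ 2 ≤ ∑ k ∈ Finset.range n,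
        ⟪φ v (∑ i ∈ Finset.Ico (s k) k, X i ω), X k ω⟫} := measureReal_biUnion_finset_le _ _
    _ ≤ ∑ _v ∈ T, Real.exp (-(n * (K + 1))) := Finset.sum_le_sum fun v hv => hn v hv s hs1
    _ = T.card * Real.exp (-(n * (K + 1))) := by simp
    _ ≤ Real.exp (n * 1) * Real.exp (-(n * (K + 1))) := by gcongr
    _ = Real.exp (-(n * K)) := by rw [← Real.exp_add]; congr 1; ring

end StepTwo

/-! ### Large deviation principles from real bounds -/

section RealBounds

variable {Ω M : Type*} [MeasurableSpace Ω] {P : Measure Ω} [IsProbabilityMeasure P]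

theorem satisfiesLDP_map_of_eventually [TopologicalSpace M] [MeasurableSpace M] [OpensMeasurableSpace M]
    {Y : ℕ → Ω → M} (hY : ∀ n, Measurable (Y n)) {I : M → ℝ≥0∞} (hI : IsRateFunction I)
    (hlow : ∀ O : Set M, IsOpen O → ∀ x ∈ O, ∀ b : ℝ, I x < ENNReal.ofReal b →
      ∀ᶠ n : ℕ in atTop, Real.exp (-(n * b)) ≤ P.real {ω | Y n ω ∈ O})
    (hup : ∀ F : Set M, IsClosed F → ∀ b : ℝ, 0 ≤ b → (∀ x ∈ F, ENNReal.ofReal b < I x) → ∀ b' < b,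
      ∀ᶠ n : ℕ in atTop, P.real {ω | Y n ω ∈ F} ≤ Real.exp (-(n * b'))) :
    SatisfiesLDP (fun n => P.map (Y n)) I := by
  have hlog : ∀ (n : ℕ) (z : ℝ), ENNReal.log (ENNReal.ofReal (Real.exp (-(n * -z)))) = (z : EReal) * n := by
    intro n z
    rw [ENNReal.log_ofReal_of_pos (Real.exp_pos _), Real.log_exp]
    have : -((n : ℝ) * -z) = z * n := by ring
    rw [this]
    push_cast
    rfl
  have hn0 : ∀ {n : ℕ}, 0 < n → (0 : EReal) < n := fun h => by exact_mod_cast h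
  have hnt : ∀ n : ℕ, (n : EReal) ≠ ⊤ := fun n => EReal.natCast_ne_top n
  refine ⟨hI, fun O hO => ?_, fun F hF => ?_⟩
  · rw [EReal.neg_le]
    refine le_iInf₂ fun x hx => ?_
    rw [EReal.neg_le]
    refine EReal.ge_of_forall_gt_iff_ge.mp fun z hz => ?_
    have hz' : I x < ENNReal.ofReal (-z) := by
      rw [EReal.lt_neg_comm, ← EReal.coe_neg] at hz
      rw [← EReal.coe_ennreal_lt_coe_ennreal_iff, EReal.coe_ennreal_ofReal]
      exact hz.trans_le (by exact_mod_cast le_max_left _ _)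
    refine le_liminf_of_le (by isBoundedDefault) ?_
    filter_upwards [hlow O hO x hx (-z) hz', eventually_gt_atTop 0] with n hn hpos
    rw [EReal.le_div_iff_mul_le (hn0 hpos) (hnt n), ← hlog, Measure.map_apply (hY n) hO.measurableSet]
    refine ENNReal.log_monotone ?_
    exact (ENNReal.ofReal_le_iff_le_toReal (measure_ne_top P _)).mpr hn
  · rw [EReal.le_neg]
    by_contra! hcon
    have hcon' := EReal.neg_lt_comm.mp hcon
    obtain ⟨z, hz1, hz2⟩ := EReal.lt_iff_exists_real_btwn.mp hcon'
    refine absurd hz2 (not_lt.mpr (limsup_le_of_le (by isBoundedDefault) ?_))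
    -- For $z\ge0$ the bound is just that probabilities are at most $1$; for $z<0$ a real $b$
    -- strictly between $-z$ and the infimum is available.
    by_cases hz : 0 ≤ z
    · filter_upwards [eventually_gt_atTop 0] with n hpos
      rw [EReal.div_le_iff_le_mul (hn0 hpos) (hnt n)]
      refine le_trans (ENNReal.log_le_zero_iff.mpr ?_) (mul_nonneg (hn0 hpos).le (by exact_mod_cast hz))
      rw [Measure.map_apply (hY n) hF.measurableSet]
      exact prob_le_one
    · rw [EReal.neg_lt_comm, ← EReal.coe_neg] at hz1
      obtain ⟨b, hb1, hb2⟩ := EReal.lt_iff_exists_real_btwn.mp hz1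
      have hb1' : -z < b := by exact_mod_cast hb1
      have hb0 : 0 ≤ b := by linarith [not_le.mp hz]
      have hbI : ∀ x ∈ F, ENNReal.ofReal b < I x := fun x hx => by
        rw [← EReal.coe_ennreal_lt_coe_ennreal_iff, EReal.coe_ennreal_ofReal, max_eq_left hb0]
        exact hb2.trans_le (iInf₂_le x hx)
      filter_upwards [hup F hF b hb0 hbI (-z) hb1', eventually_gt_atTop 0] with n hn hpos
      rw [EReal.div_le_iff_le_mul (hn0 hpos) (hnt n), mul_comm, ← hlog,
        Measure.map_apply (hY n) hF.measurableSet]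
      refine ENNReal.log_monotone ?_
      exact (ENNReal.le_ofReal_iff_toReal_le (measure_ne_top P _) (Real.exp_pos _).le).mpr hn

variable [PseudoMetricSpace M] {W : ℕ → Ω → M} {Φ : ℕ → ℕ → Ω → M}

/-- When the approximation is in the half-size ball, the walk is in $O$ unless the two are far
apart; that event is given a rate at least $b'$, larger than $b$, and is negligible. -/
theorem eventually_exp_le_of_approx (hd : ∀ δ > 0, ∀ K ≥ (0 : ℝ), ∀ᶠ m : ℕ in atTop, ∀ᶠ n : ℕ in atTop,
      P.real {ω | δ < dist (W n ω) (Φ m n ω)} ≤ Real.exp (-(n * K)))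
    {O : Set M} (hO : IsOpen O) {x : M} (hx : x ∈ O) {b b' : ℝ} (hb : b < b')
    (h : ∀ O' : Set M, IsOpen O' → x ∈ O' → ∀ᶠ m : ℕ in atTop, ∀ᶠ n : ℕ in atTop,
      Real.exp (-(n * b)) ≤ P.real {ω | Φ m n ω ∈ O'}) :
    ∀ᶠ n : ℕ in atTop, Real.exp (-(n * b')) ≤ P.real {ω | W n ω ∈ O} := by
  obtain ⟨ε, hε, hεO⟩ := Metric.isOpen_iff.mp hO x hx
  obtain ⟨m, h1, h2⟩ := ((h (Metric.ball x (ε / 2)) Metric.isOpen_ball (Metric.mem_ball_self (half_pos hε))).and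
    (hd (ε / 2) (half_pos hε) (max b' 0) (le_max_right _ _))).exists
  filter_upwards [h1, h2, eventually_le_exp_mul (K := 2) (sub_pos.mpr hb)] with n h1 h2 h3
  have hsub : {ω | Φ m n ω ∈ Metric.ball x (ε / 2)} ⊆
      {ω | W n ω ∈ O} ∪ {ω | ε / 2 < dist (W n ω) (Φ m n ω)} := by
    intro ω hω
    by_cases hc : ε / 2 < dist (W n ω) (Φ m n ω)
    · exact Or.inr hc
    · refine Or.inl (hεO ?_)
      have hω' : dist (Φ m n ω) x < ε / 2 := hω
      have := dist_triangle (W n ω) (Φ m n ω) x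
      rw [Metric.mem_ball]
      linarith [not_lt.mp hc]
  have h4 := (measureReal_mono hsub (measure_ne_top P _)).trans (measureReal_union_le _ _)
  have h5 : Real.exp (-(n * max b' 0)) ≤ Real.exp (-(n * b')) := by gcongr; exact le_max_left _ _
  have h6 : 2 * Real.exp (-(n * b')) ≤ Real.exp (-(n * b)) := by
    calc 2 * Real.exp (-(n * b')) ≤ Real.exp (n * (b' - b)) * Real.exp (-(n * b')) := by gcongr
      _ = Real.exp (-(n * b)) := by rw [← Real.exp_add]; congr 1; ring
  linarith

theorem eventually_measureReal_le_of_approx (hd : ∀ δ > 0, ∀ K ≥ (0 : ℝ), ∀ᶠ m : ℕ in atTop, ∀ᶠ n : ℕ in atTop,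
      P.real {ω | δ < dist (W n ω) (Φ m n ω)} ≤ Real.exp (-(n * K)))
    {C : Set M} {δ b b' : ℝ} (hδ : 0 < δ) (hb : b' < b)
    (h : ∀ᶠ m : ℕ in atTop, ∀ᶠ n : ℕ in atTop,
      P.real {ω | Φ m n ω ∈ Metric.cthickening δ C} ≤ Real.exp (-(n * b))) :
    ∀ᶠ n : ℕ in atTop, P.real {ω | W n ω ∈ C} ≤ Real.exp (-(n * b')) := by
  obtain ⟨m, h1, h2⟩ := (h.and (hd δ hδ (max b 0) (le_max_right _ _))).exists
  have h3 : ∀ᶠ n : ℕ in atTop, P.real {ω | δ < dist (W n ω) (Φ m n ω)} ≤ Real.exp (-(n * b)) := by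
    filter_upwards [h2] with n hn
    exact hn.trans (by gcongr; exact le_max_left _ _)
  filter_upwards [eventually_measureReal_union_le hb h1 h3] with n hn
  refine (measureReal_mono (fun ω hω => ?_) (measure_ne_top P _)).trans hn
  by_cases hc : δ < dist (W n ω) (Φ m n ω)
  · exact Or.inr hc
  · exact Or.inl (Metric.mem_cthickening_of_dist_le _ _ _ _ hω (by rw [dist_comm]; exact not_lt.mp hc))

end RealBounds

/-! ### Large deviations of products of exponentials -/

section ExpProd

variable {F : Type*} [NormedAddCommGroup F] [InnerProductSpace ℝ F] [FiniteDimensional ℝ F]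
  [MeasurableSpace F] [BorelSpace F]
  {Ω : Type*} [MeasurableSpace Ω] {P : Measure Ω} [IsProbabilityMeasure P] {X : ℕ → Ω → F}
  {A : Type*} [NormedRing A] [NormedAlgebra ℝ A] [NormOneClass A] [CompleteSpace A] {σ : F →L[ℝ] A} {N : ℕ}

theorem eventually_exp_le_measureReal_expProd (hmeas : ∀ k, Measurable (X k)) (hindep : iIndepFun X P)
    (hident : ∀ k, IdentDistrib (X k) (X 0) P P)
    (hΛ : ∀ v : F, Integrable (fun ω => Real.exp ⟪v, X 0 ω⟫) P)
    (hσ : ∀ v : Fin N → F, (List.ofFn fun i => σ (v i)).prod = 0)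
    (hd : ∀ δ > 0, ∀ K ≥ (0 : ℝ), ∀ᶠ m : ℕ in atTop, ∀ᶠ n : ℕ in atTop,
      P.real {ω | δ < dist (expProd (fun k => σ ((n : ℝ)⁻¹ • X k ω)) n)
        (expProd (fun j => σ (blockSum n m (fun k => X k ω) j)) m)} ≤ Real.exp (-(n * K)))
    {O : Set A} (hO : IsOpen O) {M : A} (hM : M ∈ O) {b : ℝ}
    (hb : ctlRate (logMGF P (X 0)) N σ M < ENNReal.ofReal b) :
    ∀ᶠ n : ℕ in atTop, Real.exp (-(n * b)) ≤ P.real {ω | expProd (fun k => σ ((n : ℝ)⁻¹ • X k ω)) n ∈ O} := by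
  obtain ⟨c, hc1, hc2⟩ := exists_between hb
  have hc : ENNReal.ofReal c.toReal = c := ENNReal.ofReal_toReal (ne_top_of_lt hc2)
  refine eventually_exp_le_of_approx hd hO hM (ENNReal.toReal_lt_of_lt_ofReal hc2) fun O' hO' hMO' => ?_
  -- The approximation by step controls is indexed by $m+1$ cells, hence the shift.
  filter_upwards [(tendsto_sub_atTop_nat 1).eventually (eventually_exists_expProd_mem hσ hO' hMO' hc1),
    eventually_gt_atTop 0] with m hm hm0
  rw [Nat.sub_add_cancel hm0] at hm
  obtain ⟨a, ha1, ha2⟩ := hm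
  exact eventually_le_measureReal_expProd_blockSum hmeas hindep hident hΛ hm0 hO' ha1 (by rwa [hc])

theorem eventually_measureReal_expProd_le (hmeas : ∀ k, Measurable (X k)) (hindep : iIndepFun X P)
    (hident : ∀ k, IdentDistrib (X k) (X 0) P P)
    (hΛ : ∀ v : F, Integrable (fun ω => Real.exp ⟪v, X 0 ω⟫) P) {κ : ℝ} (hκ : 0 < κ)
    (hle : ∀ v, logMGF P (X 0) v ≤ κ * ‖v‖ ^ 2)
    (hσ : ∀ v : Fin N → F, (List.ofFn fun i => σ (v i)).prod = 0)
    (hd : ∀ δ > 0, ∀ K ≥ (0 : ℝ), ∀ᶠ m : ℕ in atTop, ∀ᶠ n : ℕ in atTop,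
      P.real {ω | δ < dist (expProd (fun k => σ ((n : ℝ)⁻¹ • X k ω)) n)
        (expProd (fun j => σ (blockSum n m (fun k => X k ω) j)) m)} ≤ Real.exp (-(n * K)))
    {C : Set A} (hC : IsClosed C) {b b' : ℝ} (hb0 : 0 ≤ b)
    (hb : ∀ M ∈ C, ENNReal.ofReal b < ctlRate (logMGF P (X 0)) N σ M) (hb' : b' < b) :
    ∀ᶠ n : ℕ in atTop, P.real {ω | expProd (fun k => σ ((n : ℝ)⁻¹ • X k ω)) n ∈ C} ≤ Real.exp (-(n * b')) := by
  obtain ⟨δ, hδ, hδC⟩ := exists_thickening_le_ctlRate (differentiable_logMGF (hmeas 0) hΛ).continuous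
    logMGF_zero hκ hle hC hb0 hb
  obtain ⟨c, hc1, hc2⟩ := exists_between hb'
  refine eventually_measureReal_le_of_approx hd (half_pos hδ) hc1 ?_
  filter_upwards [eventually_gt_atTop 0] with m hm
  refine eventually_measureReal_expProd_blockSum_le hmeas hindep hident hΛ hσ hm Metric.isClosed_cthickening
    (fun M hM => ?_) hc2
  obtain ⟨M', hM', hd'⟩ := Metric.mem_thickening_iff.mp
    (Metric.cthickening_subset_thickening' hδ (half_lt_self hδ) C hM)
  exact hδC M M' hM' hd'.le

end ExpProd

/-! ### Large deviations of walks -/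

namespace StratifiedLieAlgebra

variable {E : Type*} [NormedAddCommGroup E] [InnerProductSpace ℝ E] [FiniteDimensional ℝ E]
  [MeasurableSpace E] [BorelSpace E] {r : ℕ} {S : StratifiedLieAlgebra E r}
  {A : Type*} [NormedRing A] [NormedAlgebra ℝ A] [CompleteSpace A] {N : ℕ}

theorem NilRep.emb_dilation_walk (R : S.NilRep A N) (hN : r ≤ N) (a : ℝ) (x : ℕ → S.H) (n : ℕ) :
    R.emb (S.dilation a (S.walk x n)) = expProd (fun k => R.sigma (a • x k)) n := by
  rw [dilation_walk, R.emb_walk hN]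
  rfl

theorem NilRep.exists_sigma_commutator (R : S.NilRep A N) : ∃ B : S.H →L[ℝ] S.H →L[ℝ] E,
    ∀ x y, R.sigma x * R.sigma y - R.sigma y * R.sigma x = R.rho (B x y) :=
  ⟨LinearMap.toContinuousLinearMap ((LinearMap.toContinuousLinearMap :
    (S.H →ₗ[ℝ] E) ≃ₗ[ℝ] (S.H →L[ℝ] E)).toLinearMap ∘ₗ S.bracket.domRestrict₁₂ S.H S.H),
    fun x y => (R.map_bracket x y).symm⟩

theorem NilRep.sigma_mul_mul_eq_zero (R : S.NilRep A 3) (x y z : S.H) :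
    R.sigma x * R.sigma y * R.sigma z = 0 := by
  have := R.sigma_prod_eq_zero ![x, y, z]
  simpa [List.ofFn_succ, mul_assoc] using this

variable [FiniteDimensional ℝ A]

theorem NilRep.continuous_dilation_walk (R : S.NilRep A N) (hN : r ≤ N) (a : ℝ) (n : ℕ) :
    Continuous fun x : ℕ → S.H => S.dilation a (S.walk x n) := by
  have h1 : ∀ n, Continuous fun x : ℕ → S.H => expProd (fun k => R.sigma (a • x k)) n := by
    intro n
    induction n with
    | zero => exact continuous_const
    | succ n ih => exact ih.mul (continuous_exp_real.comp (by fun_prop))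
  have h2 : (fun x : ℕ → S.H => S.dilation a (S.walk x n)) =
      fun x => R.theta (expProd (fun k => R.sigma (a • x k)) n) := by
    ext1 x
    rw [← R.emb_dilation_walk hN, R.theta_emb]
  rw [h2]
  exact R.contDiff_theta.continuous.comp (h1 n)

variable {Ω : Type*} [MeasurableSpace Ω] {P : Measure Ω} [IsProbabilityMeasure P] {X : ℕ → Ω → S.H}

/-- Lower semicontinuity is pulled back through the continuous embedding. The unit has rate $0$,
reached by the zero control, whose cost vanishes because $\Lambda\ge0$. -/
theorem NilRep.isRateFunction_rate [NormOneClass A] (R : S.NilRep A N) (hN : r ≤ N) {Λ : S.H → ℝ}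
    (hΛ : Continuous Λ) (hΛ0 : Λ 0 = 0) (hnn : ∀ v, 0 ≤ Λ v) {κ : ℝ} (hκ : 0 < κ)
    (hle : ∀ v, Λ v ≤ κ * ‖v‖ ^ 2) : IsRateFunction (S.rate (legendre Λ)) := by
  have h : S.rate (legendre Λ) = fun g => ctlRate Λ N R.sigma (R.emb g) :=
    funext fun g => R.rate_eq_ctlRate hN hκ hle g
  rw [h]
  refine ⟨(lowerSemicontinuous_ctlRate hΛ hΛ0 hκ hle).comp R.contDiff_emb.continuous, 0, ?_⟩
  have h1 := ctlRate_expProd_le (Λ := Λ) R.sigma_prod_eq_zero one_pos 0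
  have h2 : cost Λ (0 : S.H) = 0 := by
    refine le_antisymm (iSup_le fun v => le_of_eq ?_) zero_le
    exact ENNReal.ofReal_of_nonpos (by simpa using hnn v)
  simp only [expProd, Pi.zero_apply, smul_zero, map_zero, NormedSpace.exp_zero, mul_one, h2, mul_zero,
    Finset.sum_const_zero] at h1
  simp only [R.emb_zero]
  exact ne_top_of_le_ne_top ENNReal.zero_ne_top h1

theorem NilRep.satisfiesLDP_walk [NormOneClass A] (R : S.NilRep A N) (hN : r ≤ N)
    (hmeas : ∀ k, Measurable (X k)) (hindep : iIndepFun X P)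
    (hident : ∀ k, IdentDistrib (X k) (X 0) P P)
    (hΛ : ∀ v : S.H, Integrable (fun ω => Real.exp ⟪v, X 0 ω⟫) P) (hmean : ∫ ω, X 0 ω ∂P = 0)
    {κ : ℝ} (hκ : 0 < κ) (hle : ∀ v, logMGF P (X 0) v ≤ κ * ‖v‖ ^ 2)
    (hd : ∀ δ > 0, ∀ K ≥ (0 : ℝ), ∀ᶠ m : ℕ in atTop, ∀ᶠ n : ℕ in atTop,
      P.real {ω | δ < dist (expProd (fun k => R.sigma ((n : ℝ)⁻¹ • X k ω)) n)
        (expProd (fun j => R.sigma (blockSum n m (fun k => X k ω) j)) m)} ≤ Real.exp (-(n * K))) :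
    SatisfiesLDP (fun n : ℕ => P.map (fun ω => S.dilation (n : ℝ)⁻¹ (S.walk (fun k => X k ω) n)))
      (S.rate (legendre (logMGF P (X 0)))) := by
  have hrate := R.rate_eq_ctlRate hN hκ hle
  have hθ : ∀ (n : ℕ) ω, R.theta (expProd (fun k => R.sigma ((n : ℝ)⁻¹ • X k ω)) n) =
      S.dilation (n : ℝ)⁻¹ (S.walk (fun k => X k ω) n) := fun n ω => by
    rw [← R.emb_dilation_walk hN, R.theta_emb]
  refine satisfiesLDP_map_of_eventually
    (Y := fun n ω => S.dilation (n : ℝ)⁻¹ (S.walk (fun k => X k ω) n)) (fun n => (R.continuous_dilation_walk hN _ n).measurable.comp (measurable_pi_lambda _ hmeas))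
    (R.isRateFunction_rate hN (differentiable_logMGF (hmeas 0) hΛ).continuous logMGF_zero
      (logMGF_nonneg (hmeas 0) hΛ hmean) hκ hle) (fun O hO x hx b hb => ?_) fun F hF b hb0 hb b' hb' => ?_
  · rw [hrate] at hb
    have := eventually_exp_le_measureReal_expProd hmeas hindep hident hΛ R.sigma_prod_eq_zero hd
      (hO.preimage R.contDiff_theta.continuous) (M := R.emb x) (by rwa [mem_preimage, R.theta_emb]) hb
    simpa only [mem_preimage, hθ] using this
  · have := eventually_measureReal_expProd_le hmeas hindep hident hΛ hκ hle R.sigma_prod_eq_zero hd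
      -- The map `theta` is defined on the whole algebra; the second set is closed, contains the
      -- walk, and is where the rate in the algebra is the rate in the group.
      (C := R.theta ⁻¹' F ∩ {M | R.emb (R.theta M) = M})
      ((hF.preimage R.contDiff_theta.continuous).inter
        (isClosed_eq (R.contDiff_emb.continuous.comp R.contDiff_theta.continuous) continuous_id)) hb0
      (fun M hM => by
        have h1 := hb _ hM.1
        rwa [hrate, hM.2] at h1) hb'
    filter_upwards [this] with n hn
    refine le_trans (measureReal_mono ?_ (measure_ne_top P _)) hn
    refine fun ω (hω : _ ∈ F) => ⟨?_, ?_⟩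
    · rw [mem_preimage, hθ]
      exact hω
    · rw [mem_ofPred_eq, hθ, R.emb_dilation_walk hN]

end StratifiedLieAlgebra

end

theorem theorem1p1 {E : Type*} [NormedAddCommGroup E] [InnerProductSpace ℝ E]
    [FiniteDimensional ℝ E] [MeasurableSpace E] [BorelSpace E]
    {r : ℕ} (S : StratifiedLieAlgebra E r)
    {Ω : Type*} [MeasurableSpace Ω] (P : Measure Ω) [IsProbabilityMeasure P]
    (X : ℕ → Ω → S.H) (hmeas : ∀ k, Measurable (X k))
    (hindep : iIndepFun X P) (hident : ∀ k, IdentDistrib (X k) (X 0) P P)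
    (hΛ : ∀ v : S.H, Integrable (fun ω => Real.exp ⟪v, X 0 ω⟫) P)
    (hmean : ∫ ω, X 0 ω ∂P = 0)
    (hcase :
      (r = 2 ∧ ∀ v : S.H, ∃ c : ℝ≥0, HasSubgaussianMGF (fun ω => ⟪v, X 0 ω⟫) c P) ∨
      (3 ≤ r ∧ ∃ R : ℝ, ∀ᵐ ω ∂P, ‖X 0 ω‖ ≤ R)) :
    SatisfiesLDP
      (fun n : ℕ => P.map (fun ω => S.dilation (n : ℝ)⁻¹ (S.walk (fun k => X k ω) n)))
      (S.rate (legendre (logMGF P (X 0)))) := by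
  rcases hcase with ⟨rfl, hsub⟩ | ⟨-, R, hR⟩
  · obtain ⟨κ, hκ, hle⟩ := exists_logMGF_le hΛ hsub
    refine S.nilRep.satisfiesLDP_walk (Nat.le_succ 2) hmeas hindep hident hΛ hmean hκ hle fun δ hδ K hK => ?_
    obtain ⟨B, hB⟩ := S.nilRep.exists_sigma_commutator
    -- For $r=2$ the representation has $N=3$, so triple products vanish.
    exact eventually_measureReal_dist_le_of_step_two hmeas hindep hident hΛ hκ hle
      S.nilRep.sigma_mul_mul_eq_zero hB hδ hK
  · obtain ⟨κ, hκ, hle⟩ := exists_logMGF_le hΛ (hasSubgaussianMGF_inner_of_bounded (hmeas 0) hmean hR)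
    refine S.nilRep.satisfiesLDP_walk (Nat.le_succ r) hmeas hindep hident hΛ hmean hκ hle fun δ hδ K _ => ?_
    exact exists_eventually_measureReal_dist_le_of_bounded _ (fun k => (hident k).symm.ae_snd
      (measurableSet_le measurable_norm measurable_const) hR) hδ K
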